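/- Let $(\mathbb X,\mathcal X)$ be a measurable space, $\Lambda$ a $\sigma$-finite measure on $\mathbb X$, and let $\mathbf N$ be the space of all $\sigma$-finite measures on $\mathbb X$ with values in $\{0,1,2,\dots,\infty\}$, equipped with the smallest $\sigma$-field making all maps $\mu\mapsto\mu(B)$, $B\in\mathcal X$, measurable. For a $\sigma$-finite measure $\Lambda'$ on $\mathbb X$, let $\Pi_{\Lambda'}$ denote the distribution on $\mathbf N$ of a Poisson process with intensity measure $\Lambda'$. On a probability space $(\Omega,\mathcal A,\mathbb P)$, let $\eta$ be a Poisson process on $\mathbb X$ with intensity measure $\Lambda$ which is proper, that is, almost surely $\eta=\sum_{n=1}^{\kappa}\delta_{X_n}$ for random elements $X_1,X_2,\dots$ of $\mathbb X$ and a $\{0,1,2,\dots,\infty\}$-valued random variable $\kappa$. For $t\in[0,1]$ let $\eta_t=\sum_{n=1}^{\kappa}Y_n^{(t)}\delta_{X_n}$ be the $t$-thinning of $\eta$, where for each $t$ the variables $Y^{(t)}_1,Y^{(t)}_2,\dots$ are independent with distribution $(1-t)\delta_0+t\delta_1$ and independent of $(\kappa,X_1,X_2,\dots)$, and $(t,\omega)\mapsto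 Y^{(t)}_n(\omega)$ is measurable for each $n$. For measurable $f\colon\mathbf N\to\mathbb R$ write $D_xf(\mu)=f(\mu+\delta_x)-f(\mu)$. An integral $\int h(x,\eta-\delta_x)\,\eta(dx)$ is understood as $\sum_{n=1}^{\kappa}h(X_n,\eta-\delta_{X_n})$. Let $f\colon\mathbf N\to\mathbb R$ be measurable, let $F=f(\eta)$ almost surely with $F\in L^2(\mathbb P)$, and put $D_xF=D_xf(\eta)$, $D_xe^{sF}=e^{sf(\eta+\delta_x)}-e^{sf(\eta)}$, and $$s_F=\sup\{s\ge 0: e^{sF}\in L^2(\mathbb P),\ De^{sF}\in L^2(\mathbb P\otimes\Lambda)\}\in[0,\infty].$$ Suppose that $DF\ge 0$ holds $(\mathbb P\otimes\Lambda)$-almost everywhere and that there are a measurable function $g\colon\mathbb X\to[0,\infty)$ and constants $a>0$, $b\ge 0$ such that almost surely $$\int_0^1\int_{\mathbf N}D_xf(\eta_t+\mu)\,\Pi_{(1-t)\Lambda}(d\mu)\,dt\le g(x)\quad\text{for }\Lambda\text{-a.e. }x\in\mathbb X,$$ and almost surely $$\int D_xf(\eta-\delta_x)\,g(x)\,\eta(dx)\le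 aF+b .$$ Then, for all $r\ge 0$ (with $\inf\emptyset=\infty$), $$\mathbb P(F-\mathbb E[F]\ge r)\le\exp\bigg(\inf_{0<s<a^{-1}\wedge s_F}\bigg(-\frac{bs}{a}-s\,\mathbb E[F]-\bigg(\frac{\mathbb E[F]}{a}+\frac{b}{a^2}\bigg)\log(1-as)-sr\bigg)\bigg).$$ If moreover $a^{-1}\le s_F$, then for all $r\ge 0$ $$\mathbb P(F-\mathbb E[F]\ge r)\le\exp\bigg(-\frac1a\bigg[r+\bigg(\mathbb E[F]+\frac ba\bigg)\log\bigg(\frac{\mathbb E[F]+b/a}{r+\mathbb E[F]+b/a}\bigg)\bigg]\bigg),$$ where the product with the logarithm is read as $0$ if $\mathbb E[F]+b/a=0$. -/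

import Mathlib

open MeasureTheory ProbabilityTheory
open scoped ENNReal NNReal

noncomputable section

namespace PoissonConcentration

variable {X : Type*} [MeasurableSpace X]

/-- A measure is a counting configuration if it is σ-finite and takes values in `{0, 1, 2, …, ∞}`
on measurable sets. -/
def IsConfig (μ : Measure X) : Prop :=
  SigmaFinite μ ∧ ∀ B : Set X, MeasurableSet B → ∃ n : ℕ∞, μ B = (n : ℝ≥0∞)

variable (X) in
/-- The space `𝐍(X)` of all σ-finite measures on `X` with values in `{0, 1, 2, …, ∞}`. -/
def Config : Type _ := {μ : Measure X // IsConfig μ}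

namespace Config

/-- The measure underlying a configuration. -/
def toMeasure (μ : Config X) : Measure X := μ.1

/-- The smallest σ-field on `𝐍(X)` making all evaluations `μ ↦ μ B`, `B` measurable, measurable
(the trace of the corresponding σ-field on `Measure X`). -/
instance : MeasurableSpace (Config X) :=
  MeasurableSpace.comap Config.toMeasure inferInstance

instance : Zero (Config X) :=
  ⟨⟨0, inferInstance, fun _ _ => ⟨0, by simp⟩⟩⟩

instance : Add (Config X) :=
  ⟨fun μ ν => ⟨μ.1 + ν.1, by
    obtain ⟨hμ, hμ'⟩ := μ.2
    obtain ⟨hν, hν'⟩ := ν.2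
    refine ⟨inferInstance, fun B hB => ?_⟩
    obtain ⟨m, hm⟩ := hμ' B hB
    obtain ⟨n, hn⟩ := hν' B hB
    exact ⟨m + n, by simp [hm, hn]⟩⟩⟩

/-- The unit mass `δ_x` as a configuration. -/
def point (x : X) : Config X :=
  ⟨Measure.dirac x, inferInstance, fun B hB => by
    classical
    by_cases hx : x ∈ B
    · exact ⟨1, by simp [Measure.dirac_apply' x hB, hx]⟩
    · exact ⟨0, by simp [Measure.dirac_apply' x hB, hx]⟩⟩

open Classical in
/-- Regard a measure as a configuration, with value `0` if it is none. -/
def ofMeasure (μ : Measure X) : Config X :=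
  if h : IsConfig μ then ⟨μ, h⟩ else 0

end Config

/-- The difference operator `D_x f(μ) = f(μ + δ_x) - f(μ)`. -/
def diffOp (f : Config X → ℝ) (x : X) (μ : Config X) : ℝ :=
  f (μ + Config.point x) - f μ

/-- `η` is a Poisson process with intensity measure `Λ`: the number of points in a measurable set
`B` is Poisson distributed with parameter `Λ B` (almost surely infinite if `Λ B = ∞`), and the
numbers of points in finitely many pairwise disjoint measurable sets are independent. -/
structure IsPoissonProcess {Ω : Type*} [MeasurableSpace Ω] (P : Measure Ω)
    (η : Ω → Config X) (Λ : Measure X) : Prop where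
  measurable : Measurable η
  law_of_ne_top : ∀ B : Set X, MeasurableSet B → Λ B ≠ ∞ →
    P.map (fun ω => (η ω).toMeasure B)
      = (poissonMeasure (Λ B).toNNReal).map (fun n : ℕ => (n : ℝ≥0∞))
  law_of_eq_top : ∀ B : Set X, MeasurableSet B → Λ B = ∞ →
    ∀ᵐ ω ∂P, (η ω).toMeasure B = ∞
  indep : ∀ (m : ℕ) (B : Fin m → Set X), (∀ i, MeasurableSet (B i)) →
    Pairwise (fun i j => Disjoint (B i) (B j)) →
    iIndepFun (fun i ω => (η ω).toMeasure (B i)) P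

open Classical in
/-- `Π_Λ`, the distribution on `𝐍(X)` of a Poisson process with intensity measure `Λ`: the
probability measure (unique, and existing for σ-finite `Λ`) under which the identity of `𝐍(X)` is
a Poisson process with intensity measure `Λ`. -/
def poissonLaw (Λ : Measure X) : Measure (Config X) :=
  if h : ∃ Q : Measure (Config X), IsProbabilityMeasure Q ∧ IsPoissonProcess Q id Λ
  then h.choose else 0

variable {Ω : Type*} [MeasurableSpace Ω]

/-- The sum of the unit masses `δ_{ξ n}` over those `n < κ` that satisfy `keep n`. -/
def pointSum (κ : ℕ∞) (ξ : ℕ → X) (keep : ℕ → Bool) : Measure X :=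
  Measure.sum fun n : ℕ =>
    if (n : ℕ∞) < κ ∧ keep n = true then Measure.dirac (ξ n) else 0

/-- The random elements `ξ 0, ξ 1, …` of `X` and the random number `κ` of points represent the
point process `η` as `∑_{n < κ} δ_{ξ n}`, almost surely; that is, they witness that `η` is
proper. -/
structure IsProperRep (P : Measure Ω) (η : Ω → Config X) (κ : Ω → ℕ∞) (ξ : ℕ → Ω → X) :
    Prop where
  measurable_card : Measurable κ
  measurable_point : ∀ n, Measurable (ξ n)
  eq_sum : ∀ᵐ ω ∂P,
    (η ω).toMeasure = pointSum (κ ω) (fun n => ξ n ω) (fun _ => true)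

/-- For each `t ∈ [0, 1]`, the marks `Y t 0, Y t 1, …` (with `true` for `1` and `false` for `0`)
are independent with distribution `(1 - t) δ_0 + t δ_1`, and independent of the points `(κ, ξ)`.
Nothing is said on the joint distribution for distinct `t` apart from joint measurability, without
which integrals over `t` would make no sense; `Y t n = 1{U n ≤ t}` with independent uniform `U n`
is an example. -/
structure IsThinningMarks (P : Measure Ω) (κ : Ω → ℕ∞) (ξ : ℕ → Ω → X)
    (Y : ℝ → ℕ → Ω → Bool) : Prop where
  measurable : ∀ n, Measurable fun p : ℝ × Ω => Y p.1 n p.2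
  law : ∀ t ∈ Set.Icc (0 : ℝ) 1, ∀ n, P.map (Y t n)
    = ENNReal.ofReal (1 - t) • Measure.dirac false + ENNReal.ofReal t • Measure.dirac true
  indep : ∀ t ∈ Set.Icc (0 : ℝ) 1, iIndepFun (fun n => Y t n) P
  indep_points : ∀ t ∈ Set.Icc (0 : ℝ) 1,
    IndepFun (fun ω n => Y t n ω) (fun ω => (κ ω, fun n => ξ n ω)) P

/-- The `t`-thinning `η_t = ∑_{n < κ} Y_n δ_{ξ n}` for the marks `Y_n = Y t n`. -/
def thinning (κ : Ω → ℕ∞) (ξ : ℕ → Ω → X) (Y : ℝ → ℕ → Ω → Bool) (t : ℝ) (ω : Ω) : Config X :=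
  Config.ofMeasure (pointSum (κ ω) (fun n => ξ n ω) (fun n => Y t n ω))

/-- `∫₀¹ ∫ D_x f(η_t + μ) Π_{(1-t)Λ}(dμ) dt`, as an element of `[0, ∞]`, for functionals with
`D f ≥ 0`. -/
def avgDiff (Λ : Measure X) (f : Config X → ℝ) (κ : Ω → ℕ∞) (ξ : ℕ → Ω → X)
    (Y : ℝ → ℕ → Ω → Bool) (x : X) (ω : Ω) : ℝ≥0∞ :=
  ∫⁻ t in Set.Icc (0 : ℝ) 1,
    ∫⁻ μ, ENNReal.ofReal (diffOp f x (thinning κ ξ Y t ω + μ))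
      ∂(poissonLaw (ENNReal.ofReal (1 - t) • Λ))

/-- `∫ D_x f(η - δ_x) g(x) η(dx)`, as an element of `[0, ∞]`, for functionals with `D f ≥ 0`:
for `η = ∑_{n < κ} δ_{ξ n}` the integral with respect to `η` is the sum over the points `ξ n`,
`n < κ`. -/
def reducedIntegral (η : Ω → Config X) (κ : Ω → ℕ∞) (ξ : ℕ → Ω → X)
    (f : Config X → ℝ) (g : X → ℝ≥0) (ω : Ω) : ℝ≥0∞ :=
  ∑' n : ℕ, if (n : ℕ∞) < κ ω then
    ENNReal.ofReal (diffOp f (ξ n ω)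
      (Config.ofMeasure ((η ω).toMeasure - Measure.dirac (ξ n ω)))) * g (ξ n ω)
  else 0

/-- `s_F = sup {s ≥ 0 : e^{sF} ∈ L²(P), D e^{sF} ∈ L²(P ⊗ Λ)}` for `F = f(η)`, possibly `∞`. -/
def sCrit (P : Measure Ω) (Λ : Measure X) (η : Ω → Config X) (f : Config X → ℝ) : ℝ≥0∞ :=
  sSup {S : ℝ≥0∞ | ∃ s : ℝ≥0, S = s ∧
    MemLp (fun ω => Real.exp (s * f (η ω))) 2 P ∧
    MemLp (fun p : Ω × X => diffOp (fun μ => Real.exp (s * f μ)) p.2 (η p.1)) 2 (P.prod Λ)}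

end PoissonConcentration

end

noncomputable section

namespace PoissonConcentration

open Filter Topology BoundedContinuousFunction

variable {X : Type*} [MeasurableSpace X] {Ω : Type*} [MeasurableSpace Ω]

/-! The engine is a covariance formula obtained by interpolation. Let `η^t` be the superposition of
the `t`-thinning of `η` and a `(1-t)`-thinning of an independent copy; it has the law of `η`, it is
independent of `η` at `t = 0` and equals `η` at `t = 1`. The joint Laplace functional of `η` and
`η^t` is `L(u) L(v) exp(t ∫ (1 - e^{-u})(1 - e^{-v}) dΛ)`. Adding a point at `x` multiplies
`e^{-η(u)}` by `e^{-u(x)}`, so the `t`-derivative of this expression is the expectation of the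
product of two difference operators, integrated over `x`. For general functionals this becomes
`Cov(γ(η), φ(η)) = ∫₀¹ ∫ E[D_xγ(η) D_xφ(η^t)] Λ(dx) dt`.

Take `γ = e^{sf}` and `φ = f`. Averaging `D_xf(η^t)` over the copy and over `t` gives at most `g(x)`
by hypothesis. Convexity gives `D_x e^{sF} ≤ s e^{s f(η + δ_x)} D_xf(η)`, and the Mecke equation
turns the integral of the right side times `g(x)` into `s e^{sF} ∫ D_xf(η - δ_x) g(x) η(dx)`, in
expectation. Hence `Cov(e^{sF}, F) ≤ s E[e^{sF}(aF + b)]`. For the moment generating function `M`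
and `m = E F` this says `(1 - as) M' ≤ (m + bs) M`. Integrating from `0` bounds `log M`, and
Chernoff's inequality with the best `s` gives both tail bounds.

The formula for the Laplace functional is `laplace_resample`. `covariance_resample` lifts the
covariance identity from exponential to bounded functionals on sets of finite intensity, by reading
it as an equality of finite measures. `ofReal_covariance_le` passes to the whole space by martingale
convergence, keeping an inequality only. `mecke` follows from the Laplace functional by
differentiation. `integral_mul_exp_le` removes truncation of `f` and yields the differential
inequality, which `cgf_le_of_integral_mul_exp_le` integrates. -/

/-! ### Exponentials on `[0, ∞]` and the measures they determine -/

/-- The function `y ↦ e^{-y}` on `[0, ∞]`, with `e^{-∞} = 0`. -/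
def expNeg (y : ℝ≥0∞) : ℝ := (EReal.exp (-(y : EReal))).toReal

lemma expNeg_top : expNeg ∞ = 0 := by simp [expNeg]

lemma expNeg_coe (y : ℝ≥0) : expNeg y = Real.exp (-y) := by
  have : (-((y : ℝ≥0∞) : EReal)) = ((-(y : ℝ) : ℝ) : EReal) := by
    rw [EReal.coe_neg]; rfl
  rw [expNeg, this, EReal.exp_coe, ENNReal.toReal_ofReal (Real.exp_pos _).le]

lemma expNeg_of_ne_top {y : ℝ≥0∞} (hy : y ≠ ∞) : expNeg y = Real.exp (-y.toReal) := by
  lift y to ℝ≥0 using hy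
  exact expNeg_coe y

lemma expNeg_ofReal {y : ℝ} (hy : 0 ≤ y) : expNeg (ENNReal.ofReal y) = Real.exp (-y) := by
  rw [expNeg_of_ne_top ENNReal.ofReal_ne_top, ENNReal.toReal_ofReal hy]

@[simp] lemma expNeg_zero : expNeg 0 = 1 := by simp [expNeg]

lemma expNeg_add (x y : ℝ≥0∞) : expNeg (x + y) = expNeg x * expNeg y := by
  induction x with
  | top => simp [expNeg_top]
  | coe x =>
    induction y with
    | top => simp [expNeg_top]
    | coe y =>
      rw [← ENNReal.coe_add, expNeg_coe, expNeg_coe, expNeg_coe, ← Real.exp_add]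
      push_cast; ring_nf

lemma expNeg_nonneg (y : ℝ≥0∞) : 0 ≤ expNeg y := ENNReal.toReal_nonneg

lemma expNeg_le_one (y : ℝ≥0∞) : expNeg y ≤ 1 := by
  induction y with
  | top => simp [expNeg_top]
  | coe y => rw [expNeg_coe]; simp

lemma abs_expNeg_le_one (y : ℝ≥0∞) : |expNeg y| ≤ 1 := by
  rw [abs_of_nonneg (expNeg_nonneg y)]; exact expNeg_le_one y

lemma expNeg_injective : Function.Injective expNeg := by
  intro x y h
  induction x with
  | top =>
    induction y with
    | top => rfl
    | coe y => rw [expNeg_top, expNeg_coe] at h; exact absurd h (Real.exp_pos _).ne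
  | coe x =>
    induction y with
    | top => rw [expNeg_top, expNeg_coe] at h; exact absurd h (Real.exp_pos _).ne'
    | coe y =>
      rw [expNeg_coe, expNeg_coe, Real.exp_eq_exp] at h
      simpa using h

lemma expNeg_antitone : Antitone expNeg := by
  intro x y h
  obtain ⟨z, rfl⟩ := exists_add_of_le h
  rw [expNeg_add]
  exact mul_le_of_le_one_right (expNeg_nonneg x) (expNeg_le_one z)

lemma continuous_expNeg : Continuous expNeg := by
  have h : Continuous fun y : ℝ≥0∞ => EReal.exp (-(y : EReal)) :=
    ENNReal.continuous_exp.comp (continuous_neg.comp continuous_coe_ennreal_ereal)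
  refine ENNReal.continuousOn_toReal.comp_continuous h fun y => ?_
  simp

lemma measurable_expNeg : Measurable expNeg := continuous_expNeg.measurable

lemma measurable_expNeg_comp {E : Type*} [MeasurableSpace E] {c : E → ℝ≥0∞} (hc : Measurable c) :
    Measurable fun x => expNeg (c x) :=
  measurable_expNeg.comp hc

@[simp] lemma expNeg_eq_zero {y : ℝ≥0∞} : expNeg y = 0 ↔ y = ∞ := by
  rw [← expNeg_top, expNeg_injective.eq_iff]

lemma expNeg_sum {ι : Type*} (s : Finset ι) (c : ι → ℝ≥0∞) :
    expNeg (∑ i ∈ s, c i) = ∏ i ∈ s, expNeg (c i) := by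
  classical
  induction s using Finset.induction_on with
  | empty => simp
  | insert i s hi ih => rw [Finset.sum_insert hi, Finset.prod_insert hi, expNeg_add, ih]

lemma expNeg_natCast_mul (n : ℕ) (c : ℝ≥0∞) : expNeg (n * c) = expNeg c ^ n := by
  induction n with
  | zero => simp
  | succ n ih => rw [Nat.cast_succ, add_mul, expNeg_add, ih, one_mul, pow_succ]

lemma tendsto_prod_expNeg (c : ℕ → ℝ≥0∞) :
    Tendsto (fun N => ∏ n ∈ Finset.range N, expNeg (c n)) atTop (𝓝 (expNeg (∑' n, c n))) := by
  simp_rw [← expNeg_sum]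
  exact (continuous_expNeg.tendsto _).comp ENNReal.summable.hasSum.tendsto_sum_nat

/-- The inverse of `expNeg`, that is `z ↦ -log z` as a map from `[0, 1]` to `[0, ∞]`. -/
def negLog (z : ℝ) : ℝ≥0∞ := (-ENNReal.log (ENNReal.ofReal z)).toENNReal

lemma expNeg_negLog {z : ℝ} (h0 : 0 ≤ z) (h1 : z ≤ 1) : expNeg (negLog z) = z := by
  unfold negLog
  rcases h0.eq_or_lt with rfl | h0
  · simp [expNeg_top]
  · have : -ENNReal.log (ENNReal.ofReal z) = ((-Real.log z : ℝ) : EReal) := by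
      rw [ENNReal.log_ofReal_of_pos h0, EReal.coe_neg]
    rw [this, EReal.toENNReal_of_ne_top (by simp), EReal.toReal_coe, expNeg_ofReal
      (by have := Real.log_nonpos h0.le h1; linarith), neg_neg, Real.exp_log h0]

lemma measurable_negLog : Measurable negLog := by
  unfold negLog
  exact (((ENNReal.measurable_log.comp ENNReal.measurable_ofReal).neg)).ereal_toENNReal

lemma integrable_expNeg {E : Type*} [MeasurableSpace E] {μ : Measure E} [IsFiniteMeasure μ]
    {c : E → ℝ≥0∞} (hc : AEMeasurable c μ) : Integrable (fun x => expNeg (c x)) μ :=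
  Integrable.of_bound (measurable_expNeg.comp_aemeasurable hc).aestronglyMeasurable 1
    (ae_of_all _ fun x => abs_expNeg_le_one (c x))

/-- Two finite measures on `[0, ∞]^ι` coincide if the integrals of all products of the functions
`e^{-y i}` coincide. -/
theorem ext_of_integral_expNeg_pi {ι : Type*} [Fintype ι] {μ ν : Measure (ι → ℝ≥0∞)}
    [IsFiniteMeasure μ] [IsFiniteMeasure ν] (C : AddSubmonoid ((ι → ℝ≥0∞) → ℝ≥0∞))
    (hproj : ∀ i, (fun y : ι → ℝ≥0∞ => y i) ∈ C)
    (h : ∀ c ∈ C, ∫ y, expNeg (c y) ∂μ = ∫ y, expNeg (c y) ∂ν) : μ = ν := by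
  let z : ι → ((ι → ℝ≥0∞) →ᵇ ℝ) := fun i =>
    BoundedContinuousFunction.ofNormedAddCommGroup (fun y => expNeg (y i))
      (continuous_expNeg.comp (continuous_apply i)) 1 fun y => abs_expNeg_le_one (y i)
  let A : StarSubalgebra ℝ ((ι → ℝ≥0∞) →ᵇ ℝ) :=
    { Algebra.adjoin ℝ (Set.range z) with
      star_mem' := by
        intro a ha
        have : star a = a := by ext; simp
        rwa [this] }
  -- The algebra generated by the bounded continuous functions `e^{-y i}` separates points, because
  -- `e^{-y}` is injective on all of `[0, ∞]`.
  refine ext_of_forall_mem_subalgebra_integral_eq_of_polish (𝕜 := ℝ) (A := A) ?_ ?_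
  · intro x y hxy
    obtain ⟨i, hi⟩ := Function.ne_iff.1 hxy
    refine ⟨_, ⟨_, ⟨z i, Algebra.subset_adjoin ⟨i, rfl⟩, rfl⟩, rfl⟩, ?_⟩
    exact fun h => hi (expNeg_injective h)
  · intro g hg
    have hg' : g ∈ Subalgebra.toSubmodule (Algebra.adjoin ℝ (Set.range z)) := hg
    -- By linearity only monomials in the generators matter, and each of them is `e^{-c}` for some
    -- `c ∈ C`.
    rw [Algebra.adjoin_eq_span] at hg'
    clear hg
    induction hg' using Submodule.span_induction with
    | mem g hg =>
      obtain ⟨c, hc, hgc⟩ : ∃ c ∈ C, ∀ y, g y = expNeg (c y) := by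
        clear h
        induction hg using Submonoid.closure_induction with
        | mem g hg =>
          obtain ⟨i, rfl⟩ := hg
          exact ⟨_, hproj i, fun y => rfl⟩
        | one => exact ⟨0, C.zero_mem, fun y => by simp⟩
        | mul g g' _ _ h1 h2 =>
          obtain ⟨c, hc, hgc⟩ := h1
          obtain ⟨c', hc', hgc'⟩ := h2
          exact ⟨c + c', C.add_mem hc hc', fun y => by simp [expNeg_add, hgc, hgc']⟩
      simp_rw [hgc]
      exact h c hc
    | zero => simp
    | add g g' _ _ h1 h2 =>
      simp only [BoundedContinuousFunction.coe_add, Pi.add_apply]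
      rw [integral_add (g.integrable _) (g'.integrable _),
        integral_add (g.integrable _) (g'.integrable _), h1, h2]
    | smul r g _ h1 =>
      simp only [BoundedContinuousFunction.coe_smul]
      rw [integral_smul, integral_smul, h1]

/-- A finite measure is determined by its integrals of the functions `e^{-c}`, where `c` ranges
over an additive class of `[0, ∞]`-valued functions that generates the σ-field. -/
theorem ext_of_integral_expNeg {E : Type*} [mE : MeasurableSpace E] {μ ν : Measure E}
    [IsFiniteMeasure μ] [IsFiniteMeasure ν] (C : AddSubmonoid (E → ℝ≥0∞))
    (hC : ∀ c ∈ C, Measurable c)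
    (hgen : mE ≤ ⨆ c ∈ C, MeasurableSpace.comap c inferInstance)
    (h : ∀ c ∈ C, ∫ x, expNeg (c x) ∂μ = ∫ x, expNeg (c x) ∂ν) : μ = ν := by
  have hle : ⨆ c ∈ (C : Set (E → ℝ≥0∞)), MeasurableSpace.comap c inferInstance ≤ mE :=
    iSup₂_le fun c hc => (hC c hc).comap_le
  -- Finite intersections of sets from the σ-fields of single `c ∈ C` form a generating π-system. On
  -- such a set both measures are read off from the joint law of finitely many `c`, to which the
  -- finite-dimensional result applies.
  refine ext_of_generate_finite
    (piiUnionInter (fun c : E → ℝ≥0∞ => {s | MeasurableSet[MeasurableSpace.comap c inferInstance] s})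
      (C : Set (E → ℝ≥0∞))) ?_ ?_ ?_ ?_
  · exact (le_antisymm hgen hle).trans (generateFrom_piiUnionInter_measurableSet _ _).symm
  · exact isPiSystem_piiUnionInter _
      (fun c => @MeasurableSpace.isPiSystem_measurableSet _ (MeasurableSpace.comap c inferInstance)) _
  · rintro s ⟨I, hI, f, hf, rfl⟩
    have hmeas : ∀ i : I, Measurable (i : E → ℝ≥0∞) := fun i => hC i (hI i.2)
    have hΦ : Measurable fun (x : E) (i : I) => (i : E → ℝ≥0∞) x :=
      measurable_pi_lambda _ hmeas
    have hmap : μ.map (fun (x : E) (i : I) => (i : E → ℝ≥0∞) x)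
        = ν.map (fun (x : E) (i : I) => (i : E → ℝ≥0∞) x) := by
      refine ext_of_integral_expNeg_pi
        { carrier := {c | Measurable c ∧ (fun x => c fun i : I => (i : E → ℝ≥0∞) x) ∈ C}
          add_mem' := fun ha hb => ⟨ha.1.add hb.1, C.add_mem ha.2 hb.2⟩
          zero_mem' := ⟨measurable_const, C.zero_mem⟩ } ?_ ?_
      · exact fun i => ⟨measurable_pi_apply i, hI i.2⟩
      · rintro c ⟨hc, hcC⟩
        have hm : Measurable fun y => expNeg (c y) := measurable_expNeg_comp hc
        rw [integral_map hΦ.aemeasurable hm.aestronglyMeasurable,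
          integral_map hΦ.aemeasurable hm.aestronglyMeasurable]
        exact h _ hcC
    choose! t ht hft using hf
    have hs : ⋂ x ∈ I, f x = (fun (x : E) (i : I) => (i : E → ℝ≥0∞) x) ⁻¹'
        (Set.univ.pi fun i : I => t i) := by
      ext x
      simp only [Set.mem_iInter, Set.mem_preimage, Set.mem_pi, Set.mem_univ, true_imp_iff,
        Subtype.forall]
      refine forall₂_congr fun i hi => ?_
      rw [← hft i hi]; rfl
    have hmt : MeasurableSet (Set.univ.pi fun i : I => t i) :=
      MeasurableSet.univ_pi fun i => ht i i.2
    rw [hs, ← Measure.map_apply hΦ hmt, hmap, Measure.map_apply hΦ hmt]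
  -- The choice `c = 0` compares the total masses.
  · have := h 0 C.zero_mem
    simpa [measureReal_def, ENNReal.toReal_eq_toReal_iff] using this

/-! ### Configurations and their σ-field -/

namespace Config

lemma toMeasure_injective : Function.Injective (toMeasure (X := X)) := Subtype.val_injective

lemma isConfig (μ : Config X) : IsConfig μ.toMeasure := μ.2

instance (μ : Config X) : SigmaFinite μ.toMeasure := μ.2.1

lemma measurable_toMeasure : Measurable (toMeasure (X := X)) := comap_measurable _

@[simp] lemma toMeasure_add (μ ν : Config X) : (μ + ν).toMeasure = μ.toMeasure + ν.toMeasure := rfl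

@[simp] lemma toMeasure_zero : (0 : Config X).toMeasure = 0 := rfl

@[simp] lemma toMeasure_point (x : X) : (point x).toMeasure = Measure.dirac x := rfl

lemma toMeasure_ofMeasure {μ : Measure X} (h : IsConfig μ) : (ofMeasure μ).toMeasure = μ := by
  simp [ofMeasure, h, toMeasure]

@[simp] lemma ofMeasure_toMeasure (μ : Config X) : ofMeasure μ.toMeasure = μ :=
  toMeasure_injective (toMeasure_ofMeasure μ.isConfig)

section Measurability

variable {E : Type*} [MeasurableSpace E]

lemma measurable_of_toMeasure {g : E → Config X} (h : Measurable fun e => (g e).toMeasure) :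
    Measurable g :=
  measurable_comap_iff.2 h

lemma measurable_of_apply {g : E → Config X}
    (h : ∀ B, MeasurableSet B → Measurable fun e => (g e).toMeasure B) : Measurable g :=
  measurable_of_toMeasure (Measure.measurable_of_measurable_coe _ h)

lemma measurable_apply {B : Set X} (hB : MeasurableSet B) :
    Measurable fun μ : Config X => μ.toMeasure B :=
  (Measure.measurable_coe hB).comp measurable_toMeasure

lemma measurable_lintegral {u : X → ℝ≥0∞} (hu : Measurable u) :
    Measurable fun μ : Config X => ∫⁻ x, u x ∂μ.toMeasure :=
  (Measure.measurable_lintegral hu).comp measurable_toMeasure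

lemma measurable_add {g h : E → Config X} (hg : Measurable g) (hh : Measurable h) :
    Measurable fun e => g e + h e := by
  refine measurable_of_apply fun B hB => ?_
  simp only [toMeasure_add, Measure.add_apply]
  exact ((measurable_apply hB).comp hg).add ((measurable_apply hB).comp hh)

lemma measurable_point : Measurable (point (X := X)) :=
  measurable_of_toMeasure Measure.measurable_dirac

end Measurability

lemma isConfig_restrict (μ : Config X) {S : Set X} (hS : MeasurableSet S) :
    IsConfig (μ.toMeasure.restrict S) := by
  refine ⟨inferInstance, fun B hB => ?_⟩
  rw [Measure.restrict_apply hB]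
  exact μ.isConfig.2 _ (hB.inter hS)

/-- The restriction of a configuration to a set. -/
def restr (S : Set X) (μ : Config X) : Config X := ofMeasure (μ.toMeasure.restrict S)

lemma toMeasure_restr {S : Set X} (hS : MeasurableSet S) (μ : Config X) :
    (restr S μ).toMeasure = μ.toMeasure.restrict S :=
  toMeasure_ofMeasure (μ.isConfig_restrict hS)

lemma measurable_restr {S : Set X} (hS : MeasurableSet S) : Measurable (restr S) := by
  refine measurable_of_apply fun B hB => ?_
  simp_rw [toMeasure_restr hS, Measure.restrict_apply hB]
  exact measurable_apply (hB.inter hS)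

lemma restr_add {S : Set X} (hS : MeasurableSet S) (μ ν : Config X) :
    restr S (μ + ν) = restr S μ + restr S ν := by
  apply toMeasure_injective
  simp [toMeasure_restr hS]

lemma restr_restr {S T : Set X} (hS : MeasurableSet S) (hT : MeasurableSet T) (μ : Config X) :
    restr S (restr T μ) = restr (S ∩ T) μ := by
  apply toMeasure_injective
  simp [toMeasure_restr, hS, hT, hS.inter hT, Measure.restrict_restrict]

@[simp] lemma restr_univ (μ : Config X) : restr Set.univ μ = μ := by
  apply toMeasure_injective
  simp [toMeasure_restr]

@[simp] lemma restr_empty (μ : Config X) : restr ∅ μ = 0 := by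
  apply toMeasure_injective
  simp [toMeasure_restr]

@[simp] lemma add_zero' (μ : Config X) : μ + 0 = μ := by
  apply toMeasure_injective
  simp

lemma lintegral_restr {S : Set X} (hS : MeasurableSet S) (μ : Config X) (u : X → ℝ≥0∞) :
    ∫⁻ x, u x ∂(restr S μ).toMeasure = ∫⁻ x, S.indicator u x ∂μ.toMeasure := by
  rw [toMeasure_restr hS, lintegral_indicator hS]

lemma lintegral_point {u : X → ℝ≥0∞} (hu : Measurable u) (x : X) :
    ∫⁻ y, u y ∂(point x).toMeasure = u x := by
  rw [toMeasure_point, lintegral_dirac' x hu]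

/-- Since `μ B` is the integral of an indicator, the linear functionals `μ ↦ ∫ u dμ` generate the
σ-field. They form an additive class, as required by `ext_of_integral_expNeg`. -/
lemma measurableSpace_le :
    (inferInstance : MeasurableSpace (Config X)) ≤
      ⨆ (u : X → ℝ≥0∞) (_ : ∃ B, MeasurableSet B ∧ u = B.indicator 1),
        MeasurableSpace.comap (fun μ : Config X => ∫⁻ x, u x ∂μ.toMeasure) inferInstance := by
  set m := ⨆ (u : X → ℝ≥0∞) (_ : ∃ B, MeasurableSet B ∧ u = B.indicator 1),
        MeasurableSpace.comap (fun μ : Config X => ∫⁻ x, u x ∂μ.toMeasure) inferInstance with hm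
  have hid : @Measurable _ _ m instMeasurableSpace (fun μ : Config X => μ) := by
    refine @measurable_of_apply X _ (Config X) m _ fun B hB => ?_
    have : (fun μ : Config X => μ.toMeasure B)
        = fun μ : Config X => ∫⁻ x, B.indicator 1 x ∂μ.toMeasure := by
      ext μ; rw [lintegral_indicator_one hB]
    rw [this]
    refine Measurable.mono (comap_measurable _) ?_ le_rfl
    rw [hm]
    exact le_iSup₂_of_le (B.indicator 1) ⟨B, hB, rfl⟩ le_rfl
  exact fun s hs => hid hs

end Config

open Config

/-! ### Uniqueness from Laplace functionals -/

/-- A finite measure on the space of configurations is determined by its Laplace functional. -/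
theorem ext_of_laplace {μ ν : Measure (Config X)} [IsFiniteMeasure μ] [IsFiniteMeasure ν]
    (h : ∀ u : X → ℝ≥0∞, Measurable u →
      ∫ m, expNeg (∫⁻ x, u x ∂m.toMeasure) ∂μ = ∫ m, expNeg (∫⁻ x, u x ∂m.toMeasure) ∂ν) :
    μ = ν := by
  refine ext_of_integral_expNeg
    { carrier := {c | ∃ u : X → ℝ≥0∞, Measurable u ∧ c = fun m => ∫⁻ x, u x ∂m.toMeasure}
      add_mem' := ?_
      zero_mem' := ⟨0, measurable_const, by ext; simp⟩ } ?_ ?_ ?_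
  · rintro _ _ ⟨u, hu, rfl⟩ ⟨v, hv, rfl⟩
    exact ⟨u + v, hu.add hv, by ext m; simp [lintegral_add_left hu]⟩
  · rintro _ ⟨u, hu, rfl⟩
    exact measurable_lintegral hu
  · refine measurableSpace_le.trans (iSup₂_le ?_)
    rintro _ ⟨B, hB, rfl⟩
    exact le_iSup₂_of_le (fun m : Config X => ∫⁻ x, B.indicator 1 x ∂m.toMeasure)
      ⟨_, measurable_one.indicator hB, rfl⟩ le_rfl
  · rintro _ ⟨u, hu, rfl⟩
    exact h u hu

/-- A finite measure on the space of pairs of configurations is determined by its Laplace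
functional. -/
theorem ext_of_laplace_prod {μ ν : Measure (Config X × Config X)}
    [IsFiniteMeasure μ] [IsFiniteMeasure ν]
    (h : ∀ u v : X → ℝ≥0∞, Measurable u → Measurable v →
      ∫ m, expNeg (∫⁻ x, u x ∂m.1.toMeasure + ∫⁻ x, v x ∂m.2.toMeasure) ∂μ
        = ∫ m, expNeg (∫⁻ x, u x ∂m.1.toMeasure + ∫⁻ x, v x ∂m.2.toMeasure) ∂ν) :
    μ = ν := by
  refine ext_of_integral_expNeg
    { carrier := {c | ∃ u v : X → ℝ≥0∞, Measurable u ∧ Measurable v ∧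
        c = fun m => ∫⁻ x, u x ∂m.1.toMeasure + ∫⁻ x, v x ∂m.2.toMeasure}
      add_mem' := ?_
      zero_mem' := ⟨0, 0, measurable_const, measurable_const, by ext; simp⟩ } ?_ ?_ ?_
  · rintro _ _ ⟨u, v, hu, hv, rfl⟩ ⟨u', v', hu', hv', rfl⟩
    refine ⟨u + u', v + v', hu.add hu', hv.add hv', ?_⟩
    ext m
    simp only [Pi.add_apply, lintegral_add_left hu, lintegral_add_left hv]
    ring
  · rintro _ ⟨u, v, hu, hv, rfl⟩
    exact ((measurable_lintegral hu).comp measurable_fst).add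
      ((measurable_lintegral hv).comp measurable_snd)
  · refine sup_le ?_ ?_
    · refine (MeasurableSpace.comap_mono measurableSpace_le).trans ?_
      simp_rw [MeasurableSpace.comap_iSup, MeasurableSpace.comap_comp]
      refine iSup₂_le ?_
      rintro _ ⟨B, hB, rfl⟩
      refine le_iSup₂_of_le
        (fun m : Config X × Config X => ∫⁻ x, B.indicator 1 x ∂m.1.toMeasure)
        ⟨_, 0, measurable_one.indicator hB, measurable_const, by ext; simp⟩ le_rfl
    · refine (MeasurableSpace.comap_mono measurableSpace_le).trans ?_
      simp_rw [MeasurableSpace.comap_iSup, MeasurableSpace.comap_comp]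
      refine iSup₂_le ?_
      rintro _ ⟨B, hB, rfl⟩
      refine le_iSup₂_of_le
        (fun m : Config X × Config X => ∫⁻ x, B.indicator 1 x ∂m.2.toMeasure)
        ⟨0, _, measurable_const, measurable_one.indicator hB, by ext; simp⟩ le_rfl
  · rintro _ ⟨u, v, hu, hv, rfl⟩
    exact h u v hu hv

/-- A finite measure on the product of the state space and the space of configurations is
determined by its Laplace functional. -/
theorem ext_of_laplace_point {μ ν : Measure (X × Config X)}
    [IsFiniteMeasure μ] [IsFiniteMeasure ν]
    (h : ∀ v u : X → ℝ≥0, Measurable v → Measurable u →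
      ∫ p, expNeg (v p.1 + ∫⁻ x, u x ∂p.2.toMeasure) ∂μ
        = ∫ p, expNeg (v p.1 + ∫⁻ x, u x ∂p.2.toMeasure) ∂ν) :
    μ = ν := by
  refine ext_of_integral_expNeg
    { carrier := {c | ∃ v u : X → ℝ≥0, Measurable v ∧ Measurable u ∧
        c = fun p => (v p.1 : ℝ≥0∞) + ∫⁻ x, u x ∂p.2.toMeasure}
      add_mem' := ?_
      zero_mem' := ⟨0, 0, measurable_const, measurable_const, by ext; simp⟩ } ?_ ?_ ?_
  · rintro _ _ ⟨u, v, hu, hv, rfl⟩ ⟨u', v', hu', hv', rfl⟩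
    refine ⟨u + u', v + v', hu.add hu', hv.add hv', ?_⟩
    ext m
    simp only [Pi.add_apply, ENNReal.coe_add, lintegral_add_left hv.coe_nnreal_ennreal]
    ring
  · rintro _ ⟨v, u, hv, hu, rfl⟩
    exact (hv.coe_nnreal_ennreal.comp measurable_fst).add
      ((measurable_lintegral hu.coe_nnreal_ennreal).comp measurable_snd)
  · refine sup_le ?_ ?_
    · rintro _ ⟨B, hB, rfl⟩
      have hle : MeasurableSpace.comap (fun p : X × Config X => (B.indicator 1 p.1 : ℝ≥0∞))
          inferInstance ≤ ⨆ c ∈ {c : X × Config X → ℝ≥0∞ | ∃ v u : X → ℝ≥0, Measurable v ∧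
            Measurable u ∧ c = fun p => (v p.1 : ℝ≥0∞) + ∫⁻ x, u x ∂p.2.toMeasure},
            MeasurableSpace.comap c inferInstance := by
        -- The indicator of `B`, applied to the first coordinate, belongs to the class with `u = 0`,
        -- and `B` is recovered as the preimage of `{1}`.
        refine le_iSup₂_of_le (fun p : X × Config X => (B.indicator 1 p.1 : ℝ≥0∞)) 
          ⟨B.indicator 1, 0, measurable_one.indicator hB, measurable_const, ?_⟩ le_rfl
        ext p
        by_cases hp : p.1 ∈ B <;> simp [hp]
      refine hle _ ⟨{1}, measurableSet_singleton _, ?_⟩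
      ext p
      by_cases hp : p.1 ∈ B <;> simp [hp]
    · refine (MeasurableSpace.comap_mono measurableSpace_le).trans ?_
      simp_rw [MeasurableSpace.comap_iSup, MeasurableSpace.comap_comp]
      refine iSup₂_le ?_
      rintro _ ⟨B, hB, rfl⟩
      refine le_iSup₂_of_le
        (fun p : X × Config X => ∫⁻ x, B.indicator 1 x ∂p.2.toMeasure)
        ⟨0, B.indicator 1, measurable_const, measurable_one.indicator hB, ?_⟩ le_rfl
      ext p
      simp only [Pi.zero_apply, ENNReal.coe_zero, zero_add]
      refine lintegral_congr fun x => ?_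
      by_cases hx : x ∈ B <;> simp [hx]
  · rintro _ ⟨v, u, hv, hu, rfl⟩
    exact h v u hv hu

/-! ### Sums of unit masses -/

section PointSum

lemma pointSum_apply (κ : ℕ∞) (ξ : ℕ → X) (keep : ℕ → Bool) {B : Set X} (hB : MeasurableSet B) :
    pointSum κ ξ keep B
      = ∑' n : ℕ, if (n : ℕ∞) < κ ∧ keep n = true then B.indicator 1 (ξ n) else 0 := by
  rw [pointSum, Measure.sum_apply _ hB]
  refine tsum_congr fun n => ?_
  split_ifs <;> simp [hB]

lemma lintegral_pointSum (κ : ℕ∞) (ξ : ℕ → X) (keep : ℕ → Bool) {u : X → ℝ≥0∞}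
    (hu : Measurable u) :
    ∫⁻ x, u x ∂pointSum κ ξ keep
      = ∑' n : ℕ, if (n : ℕ∞) < κ ∧ keep n = true then u (ξ n) else 0 := by
  rw [pointSum, lintegral_sum_measure]
  refine tsum_congr fun n => ?_
  split_ifs
  · exact lintegral_dirac' _ hu
  · simp

lemma pointSum_mono (κ : ℕ∞) (ξ : ℕ → X) {keep keep' : ℕ → Bool}
    (h : ∀ n, keep n = true → keep' n = true) : pointSum κ ξ keep ≤ pointSum κ ξ keep' := by
  refine Measure.le_iff.2 fun B hB => ?_
  rw [pointSum_apply _ _ _ hB, pointSum_apply _ _ _ hB]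
  refine ENNReal.tsum_le_tsum fun n => ?_
  by_cases h1 : (n : ℕ∞) < κ ∧ keep n = true
  · rw [if_pos h1, if_pos ⟨h1.1, h n h1.2⟩]
  · rw [if_neg h1]; exact zero_le

/-- The full sum dominates every subsum, so σ-finiteness is inherited; the mass of a set is the
number of retained indices whose points lie in it. -/
lemma isConfig_pointSum {κ : ℕ∞} {ξ : ℕ → X}
    (h : SigmaFinite (pointSum κ ξ fun _ => true)) (keep : ℕ → Bool) :
    IsConfig (pointSum κ ξ keep) := by
  refine ⟨Measure.sigmaFinite_of_le _ (pointSum_mono κ ξ fun _ _ => rfl), fun B hB => ?_⟩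
  refine ⟨{n : ℕ | ((n : ℕ∞) < κ ∧ keep n = true) ∧ ξ n ∈ B}.encard, ?_⟩
  rw [← ENNReal.tsum_set_one, tsum_subtype _ (fun _ => (1 : ℝ≥0∞)), pointSum_apply _ _ _ hB]
  refine tsum_congr fun n => ?_
  by_cases h1 : (n : ℕ∞) < κ ∧ keep n = true <;> by_cases h2 : ξ n ∈ B <;>
    simp [Set.indicator, h1, h2]

end PointSum

/-! ### The Laplace functional characterises Poisson processes -/

lemma integral_pow_poissonMeasure (r : ℝ≥0) (z : ℝ) :
    ∫ n, z ^ n ∂poissonMeasure r = Real.exp (-(r * (1 - z))) := by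
  rw [integral_poissonMeasure]
  have h := (NormedSpace.expSeries_div_hasSum_exp (r * z : ℝ)).mul_left (Real.exp (-r))
  rw [← Real.exp_eq_exp_ℝ, ← Real.exp_add] at h
  rw [show -((r : ℝ) * (1 - z)) = -r + r * z by ring, ← h.tsum_eq]
  refine tsum_congr fun n => ?_
  simp only [smul_eq_mul, mul_pow]
  ring

/-- This is the generating function at `z = e^{-c}`; it includes `c = ∞`, where `z = 0` and the
integral is the probability of the value `0`. -/
lemma integral_expNeg_poissonMeasure (r : ℝ≥0) (c : ℝ≥0∞) :
    ∫ n : ℕ, expNeg (c * n) ∂poissonMeasure r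
      = expNeg (ENNReal.ofReal (1 - expNeg c) * r) := by
  simp_rw [mul_comm c, expNeg_natCast_mul, integral_pow_poissonMeasure]
  rw [expNeg_of_ne_top (ENNReal.mul_ne_top ENNReal.ofReal_ne_top ENNReal.coe_ne_top),
    ENNReal.toReal_mul, ENNReal.toReal_ofReal (sub_nonneg.2 (expNeg_le_one c)), mul_comm]
  rfl

lemma IsPoissonProcess.integral_expNeg_count {P : Measure Ω} [IsProbabilityMeasure P]
    {η : Ω → Config X} {Λ : Measure X} (hη : IsPoissonProcess P η Λ) {B : Set X}
    (hB : MeasurableSet B) (c : ℝ≥0∞) :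
    ∫ ω, expNeg (c * (η ω).toMeasure B) ∂P
      = expNeg (ENNReal.ofReal (1 - expNeg c) * Λ B) := by
  have hm : Measurable fun ω => (η ω).toMeasure B := (measurable_apply hB).comp hη.measurable
  by_cases hΛ : Λ B = ∞
  · rcases eq_or_ne c 0 with rfl | hc
    · simp
    · have h0 : ∀ᵐ ω ∂P, expNeg (c * (η ω).toMeasure B) = 0 := by
        filter_upwards [hη.law_of_eq_top B hB hΛ] with ω hω
        rw [hω, ENNReal.mul_top hc, expNeg_top]
      rw [integral_eq_zero_of_ae h0, hΛ, ENNReal.mul_top, expNeg_top]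
      have h1 : expNeg c < 1 := lt_of_le_of_ne (expNeg_le_one c) fun h =>
        hc (expNeg_injective (h.trans expNeg_zero.symm))
      simpa using h1
  · have h1 : ∫ ω, expNeg (c * (η ω).toMeasure B) ∂P
        = ∫ y, expNeg (c * y) ∂(P.map fun ω => (η ω).toMeasure B) := by
      rw [integral_map hm.aemeasurable]
      exact (measurable_expNeg_comp (measurable_id'.const_mul c)).aestronglyMeasurable
    rw [h1, hη.law_of_ne_top B hB hΛ, integral_map (measurable_of_countable _).aemeasurable
      (measurable_expNeg_comp (measurable_id'.const_mul c)).aestronglyMeasurable,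
      integral_expNeg_poissonMeasure, ENNReal.coe_toNNReal hΛ]

/-- The level sets of `u` are disjoint, so their counts are independent and the expectation
factorises into Poisson generating functions. -/
lemma IsPoissonProcess.laplace_simpleFunc {P : Measure Ω} [IsProbabilityMeasure P]
    {η : Ω → Config X} {Λ : Measure X} (hη : IsPoissonProcess P η Λ) (u : SimpleFunc X ℝ≥0∞) :
    ∫ ω, expNeg (∫⁻ x, u x ∂(η ω).toMeasure) ∂P
      = expNeg (∫⁻ x, ENNReal.ofReal (1 - expNeg (u x)) ∂Λ) := by
  let e := u.range.equivFin.symm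
  let B : Fin u.range.card → Set X := fun i => u ⁻¹' {(e i : ℝ≥0∞)}
  have hB : ∀ i, MeasurableSet (B i) := fun i => u.measurableSet_preimage _
  have hdisj : Pairwise fun i j => Disjoint (B i) (B j) := by
    intro i j hij
    refine Disjoint.preimage _ (Set.disjoint_singleton.2 fun h => hij ?_)
    exact e.injective (Subtype.ext h)
  have hsum : ∀ (g : ℝ≥0∞ → ℝ≥0∞) (μ : Measure X),
      ∫⁻ x, g (u x) ∂μ = ∑ i, g (e i) * μ (B i) := by
    intro g μ
    have h1 : ∫⁻ x, g (u x) ∂μ = ∑ c ∈ u.range, g c * μ (u ⁻¹' {c}) := by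
      rw [← SimpleFunc.map_lintegral, ← SimpleFunc.lintegral_eq_lintegral]
      rfl
    rw [h1, ← Finset.sum_coe_sort u.range fun c => g c * μ (u ⁻¹' {c})]
    exact (Equiv.sum_comp e fun c : u.range => g c * μ (u ⁻¹' {(c : ℝ≥0∞)})).symm
  have h1 : ∀ ω, ∫⁻ x, u x ∂(η ω).toMeasure = ∑ i, e i * (η ω).toMeasure (B i) :=
    fun ω => hsum id _
  have h2 := hsum (fun c => ENNReal.ofReal (1 - expNeg c)) Λ
  rw [h2]
  simp_rw [h1, expNeg_sum]
  have hind := hη.indep _ B hB hdisj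
  rw [hind.integral_fun_prod_comp (f := fun i y => expNeg (e i * y))
    (fun i => ((measurable_apply (hB i)).comp hη.measurable).aemeasurable)
    (fun i => (measurable_expNeg_comp (measurable_id'.const_mul _)).aestronglyMeasurable)]
  exact Finset.prod_congr rfl fun i _ => hη.integral_expNeg_count (hB i) _

/-- The Laplace functional of a Poisson process. -/
theorem IsPoissonProcess.laplace {P : Measure Ω} [IsProbabilityMeasure P]
    {η : Ω → Config X} {Λ : Measure X} (hη : IsPoissonProcess P η Λ) {u : X → ℝ≥0∞}
    (hu : Measurable u) :
    ∫ ω, expNeg (∫⁻ x, u x ∂(η ω).toMeasure) ∂P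
      = expNeg (∫⁻ x, ENNReal.ofReal (1 - expNeg (u x)) ∂Λ) := by
  have hmono : ∀ x, Monotone fun n => SimpleFunc.eapprox u n x :=
    fun x m n hmn => SimpleFunc.monotone_eapprox u hmn x
  have hlim : ∀ x, Tendsto (fun n => SimpleFunc.eapprox u n x) atTop (𝓝 (u x)) := by
    intro x
    rw [← SimpleFunc.iSup_eapprox_apply hu x]
    exact tendsto_atTop_iSup (hmono x)
  have hL : Tendsto (fun n => ∫ ω, expNeg (∫⁻ x, SimpleFunc.eapprox u n x ∂(η ω).toMeasure) ∂P)
      atTop (𝓝 (∫ ω, expNeg (∫⁻ x, u x ∂(η ω).toMeasure) ∂P)) := by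
    refine tendsto_integral_of_dominated_convergence (fun _ => 1) (fun n => ?_)
      (integrable_const _) (fun n => ae_of_all _ fun ω => abs_expNeg_le_one _)
      (ae_of_all _ fun ω => ?_)
    · exact (measurable_expNeg_comp ((measurable_lintegral
        (SimpleFunc.measurable _)).comp hη.measurable)).aestronglyMeasurable
    · refine (continuous_expNeg.tendsto _).comp ?_
      exact lintegral_tendsto_of_tendsto_of_monotone
        (fun n => (SimpleFunc.measurable _).aemeasurable) (ae_of_all _ hmono) (ae_of_all _ hlim)
  have hR : Tendsto
      (fun n => expNeg (∫⁻ x, ENNReal.ofReal (1 - expNeg (SimpleFunc.eapprox u n x)) ∂Λ))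
      atTop (𝓝 (expNeg (∫⁻ x, ENNReal.ofReal (1 - expNeg (u x)) ∂Λ))) := by
    refine (continuous_expNeg.tendsto _).comp ?_
    refine lintegral_tendsto_of_tendsto_of_monotone (fun n => ?_) (ae_of_all _ fun x => ?_)
      (ae_of_all _ fun x => ?_)
    · exact (ENNReal.measurable_ofReal.comp ((measurable_expNeg_comp
        (SimpleFunc.measurable _)).const_sub 1)).aemeasurable
    · exact fun m n hmn => ENNReal.ofReal_le_ofReal
        (sub_le_sub_left (expNeg_antitone (hmono x hmn)) 1)
    · exact ((ENNReal.continuous_ofReal.comp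
        (continuous_const.sub continuous_expNeg)).tendsto _).comp (hlim x)
  refine tendsto_nhds_unique hL ?_
  simp_rw [hη.laplace_simpleFunc]
  exact hR

/-- A point process with the Laplace functional of a Poisson process is a Poisson process. -/
theorem isPoissonProcess_of_laplace {P : Measure Ω} [IsProbabilityMeasure P]
    {η : Ω → Config X} {Λ : Measure X} (hη : Measurable η)
    (h : ∀ u : X → ℝ≥0∞, Measurable u → ∫ ω, expNeg (∫⁻ x, u x ∂(η ω).toMeasure) ∂P
      = expNeg (∫⁻ x, ENNReal.ofReal (1 - expNeg (u x)) ∂Λ)) :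
    IsPoissonProcess P η Λ := by
  have hm : ∀ {B : Set X}, MeasurableSet B → Measurable fun ω => (η ω).toMeasure B :=
    fun hB => (measurable_apply hB).comp hη
  have hcount : ∀ {B : Set X}, MeasurableSet B → ∀ c : ℝ≥0∞,
      ∫ ω, expNeg (c * (η ω).toMeasure B) ∂P
        = expNeg (ENNReal.ofReal (1 - expNeg c) * Λ B) := by
    intro B hB c
    have h1 := h (B.indicator fun _ => c) (measurable_const.indicator hB)
    simp_rw [lintegral_indicator_const hB] at h1
    rw [h1, ← lintegral_indicator_const hB]
    congr 1
    refine lintegral_congr fun x => ?_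
    by_cases hx : x ∈ B <;> simp [hx]
  refine ⟨hη, fun B hB hΛ => ?_, fun B hB hΛ => ?_, fun m B hB hdisj => ?_⟩
  · have : IsProbabilityMeasure (P.map fun ω => (η ω).toMeasure B) :=
      Measure.isProbabilityMeasure_map (hm hB).aemeasurable
    have : IsProbabilityMeasure ((poissonMeasure (Λ B).toNNReal).map fun n : ℕ => (n : ℝ≥0∞)) :=
      Measure.isProbabilityMeasure_map (measurable_of_countable _).aemeasurable
    refine ext_of_integral_expNeg
      { carrier := {c | ∃ a : ℝ≥0∞, c = fun y => a * y}
        add_mem' := ?_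
        zero_mem' := ⟨0, by ext; simp⟩ } ?_ ?_ ?_
    · rintro _ _ ⟨a, rfl⟩ ⟨b, rfl⟩
      exact ⟨a + b, by ext y; simp [add_mul]⟩
    · rintro _ ⟨a, rfl⟩
      exact measurable_id'.const_mul a
    · refine le_iSup₂_of_le (fun y => y) ⟨1, by simp⟩ ?_
      exact (MeasurableSpace.comap_id).ge
    · rintro _ ⟨a, rfl⟩
      have ha : Measurable fun y : ℝ≥0∞ => expNeg (a * y) :=
        measurable_expNeg_comp (measurable_id'.const_mul a)
      rw [integral_map (hm hB).aemeasurable ha.aestronglyMeasurable,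
        integral_map (measurable_of_countable _).aemeasurable ha.aestronglyMeasurable,
        hcount hB, integral_expNeg_poissonMeasure, ENNReal.coe_toNNReal hΛ]
  · have h1 := hcount hB 1
    -- With `c = 1` the expectation of `e^{-η(B)}` is `e^{-∞} = 0`, which forces `η(B) = ∞` almost
    -- surely.
    have hlt : expNeg 1 < 1 := by
      rw [← ENNReal.coe_one, expNeg_coe]; simp
    rw [hΛ, ENNReal.mul_top (by simpa using hlt), expNeg_top,
      integral_eq_zero_iff_of_nonneg (fun ω => expNeg_nonneg _)
        (integrable_expNeg ((hm hB).const_mul 1).aemeasurable)] at h1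
    filter_upwards [h1] with ω hω
    simpa using hω
  · rw [iIndepFun_iff_map_fun_eq_pi_map fun i => (hm (hB i)).aemeasurable]
    have hpi : Measurable fun ω i => (η ω).toMeasure (B i) :=
      measurable_pi_lambda _ fun i => hm (hB i)
    have hpr : ∀ i, IsProbabilityMeasure (P.map fun ω => (η ω).toMeasure (B i)) :=
      fun i => Measure.isProbabilityMeasure_map (hm (hB i)).aemeasurable
    refine ext_of_integral_expNeg_pi
      { carrier := {c | ∃ a : Fin m → ℝ≥0∞, c = fun y => ∑ i, a i * y i}
        add_mem' := ?_
        zero_mem' := ⟨0, by ext; simp⟩ } ?_ ?_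
    · rintro _ _ ⟨a, rfl⟩ ⟨b, rfl⟩
      exact ⟨a + b, by ext y; simp [add_mul, Finset.sum_add_distrib]⟩
    · exact fun i => ⟨Pi.single i 1, by ext y; simp [Pi.single_apply]⟩
    · rintro _ ⟨a, rfl⟩
      have hs : Measurable fun y : Fin m → ℝ≥0∞ => expNeg (∑ i, a i * y i) :=
        measurable_expNeg_comp (Finset.measurable_sum _ fun i _ =>
          (measurable_pi_apply i).const_mul _)
      rw [integral_map hpi.aemeasurable hs.aestronglyMeasurable]
      simp_rw [expNeg_sum]
      rw [integral_fintype_prod_eq_prod (f := fun i y => expNeg (a i * y))]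
      -- Independence is factorisation of the joint Laplace transform of the counts, which is the
      -- Laplace functional at the step function `∑ a_i 1_{B_i}`.
      have h1 := h (fun x => ∑ i, (B i).indicator (fun _ => a i) x)
        (Finset.measurable_sum _ fun i _ => measurable_const.indicator (hB i))
      simp_rw [lintegral_finsetSum _ fun i _ => measurable_const.indicator (hB i),
        lintegral_indicator_const (hB _), expNeg_sum] at h1
      rw [h1]
      -- By disjointness at most one factor differs from `1` at each `x`, so the product turns into
      -- a sum.
      have h2 : ∀ x, ENNReal.ofReal (1 - ∏ i, expNeg ((B i).indicator (fun _ => a i) x))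
          = ∑ i, (B i).indicator (fun _ => ENNReal.ofReal (1 - expNeg (a i))) x := by
        intro x
        by_cases hx : ∃ j, x ∈ B j
        · obtain ⟨j, hj⟩ := hx
          have hne : ∀ i, i ≠ j → x ∉ B i := fun i hij hi =>
            Set.disjoint_left.1 (hdisj hij) hi hj
          rw [Finset.prod_eq_single j (fun i _ hij => by simp [hne i hij]) (by simp),
            Finset.sum_eq_single j (fun i _ hij => by simp [hne i hij]) (by simp)]
          simp [hj]
        · push Not at hx
          simp [hx]
      simp_rw [h2]
      rw [lintegral_finsetSum _ fun i _ => measurable_const.indicator (hB i), expNeg_sum]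
      refine Finset.prod_congr rfl fun i _ => ?_
      rw [lintegral_indicator_const (hB i), integral_map (hm (hB i)).aemeasurable
        (measurable_expNeg_comp (measurable_id'.const_mul _)).aestronglyMeasurable, hcount (hB i)]

/-- The law of a Poisson process is determined by the intensity measure. -/
theorem IsPoissonProcess.map_eq_poissonLaw {P : Measure Ω} [IsProbabilityMeasure P]
    {η : Ω → Config X} {Λ : Measure X} (hη : IsPoissonProcess P η Λ) :
    poissonLaw Λ = P.map η := by
  have hp : IsProbabilityMeasure (P.map η) :=
    Measure.isProbabilityMeasure_map hη.measurable.aemeasurable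
  have hlap : ∀ u : X → ℝ≥0∞, Measurable u →
      ∫ m, expNeg (∫⁻ x, u x ∂m.toMeasure) ∂(P.map η)
        = expNeg (∫⁻ x, ENNReal.ofReal (1 - expNeg (u x)) ∂Λ) := by
    intro u hu
    rw [integral_map hη.measurable.aemeasurable
      (measurable_expNeg_comp (measurable_lintegral hu)).aestronglyMeasurable]
    exact hη.laplace hu
  -- The law of `η` itself witnesses existence, so `poissonLaw` does not take its default value `0`.
  have hex : ∃ Q : Measure (Config X), IsProbabilityMeasure Q ∧ IsPoissonProcess Q id Λ :=
    ⟨P.map η, hp, isPoissonProcess_of_laplace measurable_id hlap⟩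
  rw [poissonLaw, dif_pos hex]
  obtain ⟨hQ, hQ'⟩ := hex.choose_spec
  refine ext_of_laplace fun u hu => ?_
  rw [hlap u hu]
  exact hQ'.laplace hu

/-! ### Thinnings -/

/-- A Poisson process `η` with intensity measure `Λ` that is everywhere the sum of the unit masses
at the points `ξ n`, `n < κ`, together with thinning marks `Y`. -/
structure IsMarkedPoisson (P : Measure Ω) (Λ : Measure X) (η : Ω → Config X) (κ : Ω → ℕ∞)
    (ξ : ℕ → Ω → X) (Y : ℝ → ℕ → Ω → Bool) : Prop where
  poisson : IsPoissonProcess P η Λ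
  measurable_card : Measurable κ
  measurable_point : ∀ n, Measurable (ξ n)
  eq_sum : ∀ ω, (η ω).toMeasure = pointSum (κ ω) (fun n => ξ n ω) (fun _ => true)
  marks : IsThinningMarks P κ ξ Y

namespace IsMarkedPoisson

variable {P : Measure Ω} {Λ : Measure X} {η : Ω → Config X} {κ : Ω → ℕ∞}
    {ξ : ℕ → Ω → X} {Y : ℝ → ℕ → Ω → Bool}

lemma isConfig_pointSum (h : IsMarkedPoisson P Λ η κ ξ Y) (keep : ℕ → Bool) (ω : Ω) :
    IsConfig (pointSum (κ ω) (fun n => ξ n ω) keep) := by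
  refine PoissonConcentration.isConfig_pointSum ?_ keep
  rw [← h.eq_sum]
  infer_instance

lemma toMeasure_thinning (h : IsMarkedPoisson P Λ η κ ξ Y) (t : ℝ) (ω : Ω) :
    (thinning κ ξ Y t ω).toMeasure = pointSum (κ ω) (fun n => ξ n ω) (fun n => Y t n ω) :=
  toMeasure_ofMeasure (h.isConfig_pointSum _ ω)

lemma measurable_thinning {E : Type*} [MeasurableSpace E] (h : IsMarkedPoisson P Λ η κ ξ Y)
    {τ : E → ℝ} {o : E → Ω} (hτ : Measurable τ) (ho : Measurable o) :
    Measurable fun e => thinning κ ξ Y (τ e) (o e) := by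
  refine measurable_of_apply fun B hB => ?_
  simp_rw [h.toMeasure_thinning, pointSum_apply _ _ _ hB]
  have hY : ∀ n, Measurable fun e => Y (τ e) n (o e) :=
    fun n => (h.marks.measurable n).comp (hτ.prodMk ho)
  refine Measurable.tsum fun n => Measurable.ite ?_ ?_ measurable_const
  · exact ((h.measurable_card.comp ho) (MeasurableSet.of_discrete (s := Set.Ioi (n : ℕ∞)))).inter
      (hY n (measurableSet_singleton true))
  · exact (measurable_one.indicator hB).comp ((h.measurable_point n).comp ho)

lemma measurable_thinning_right (h : IsMarkedPoisson P Λ η κ ξ Y) (t : ℝ) :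
    Measurable (thinning κ ξ Y t) :=
  h.measurable_thinning measurable_const measurable_id

lemma measurable_marks (h : IsMarkedPoisson P Λ η κ ξ Y) (t : ℝ) (n : ℕ) : Measurable fun ω => Y t n ω :=
  (h.marks.measurable n).comp (measurable_prodMk_left (x := t))

lemma integral_mark [IsProbabilityMeasure P] (h : IsMarkedPoisson P Λ η κ ξ Y) {t : ℝ}
    (ht : t ∈ Set.Icc (0 : ℝ) 1) (n : ℕ) (g : Bool → ℝ) :
    ∫ ω, g (Y t n ω) ∂P = (1 - t) * g false + t * g true := by
  have h1 : ∫ ω, g (Y t n ω) ∂P = ∫ y, g y ∂(P.map (Y t n)) := by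
    rw [integral_map (h.measurable_marks t n).aemeasurable
      (measurable_of_countable g).aestronglyMeasurable]
  have hi : ∀ (c : ℝ≥0∞) (b : Bool), c ≠ ∞ → Integrable g (c • Measure.dirac b) :=
    fun c b hc => Integrable.smul_measure (by simp) hc
  rw [h1, h.marks.law t ht n, integral_add_measure (hi _ _ ENNReal.ofReal_ne_top)
      (hi _ _ ENNReal.ofReal_ne_top), integral_smul_measure, integral_smul_measure,
    integral_dirac, integral_dirac, ENNReal.toReal_ofReal (by linarith [ht.2]),
    ENNReal.toReal_ofReal ht.1]
  rfl

lemma integral_prod_marks [IsProbabilityMeasure P] (h : IsMarkedPoisson P Λ η κ ξ Y) {t : ℝ}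
    (ht : t ∈ Set.Icc (0 : ℝ) 1) (N : ℕ) (g : ℕ → Bool → ℝ) :
    ∫ ω, ∏ n ∈ Finset.range N, g n (Y t n ω) ∂P
      = ∏ n ∈ Finset.range N, ((1 - t) * g n false + t * g n true) := by
  simp_rw [Finset.prod_range]
  rw [((h.marks.indep t ht).precomp (g := fun i : Fin N => (i : ℕ))
    Fin.val_injective).integral_fun_prod_comp (f := fun i : Fin N => g i)
    (fun i => (h.measurable_marks t i).aemeasurable)
    (fun i => (measurable_of_countable _).aestronglyMeasurable)]
  exact Finset.prod_congr rfl fun i _ => h.integral_mark ht i (g i)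

/-- The joint Laplace functional of a Poisson process and its `t`-thinning. -/
theorem laplace_thinning [IsProbabilityMeasure P] (h : IsMarkedPoisson P Λ η κ ξ Y) {t : ℝ}
    (ht : t ∈ Set.Icc (0 : ℝ) 1) {u v : X → ℝ≥0∞} (hu : Measurable u) (hv : Measurable v) :
    ∫ ω, expNeg (∫⁻ x, u x ∂(η ω).toMeasure
        + ∫⁻ x, v x ∂(thinning κ ξ Y t ω).toMeasure) ∂P
      = expNeg (∫⁻ x, ENNReal.ofReal (1 - expNeg (u x) * (1 - t + t * expNeg (v x))) ∂Λ) := by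
  -- `z x` is the mean of `e^{-u(x) - Y v(x)}` over one mark `Y`. Averaging over the marks given the
  -- points therefore replaces the pair `(u, v)` by the single function `w = -log z`, which may take
  -- the value `∞`.
  set z : X → ℝ := fun x => expNeg (u x) * (1 - t + t * expNeg (v x)) with hz
  have hz0 : ∀ x, 0 ≤ z x := fun x => mul_nonneg (expNeg_nonneg _)
    (add_nonneg (by linarith [ht.2]) (mul_nonneg ht.1 (expNeg_nonneg _)))
  have hz1 : ∀ x, z x ≤ 1 := by
    intro x
    refine mul_le_one₀ (expNeg_le_one _)
      (add_nonneg (by linarith [ht.2]) (mul_nonneg ht.1 (expNeg_nonneg _))) ?_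
    nlinarith [expNeg_le_one (v x), ht.1]
  have hzm : Measurable z := (measurable_expNeg_comp hu).mul
    (((measurable_expNeg_comp hv).const_mul t).const_add (1 - t))
  set w : X → ℝ≥0∞ := fun x => negLog (z x) with hw
  have hwm : Measurable w := measurable_negLog.comp hzm
  have hwz : ∀ x, expNeg (w x) = z x := fun x => expNeg_negLog (hz0 x) (hz1 x)
  have hκ : ∀ n : ℕ, MeasurableSet {ω | (n : ℕ∞) < κ ω} :=
    fun n => h.measurable_card (MeasurableSet.of_discrete (s := Set.Ioi (n : ℕ∞)))
  -- Only the first `N` points are treated, so that finitely many independent marks occur; `N → ∞`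
  -- follows by dominated convergence.
  have key : ∀ N : ℕ,
      ∫ ω, ∏ n ∈ Finset.range N, expNeg (if (n : ℕ∞) < κ ω then
          u (ξ n ω) + (if Y t n ω = true then v (ξ n ω) else 0) else 0) ∂P
        = ∫ ω, ∏ n ∈ Finset.range N, expNeg (if (n : ℕ∞) < κ ω then w (ξ n ω) else 0) ∂P := by
    intro N
    set K : Ω → ℕ∞ × (ℕ → X) := fun ω => (κ ω, fun n => ξ n ω) with hK
    have hKm : Measurable K :=
      h.measurable_card.prodMk (measurable_pi_lambda _ h.measurable_point)
    have hYm : Measurable fun ω n => Y t n ω := measurable_pi_lambda _ (h.measurable_marks t)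
    let G : (ℕ∞ × (ℕ → X)) × (ℕ → Bool) → ℝ := fun p =>
      ∏ n ∈ Finset.range N, expNeg (if (n : ℕ∞) < p.1.1 then
          u (p.1.2 n) + (if p.2 n = true then v (p.1.2 n) else 0) else 0)
    have hGm : Measurable G := by
      refine Finset.measurable_fun_prod _ fun n _ => measurable_expNeg_comp ?_
      have hx : Measurable fun p : (ℕ∞ × (ℕ → X)) × (ℕ → Bool) => p.1.2 n :=
        (measurable_pi_apply n).comp (measurable_snd.comp measurable_fst)
      refine Measurable.ite ?_ ((hu.comp hx).add
        (Measurable.ite ?_ (hv.comp hx) measurable_const)) measurable_const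
      · exact (measurable_fst.comp measurable_fst) (MeasurableSet.of_discrete (s := Set.Ioi (n : ℕ∞)))
      · have hy : Measurable fun p : (ℕ∞ × (ℕ → X)) × (ℕ → Bool) => p.2 n :=
          (measurable_pi_apply n).comp measurable_snd
        exact hy (measurableSet_singleton true)
    have hGb : ∀ p, ‖G p‖ ≤ 1 := by
      intro p
      rw [Real.norm_eq_abs, Finset.abs_prod]
      exact Finset.prod_le_one (fun _ _ => abs_nonneg _) fun _ _ => abs_expNeg_le_one _
    have hp1 : IsProbabilityMeasure (P.map K) := Measure.isProbabilityMeasure_map hKm.aemeasurable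
    have hp2 : IsProbabilityMeasure (P.map fun ω n => Y t n ω) :=
      Measure.isProbabilityMeasure_map hYm.aemeasurable
    have hprod : P.map (fun ω => (K ω, fun n => Y t n ω))
        = (P.map K).prod (P.map fun ω n => Y t n ω) :=
      (indepFun_iff_map_prod_eq_prod_map_map hKm.aemeasurable hYm.aemeasurable).1
        (h.marks.indep_points t ht).symm
    calc _ = ∫ ω, G (K ω, fun n => Y t n ω) ∂P := rfl
      _ = ∫ p, G p ∂(P.map (fun ω => (K ω, fun n => Y t n ω))) :=
          (integral_map (hKm.prodMk hYm).aemeasurable hGm.aestronglyMeasurable).symm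
      _ = ∫ k, ∫ y, G (k, y) ∂(P.map fun ω n => Y t n ω) ∂(P.map K) := by
          rw [hprod, integral_prod]
          exact Integrable.of_bound hGm.aestronglyMeasurable 1 (ae_of_all _ hGb)
      _ = ∫ k, ∏ n ∈ Finset.range N, expNeg (if (n : ℕ∞) < k.1 then w (k.2 n) else 0)
            ∂(P.map K) := by
          refine integral_congr_ae (ae_of_all _ fun k => ?_)
          simp only
          have hGk : Measurable fun y => G (k, y) := hGm.comp measurable_prodMk_left
          rw [integral_map hYm.aemeasurable hGk.aestronglyMeasurable]
          simp only [G]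
          rw [h.integral_prod_marks ht N fun n y => expNeg (if (n : ℕ∞) < k.1 then
            u (k.2 n) + (if y = true then v (k.2 n) else 0) else 0)]
          refine Finset.prod_congr rfl fun n _ => ?_
          by_cases hn : (n : ℕ∞) < k.1
          · simp only [hn, if_true, hwz, hz, expNeg_add]
            simp
            ring
          · simp [hn]
      _ = _ := by
          rw [integral_map hKm.aemeasurable]
          refine (Finset.measurable_fun_prod _ fun n _ => measurable_expNeg_comp
            (Measurable.ite ?_ ?_ measurable_const)).aestronglyMeasurable
          · exact measurable_fst (MeasurableSet.of_discrete (s := Set.Ioi (n : ℕ∞)))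
          · exact hwm.comp ((measurable_pi_apply n).comp measurable_snd)
  have hlimL : Tendsto (fun N => ∫ ω, ∏ n ∈ Finset.range N, expNeg (if (n : ℕ∞) < κ ω then
          u (ξ n ω) + (if Y t n ω = true then v (ξ n ω) else 0) else 0) ∂P) atTop
      (𝓝 (∫ ω, expNeg (∫⁻ x, u x ∂(η ω).toMeasure
        + ∫⁻ x, v x ∂(thinning κ ξ Y t ω).toMeasure) ∂P)) := by
    refine tendsto_integral_of_dominated_convergence (fun _ => 1) (fun N => ?_)
      (integrable_const _) (fun N => ae_of_all _ fun ω => ?_) (ae_of_all _ fun ω => ?_)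
    · refine (Finset.measurable_fun_prod _ fun n _ => measurable_expNeg_comp ?_).aestronglyMeasurable
      have hx := h.measurable_point n
      refine Measurable.ite (hκ n) ((hu.comp hx).add
        (Measurable.ite ?_ (hv.comp hx) measurable_const)) measurable_const
      exact h.measurable_marks t n (measurableSet_singleton true)
    · rw [Real.norm_eq_abs, Finset.abs_prod]
      exact Finset.prod_le_one (fun _ _ => abs_nonneg _) fun _ _ => abs_expNeg_le_one _
    · have : ∫⁻ x, u x ∂(η ω).toMeasure + ∫⁻ x, v x ∂(thinning κ ξ Y t ω).toMeasure
          = ∑' n : ℕ, if (n : ℕ∞) < κ ω then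
              u (ξ n ω) + (if Y t n ω = true then v (ξ n ω) else 0) else 0 := by
        rw [h.eq_sum, h.toMeasure_thinning, lintegral_pointSum _ _ _ hu,
          lintegral_pointSum _ _ _ hv, ← ENNReal.tsum_add]
        refine tsum_congr fun n => ?_
        by_cases h1 : (n : ℕ∞) < κ ω <;> by_cases h2 : Y t n ω = true <;> simp [h1, h2]
      rw [this]
      exact tendsto_prod_expNeg _
  have hlimR : Tendsto (fun N => ∫ ω, ∏ n ∈ Finset.range N,
        expNeg (if (n : ℕ∞) < κ ω then w (ξ n ω) else 0) ∂P) atTop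
      (𝓝 (∫ ω, expNeg (∫⁻ x, w x ∂(η ω).toMeasure) ∂P)) := by
    refine tendsto_integral_of_dominated_convergence (fun _ => 1) (fun N => ?_)
      (integrable_const _) (fun N => ae_of_all _ fun ω => ?_) (ae_of_all _ fun ω => ?_)
    · exact (Finset.measurable_fun_prod _ fun n _ => measurable_expNeg_comp
        (Measurable.ite (hκ n) (hwm.comp (h.measurable_point n))
          measurable_const)).aestronglyMeasurable
    · rw [Real.norm_eq_abs, Finset.abs_prod]
      exact Finset.prod_le_one (fun _ _ => abs_nonneg _) fun _ _ => abs_expNeg_le_one _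
    · rw [h.eq_sum, lintegral_pointSum _ _ _ hwm]
      simp only [and_true]
      exact tendsto_prod_expNeg _
  have heq : ∫ ω, expNeg (∫⁻ x, u x ∂(η ω).toMeasure
        + ∫⁻ x, v x ∂(thinning κ ξ Y t ω).toMeasure) ∂P
      = ∫ ω, expNeg (∫⁻ x, w x ∂(η ω).toMeasure) ∂P := by
    refine tendsto_nhds_unique hlimL ?_
    simp_rw [key]
    exact hlimR
  rw [heq, h.poisson.laplace hwm]
  simp_rw [hwz, hz]

/-- The `t`-thinning of a Poisson process with intensity measure `Λ` is a Poisson process with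
intensity measure `t Λ`. -/
theorem isPoissonProcess_thinning [IsProbabilityMeasure P] (h : IsMarkedPoisson P Λ η κ ξ Y)
    {t : ℝ} (ht : t ∈ Set.Icc (0 : ℝ) 1) :
    IsPoissonProcess P (thinning κ ξ Y t) (ENNReal.ofReal t • Λ) := by
  refine isPoissonProcess_of_laplace (h.measurable_thinning_right t) fun u hu => ?_
  have h1 := h.laplace_thinning ht (measurable_const (a := (0 : ℝ≥0∞))) hu
  simp only [lintegral_zero, zero_add, expNeg_zero, one_mul] at h1
  rw [h1, lintegral_smul_measure, smul_eq_mul, ← lintegral_const_mul]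
  · congr 1
    refine lintegral_congr fun x => ?_
    rw [← ENNReal.ofReal_mul ht.1]
    congr 1
    ring
  · exact ENNReal.measurable_ofReal.comp ((measurable_expNeg_comp hu).const_sub 1)

/-- The integral with respect to `Π_{(1-t)Λ}` as an expectation over the `(1-t)`-thinning. -/
theorem avgDiff_eq [IsProbabilityMeasure P] (h : IsMarkedPoisson P Λ η κ ξ Y)
    {f : Config X → ℝ} (hf : Measurable f) (x : X) (ω : Ω) :
    avgDiff Λ f κ ξ Y x ω = ∫⁻ t in Set.Icc (0 : ℝ) 1, ∫⁻ ω', ENNReal.ofReal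
      (diffOp f x (thinning κ ξ Y t ω + thinning κ ξ Y (1 - t) ω')) ∂P := by
  refine setLIntegral_congr_fun measurableSet_Icc fun t ht => ?_
  have ht' : 1 - t ∈ Set.Icc (0 : ℝ) 1 := ⟨by linarith [ht.2], by linarith [ht.1]⟩
  rw [(h.isPoissonProcess_thinning ht').map_eq_poissonLaw,
    lintegral_map _ (h.measurable_thinning_right _)]
  have h1 : Measurable fun μ : Config X => thinning κ ξ Y t ω + μ :=
    Config.measurable_add measurable_const measurable_id
  exact ENNReal.measurable_ofReal.comp
    ((hf.comp (Config.measurable_add h1 measurable_const)).sub (hf.comp h1))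

end IsMarkedPoisson

/-! ### Campbell's formula and the Mecke equation -/

/-- The difference quotient `2^k (1 - e^{-y / 2^k})`. -/
def expQuot (k : ℕ) (y : ℝ≥0∞) : ℝ≥0∞ := ENNReal.ofReal (2 ^ k * (1 - expNeg (2⁻¹ ^ k * y)))

lemma expQuot_mono_right (k : ℕ) : Monotone (expQuot k) := by
  intro y y' h
  refine ENNReal.ofReal_le_ofReal (mul_le_mul_of_nonneg_left ?_ (by positivity))
  exact sub_le_sub_left (expNeg_antitone (mul_le_mul_right h _)) 1

lemma continuous_expQuot (k : ℕ) : Continuous (expQuot k) := by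
  refine ENNReal.continuous_ofReal.comp (continuous_const.mul (continuous_const.sub
    (continuous_expNeg.comp (ENNReal.continuous_const_mul ?_))))
  simp

/-- Halving the step, with `z = e^{-y/2^{k+1}}`, amounts to `1 - z² ≤ 2(1 - z)`. Monotonicity
permits differentiating the Laplace functional by monotone convergence, without integrability
assumptions. -/
lemma expQuot_mono_left (y : ℝ≥0∞) : Monotone fun k => expQuot k y := by
  refine monotone_nat_of_le_succ fun k => ENNReal.ofReal_le_ofReal ?_
  have h1 : expNeg (2⁻¹ ^ k * y) = expNeg (2⁻¹ ^ (k + 1) * y) * expNeg (2⁻¹ ^ (k + 1) * y) := by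
    rw [← expNeg_add, ← add_mul]
    congr 2
    rw [pow_succ, ← mul_add, ENNReal.inv_two_add_inv_two, mul_one]
  rw [h1]
  generalize expNeg (2⁻¹ ^ (k + 1) * y) = z
  have h4 : (0 : ℝ) < 2 ^ k := by positivity
  rw [pow_succ]
  nlinarith [mul_nonneg h4.le (sq_nonneg (1 - z))]

lemma expQuot_top (k : ℕ) : expQuot k ∞ = 2 ^ k := by
  have h : (2⁻¹ : ℝ≥0∞) ^ k ≠ 0 := by simp
  rw [expQuot, ENNReal.mul_top h, expNeg_top, sub_zero, mul_one,
    ENNReal.ofReal_pow (by norm_num)]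
  simp

lemma expQuot_coe (k : ℕ) (y : ℝ≥0) :
    expQuot k y = ENNReal.ofReal (2 ^ k * (1 - Real.exp (-(2⁻¹ ^ k * y)))) := by
  have : (2⁻¹ : ℝ≥0∞) ^ k * y = ((2⁻¹ ^ k * y : ℝ≥0) : ℝ≥0∞) := by
    rw [ENNReal.coe_mul, ENNReal.coe_pow, ENNReal.coe_inv two_ne_zero]
    rfl
  rw [expQuot, this, expNeg_coe]
  push_cast
  rfl

lemma expQuot_le (k : ℕ) (y : ℝ≥0∞) : expQuot k y ≤ y := by
  induction y with
  | top => exact le_top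
  | coe y =>
    rw [expQuot_coe, ← ENNReal.ofReal_coe_nnreal]
    refine ENNReal.ofReal_le_ofReal ?_
    have h1 := Real.add_one_le_exp (-(2⁻¹ ^ k * (y : ℝ)))
    have h2 : (2 : ℝ) ^ k * (2⁻¹ ^ k * y) = y := by
      rw [← mul_assoc, ← mul_pow]; norm_num
    have h4 : (0 : ℝ) < 2 ^ k := by positivity
    nlinarith

/-- For finite `y` these are difference quotients of `θ ↦ 1 - e^{-θy}` at `0`, whose derivative
there is `y`. -/
lemma iSup_expQuot (y : ℝ≥0∞) : ⨆ k, expQuot k y = y := by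
  refine le_antisymm (iSup_le fun k => expQuot_le k y) ?_
  suffices h : Tendsto (fun k => expQuot k y) atTop (𝓝 y) from
    le_of_tendsto' h fun k => le_iSup (fun k => expQuot k y) k
  induction y with
  | top =>
    simp_rw [expQuot_top]
    exact ENNReal.tendsto_pow_atTop_nhds_top_iff.2 (by norm_num)
  | coe y =>
    simp_rw [expQuot_coe]
    rw [← ENNReal.ofReal_coe_nnreal]
    refine ENNReal.tendsto_ofReal ?_
    have hpow : Tendsto (fun k : ℕ => (2⁻¹ : ℝ) ^ k) atTop (𝓝[≠] 0) := by
      refine tendsto_nhdsWithin_iff.2 ⟨tendsto_pow_atTop_nhds_zero_of_lt_one (by norm_num)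
        (by norm_num), Eventually.of_forall fun k => ?_⟩
      simp
    have hd : HasDerivAt (fun θ : ℝ => 1 - Real.exp (-(θ * y))) (y : ℝ) 0 := by
      have := ((((hasDerivAt_id (0 : ℝ)).mul_const (y : ℝ)).neg).exp).const_sub 1
      simpa using this
    have := hd.tendsto_slope_zero.comp hpow
    refine this.congr fun k => ?_
    simp

/-- Campbell's formula for `η(w) e^{-η(u)}`. -/
theorem IsPoissonProcess.lintegral_mul_expNeg {P : Measure Ω} [IsProbabilityMeasure P]
    {η : Ω → Config X} {Λ : Measure X} (hη : IsPoissonProcess P η Λ) {u w : X → ℝ≥0∞}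
    (hu : Measurable u) (hw : Measurable w) :
    ∫⁻ ω, (∫⁻ x, w x ∂(η ω).toMeasure)
        * ENNReal.ofReal (expNeg (∫⁻ x, u x ∂(η ω).toMeasure)) ∂P
      = (∫⁻ x, w x * ENNReal.ofReal (expNeg (u x)) ∂Λ)
        * ENNReal.ofReal (expNeg (∫⁻ x, ENNReal.ofReal (1 - expNeg (u x)) ∂Λ)) := by
  have hηu : ∀ {v : X → ℝ≥0∞}, Measurable v → Measurable fun ω => ∫⁻ x, v x ∂(η ω).toMeasure :=
    fun hv => (measurable_lintegral hv).comp hη.measurable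
  have hem : Measurable fun x => ENNReal.ofReal (expNeg (u x)) :=
    ENNReal.measurable_ofReal.comp (measurable_expNeg_comp hu)
  set d := ∫⁻ x, w x * ENNReal.ofReal (expNeg (u x)) ∂Λ with hd
  set A := ∫⁻ x, ENNReal.ofReal (1 - expNeg (u x)) ∂Λ with hA
  let D : ℕ → ℝ≥0∞ := fun k => ∫⁻ x, expQuot k (w x) * ENNReal.ofReal (expNeg (u x)) ∂Λ
  have hqm : ∀ k, Measurable (expQuot k) := fun k => (continuous_expQuot k).measurable
  have hDm : ∀ k, Measurable fun x => expQuot k (w x) * ENNReal.ofReal (expNeg (u x)) :=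
    fun k => ((hqm k).comp hw).mul hem
  have hDmono : Monotone D := fun j k hjk =>
    lintegral_mono fun x => mul_le_mul_left (expQuot_mono_left _ hjk) _
  have hDsup : ⨆ k, D k = d := by
    rw [← lintegral_iSup hDm
      (fun j k hjk x => mul_le_mul_left (expQuot_mono_left _ hjk) _)]
    simp_rw [← ENNReal.iSup_mul, iSup_expQuot, hd]
  -- The index occurs both in the quotient and in its argument; monotonicity in each reduces the
  -- double supremum to the diagonal.
  have hsup : ⨆ k, expQuot k (D k) = d := by
    refine le_antisymm (iSup_le fun k => (expQuot_le k _).trans (hDsup ▸ le_iSup D k)) ?_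
    rw [← iSup_expQuot d]
    refine iSup_le fun j => ?_
    rw [← hDsup, (expQuot_mono_right j).map_iSup_of_continuousAt
      (continuous_expQuot j).continuousAt (by simp [expQuot])]
    refine iSup_le fun k => le_iSup_of_le (max j k) ?_
    exact (expQuot_mono_left _ (le_max_left j k)).trans
      (expQuot_mono_right _ (hDmono (le_max_right j k)))
  -- This compares the Laplace functional at `u` and at `u + 2^{-k} w`. The exponent grows by
  -- `2^{-k} D k`, since `1 - e^{-(u+θw)} = (1 - e^{-u}) + e^{-u}(1 - e^{-θw})`.
  have hstep : ∀ k, ∫⁻ ω, expQuot k (∫⁻ x, w x ∂(η ω).toMeasure)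
        * ENNReal.ofReal (expNeg (∫⁻ x, u x ∂(η ω).toMeasure)) ∂P
      = expQuot k (D k) * ENNReal.ofReal (expNeg A) := by
    intro k
    have hwk : Measurable fun x => (2⁻¹ : ℝ≥0∞) ^ k * w x := hw.const_mul _
    have hsum : ∀ μ : Measure X, ∫⁻ x, (u x + 2⁻¹ ^ k * w x) ∂μ
        = ∫⁻ x, u x ∂μ + 2⁻¹ ^ k * ∫⁻ x, w x ∂μ := by
      intro μ
      rw [lintegral_add_left hu, lintegral_const_mul _ hw]
    have hlap := hη.laplace (hu.add hwk)
    have hA' : ∫⁻ x, ENNReal.ofReal (1 - expNeg (u x + 2⁻¹ ^ k * w x)) ∂Λ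
        = A + 2⁻¹ ^ k * D k := by
      rw [hA, ← lintegral_const_mul _ (hDm k), ← lintegral_add_left]
      · refine lintegral_congr fun x => ?_
        have h2 : (2⁻¹ : ℝ≥0∞) ^ k = ENNReal.ofReal (2⁻¹ ^ k) := by
          rw [ENNReal.ofReal_pow (by norm_num), ENNReal.ofReal_inv_of_pos (by norm_num)]
          simp
        have h0 := expNeg_le_one (u x)
        have h1 := expNeg_le_one (2⁻¹ ^ k * w x)
        rw [expNeg_add, expQuot, ← ENNReal.ofReal_mul, h2,
          ← ENNReal.ofReal_mul (by positivity), ← ENNReal.ofReal_add, ← h2]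
        · congr 1
          have h3 : (2⁻¹ : ℝ) ^ k * 2 ^ k = 1 := by rw [← mul_pow]; norm_num
          linear_combination -(1 - expNeg (2⁻¹ ^ k * w x)) * expNeg (u x) * h3
        · linarith
        · rw [← h2]
          have := expNeg_nonneg (u x)
          have h3 : 0 ≤ 1 - expNeg (2⁻¹ ^ k * w x) := by linarith
          positivity
        · have h3 : 0 ≤ 1 - expNeg (2⁻¹ ^ k * w x) := by linarith
          positivity
      · exact ENNReal.measurable_ofReal.comp ((measurable_expNeg_comp hu).const_sub 1)
    simp only [Pi.add_apply] at hlap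
    simp_rw [hsum] at hlap
    rw [hA', expNeg_add] at hlap
    have hi1 : Integrable (fun ω => expNeg (∫⁻ x, u x ∂(η ω).toMeasure)) P :=
      integrable_expNeg (hηu hu).aemeasurable
    have hi2 : Integrable (fun ω => expNeg (∫⁻ x, u x ∂(η ω).toMeasure
        + 2⁻¹ ^ k * ∫⁻ x, w x ∂(η ω).toMeasure)) P :=
      integrable_expNeg ((hηu hu).add ((hηu hw).const_mul _)).aemeasurable
    have hpt : ∀ ω, expQuot k (∫⁻ x, w x ∂(η ω).toMeasure)
        * ENNReal.ofReal (expNeg (∫⁻ x, u x ∂(η ω).toMeasure))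
        = ENNReal.ofReal (2 ^ k * (expNeg (∫⁻ x, u x ∂(η ω).toMeasure)
          - expNeg (∫⁻ x, u x ∂(η ω).toMeasure + 2⁻¹ ^ k * ∫⁻ x, w x ∂(η ω).toMeasure))) := by
      intro ω
      rw [expQuot, ← ENNReal.ofReal_mul' (expNeg_nonneg _), expNeg_add]
      congr 1
      ring
    simp_rw [hpt]
    have hi3 : Integrable (fun ω => 2 ^ k * (expNeg (∫⁻ x, u x ∂(η ω).toMeasure)
        - expNeg (∫⁻ x, u x ∂(η ω).toMeasure + 2⁻¹ ^ k * ∫⁻ x, w x ∂(η ω).toMeasure))) P :=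
      (hi1.sub hi2).const_mul _
    rw [← ofReal_integral_eq_lintegral_ofReal hi3
      (ae_of_all _ fun ω => mul_nonneg (by positivity)
        (sub_nonneg.2 (expNeg_antitone le_self_add))), integral_const_mul,
      integral_sub hi1 hi2, hlap, hη.laplace hu, expQuot, ← ENNReal.ofReal_mul' (expNeg_nonneg _)]
    congr 1
    ring
  calc ∫⁻ ω, (∫⁻ x, w x ∂(η ω).toMeasure)
        * ENNReal.ofReal (expNeg (∫⁻ x, u x ∂(η ω).toMeasure)) ∂P
      = ∫⁻ ω, ⨆ k, expQuot k (∫⁻ x, w x ∂(η ω).toMeasure)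
        * ENNReal.ofReal (expNeg (∫⁻ x, u x ∂(η ω).toMeasure)) ∂P := by
        simp_rw [← ENNReal.iSup_mul, iSup_expQuot]
    _ = ⨆ k, ∫⁻ ω, expQuot k (∫⁻ x, w x ∂(η ω).toMeasure)
        * ENNReal.ofReal (expNeg (∫⁻ x, u x ∂(η ω).toMeasure)) ∂P := by
        refine lintegral_iSup (fun k => ((hqm k).comp (hηu hw)).mul
          (ENNReal.measurable_ofReal.comp (measurable_expNeg_comp (hηu hu)))) ?_
        exact fun j k hjk ω => mul_le_mul_left (expQuot_mono_left _ hjk) _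
    _ = d * ENNReal.ofReal (expNeg A) := by
        simp_rw [hstep]
        rw [← ENNReal.iSup_mul, hsup]

lemma pointSum_eq_add_dirac {κ : ℕ∞} (ξ : ℕ → X) {n : ℕ} (hn : (n : ℕ∞) < κ) :
    pointSum κ ξ (fun _ => true)
      = pointSum κ ξ (fun m => decide (m ≠ n)) + Measure.dirac (ξ n) := by
  ext B hB
  rw [Measure.add_apply, pointSum_apply _ _ _ hB, pointSum_apply _ _ _ hB,
    ENNReal.tsum_eq_add_tsum_ite n, add_comm]
  congr 1
  · refine tsum_congr fun m => ?_
    by_cases hm : m = n <;> simp [hm]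
  · simp [hn, hB]

/-- The configuration of the points `ξ m`, `m < κ`, `m ≠ n`. -/
def punctured (κ : Ω → ℕ∞) (ξ : ℕ → Ω → X) (n : ℕ) (ω : Ω) : Config X :=
  Config.ofMeasure (pointSum (κ ω) (fun m => ξ m ω) fun m => decide (m ≠ n))

namespace IsMarkedPoisson

variable {P : Measure Ω} {Λ : Measure X} {η : Ω → Config X} {κ : Ω → ℕ∞}
    {ξ : ℕ → Ω → X} {Y : ℝ → ℕ → Ω → Bool}

lemma toMeasure_punctured (h : IsMarkedPoisson P Λ η κ ξ Y) (n : ℕ) (ω : Ω) :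
    (punctured κ ξ n ω).toMeasure
      = pointSum (κ ω) (fun m => ξ m ω) (fun m => decide (m ≠ n)) :=
  toMeasure_ofMeasure (h.isConfig_pointSum _ ω)

lemma measurable_punctured (h : IsMarkedPoisson P Λ η κ ξ Y) (n : ℕ) :
    Measurable (punctured κ ξ n) := by
  refine measurable_of_apply fun B hB => ?_
  simp_rw [h.toMeasure_punctured, pointSum_apply _ _ _ hB]
  refine Measurable.tsum fun m => Measurable.ite ?_ ?_ measurable_const
  · exact (h.measurable_card (MeasurableSet.of_discrete (s := Set.Ioi (m : ℕ∞)))).inter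
      (MeasurableSet.const _)
  · exact (measurable_one.indicator hB).comp (h.measurable_point m)

lemma eq_punctured_add (h : IsMarkedPoisson P Λ η κ ξ Y) {n : ℕ} {ω : Ω} (hn : (n : ℕ∞) < κ ω) :
    η ω = punctured κ ξ n ω + point (ξ n ω) := by
  apply toMeasure_injective
  rw [h.eq_sum, pointSum_eq_add_dirac _ hn, ← h.toMeasure_punctured, toMeasure_add,
    toMeasure_point]

/-- This identifies the measure subtraction in `reducedIntegral` with deletion of one index, which
stays correct when several points coincide. -/
lemma ofMeasure_sub_dirac (h : IsMarkedPoisson P Λ η κ ξ Y) {n : ℕ} {ω : Ω}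
    (hn : (n : ℕ∞) < κ ω) :
    ofMeasure ((η ω).toMeasure - Measure.dirac (ξ n ω)) = punctured κ ξ n ω := by
  rw [h.eq_punctured_add hn, toMeasure_add, toMeasure_point, Measure.add_sub_cancel,
    ofMeasure_toMeasure]

/-- The Mecke equation. -/
theorem mecke [IsProbabilityMeasure P] [SigmaFinite Λ] (h : IsMarkedPoisson P Λ η κ ξ Y)
    {H : X × Config X → ℝ≥0∞} (hH : Measurable H) :
    ∫⁻ ω, ∑' n : ℕ, (if (n : ℕ∞) < κ ω then H (ξ n ω, punctured κ ξ n ω) else 0) ∂P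
      = ∫⁻ ω, ∫⁻ x, H (x, η ω) ∂Λ ∂P := by
  have hκ : ∀ n : ℕ, MeasurableSet {ω | (n : ℕ∞) < κ ω} :=
    fun n => h.measurable_card (MeasurableSet.of_discrete (s := Set.Ioi (n : ℕ∞)))
  have hp : ∀ n : ℕ, Measurable fun ω => (ξ n ω, punctured κ ξ n ω) :=
    fun n => (h.measurable_point n).prodMk (h.measurable_punctured n)
  have hηm := h.poisson.measurable
  -- `M` is the reduced Campbell measure, and the assertion is that it equals the product of `Λ` and
  -- the law of `η`.
  set M : Measure (X × Config X) := Measure.sum fun n : ℕ =>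
    (P.restrict {ω | (n : ℕ∞) < κ ω}).map fun ω => (ξ n ω, punctured κ ξ n ω) with hM
  have hMint : ∀ {G : X × Config X → ℝ≥0∞}, Measurable G → ∫⁻ p, G p ∂M
      = ∫⁻ ω, ∑' n : ℕ, (if (n : ℕ∞) < κ ω then G (ξ n ω, punctured κ ξ n ω) else 0) ∂P := by
    intro G hG
    rw [hM, lintegral_sum_measure, lintegral_tsum]
    · refine tsum_congr fun n => ?_
      rw [lintegral_map hG (hp n), ← lintegral_indicator (hκ n)]
      refine lintegral_congr fun ω => ?_
      simp [Set.indicator_apply]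
    · exact fun n => (Measurable.ite (hκ n) (hG.comp (hp n)) measurable_const).aemeasurable
  have : IsProbabilityMeasure (P.map η) := Measure.isProbabilityMeasure_map hηm.aemeasurable
  suffices hMeq : M = Λ.prod (P.map η) by
    rw [← hMint hH, hMeq, lintegral_prod_symm' _ hH, lintegral_map _ hηm]
    exact hH.lintegral_prod_left'
  have hval : ∀ {S : Set X}, MeasurableSet S → ∀ {v u : X → ℝ≥0}, Measurable v → Measurable u →
      ∫⁻ p in S ×ˢ Set.univ, ENNReal.ofReal (expNeg (v p.1 + ∫⁻ x, u x ∂p.2.toMeasure)) ∂M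
        = (∫⁻ x in S, ENNReal.ofReal (expNeg (v x)) ∂Λ) * ENNReal.ofReal
          (expNeg (∫⁻ x, ENNReal.ofReal (1 - expNeg (u x)) ∂Λ)) := by
    intro S hS v u hv hu
    have hv' := hv.coe_nnreal_ennreal
    have hu' := hu.coe_nnreal_ennreal
    have hGm : Measurable fun p : X × Config X =>
        ENNReal.ofReal (expNeg (v p.1 + ∫⁻ x, u x ∂p.2.toMeasure)) :=
      ENNReal.measurable_ofReal.comp (measurable_expNeg_comp ((hv'.comp measurable_fst).add
        ((measurable_lintegral hu').comp measurable_snd)))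
    -- Since `η` is the punctured configuration plus `δ_x`, removing the point costs a factor
    -- `e^{u(x)}`. Finiteness of `u` is needed here; in Campbell's formula the factor cancels
    -- against `e^{-u(x)}`.
    have hwm : Measurable fun x =>
        S.indicator (fun x => ENNReal.ofReal (expNeg (v x) * Real.exp (u x))) x := by
      refine Measurable.indicator (ENNReal.measurable_ofReal.comp ?_) hS
      exact (measurable_expNeg_comp hv').mul (Real.measurable_exp.comp hu.coe_nnreal_real)
    rw [← lintegral_indicator (hS.prod MeasurableSet.univ),
      hMint (hGm.indicator (hS.prod MeasurableSet.univ))]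
    have hpt : ∀ ω, ∑' n : ℕ, (if (n : ℕ∞) < κ ω then (S ×ˢ Set.univ).indicator
          (fun p : X × Config X => ENNReal.ofReal (expNeg (v p.1 + ∫⁻ x, u x ∂p.2.toMeasure)))
          (ξ n ω, punctured κ ξ n ω) else 0)
        = (∫⁻ x, S.indicator (fun x => ENNReal.ofReal (expNeg (v x) * Real.exp (u x))) x
            ∂(η ω).toMeasure) * ENNReal.ofReal (expNeg (∫⁻ x, u x ∂(η ω).toMeasure)) := by
      intro ω
      rw [h.eq_sum, lintegral_pointSum _ _ _ hwm, ← ENNReal.tsum_mul_right, ← h.eq_sum]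
      refine tsum_congr fun n => ?_
      by_cases hn : (n : ℕ∞) < κ ω
      · by_cases hxS : ξ n ω ∈ S
        · rw [if_pos hn, if_pos ⟨hn, rfl⟩, Set.indicator_of_mem (by simpa using hxS),
            Set.indicator_of_mem hxS]
          rw [h.eq_punctured_add hn, toMeasure_add, lintegral_add_measure, lintegral_point hu',
            ← ENNReal.ofReal_mul' (expNeg_nonneg _), expNeg_add, expNeg_add, expNeg_coe (u _),
            Real.exp_neg]
          congr 1
          field_simp
        · simp [hn, hxS]
      · simp [hn]
    simp_rw [hpt]
    rw [h.poisson.lintegral_mul_expNeg hu' hwm, ← lintegral_indicator hS]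
    congr 1
    refine lintegral_congr fun x => ?_
    by_cases hx : x ∈ S
    · simp only [hx, Set.indicator_of_mem]
      rw [← ENNReal.ofReal_mul' (expNeg_nonneg _), expNeg_coe (u _), mul_assoc, ← Real.exp_add]
      simp
    · simp [hx]
  have hcover : ⋃ j, (spanningSets Λ j) ×ˢ (Set.univ : Set (Config X)) = Set.univ := by
    rw [← Set.iUnion_prod_const, iUnion_spanningSets, Set.univ_prod_univ]
  rw [Measure.ext_iff_of_iUnion_eq_univ hcover]
  intro j
  have hS := measurableSet_spanningSets Λ j
  set S := spanningSets Λ j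
  have hSfin : Λ S ≠ ∞ := (measure_spanningSets_lt_top Λ j).ne
  have : IsFiniteMeasure (Λ.restrict S) := isFiniteMeasure_restrict.2 hSfin
  have hprod : (Λ.prod (P.map η)).restrict (S ×ˢ Set.univ) = (Λ.restrict S).prod (P.map η) := by
    rw [← Measure.prod_restrict, Measure.restrict_univ]
  have : IsFiniteMeasure (M.restrict (S ×ˢ Set.univ)) := by
    refine ⟨?_⟩
    -- With `u = v = 0` the formula gives the mass `Λ S` of `M` on the strip, so uniqueness for
    -- finite measures applies there.
    have h0 := hval hS (measurable_const (a := (0 : ℝ≥0))) (measurable_const (a := (0 : ℝ≥0)))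
    simp only [ENNReal.coe_zero, lintegral_zero, add_zero, expNeg_zero, ENNReal.ofReal_one,
      lintegral_one, sub_self, ENNReal.ofReal_zero, mul_one, Measure.restrict_apply_univ] at h0
    rw [Measure.restrict_apply_univ, h0]
    exact hSfin.lt_top
  rw [hprod]
  refine ext_of_laplace_point fun v u hv hu => ?_
  have hv' := hv.coe_nnreal_ennreal
  have hu' := hu.coe_nnreal_ennreal
  have hm : Measurable fun p : X × Config X =>
      expNeg (v p.1 + ∫⁻ x, u x ∂p.2.toMeasure) :=
    measurable_expNeg_comp ((hv'.comp measurable_fst).add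
      ((measurable_lintegral hu').comp measurable_snd))
  rw [integral_eq_lintegral_of_nonneg_ae (ae_of_all _ fun _ => expNeg_nonneg _)
      hm.aestronglyMeasurable, integral_eq_lintegral_of_nonneg_ae
      (ae_of_all _ fun _ => expNeg_nonneg _) hm.aestronglyMeasurable, hval hS hv hu]
  congr 1
  simp_rw [expNeg_add, ENNReal.ofReal_mul (expNeg_nonneg _)]
  have hm2 : Measurable fun m : Config X => expNeg (∫⁻ x, u x ∂m.toMeasure) :=
    measurable_expNeg_comp (measurable_lintegral hu')
  have hm3 : Measurable fun m : Config X => ENNReal.ofReal (expNeg (∫⁻ x, u x ∂m.toMeasure)) :=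
    ENNReal.measurable_ofReal.comp hm2
  have hm4 : Measurable fun x => ENNReal.ofReal (expNeg (v x)) :=
    ENNReal.measurable_ofReal.comp (measurable_expNeg_comp hv')
  rw [lintegral_prod_mul hm4.aemeasurable hm3.aemeasurable]
  congr 1
  have hi : Integrable (fun ω => expNeg (∫⁻ x, u x ∂(η ω).toMeasure)) P :=
    integrable_expNeg ((measurable_lintegral hu').comp hηm).aemeasurable
  rw [lintegral_map hm3 hηm, ← h.poisson.laplace hu', ofReal_integral_eq_lintegral_ofReal hi
      (ae_of_all _ fun _ => expNeg_nonneg _)]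

end IsMarkedPoisson

/-! ### Resampling on a set -/

lemma measurable_diffOp {f : Config X → ℝ} (hf : Measurable f) :
    Measurable fun q : X × Config X => diffOp f q.1 q.2 :=
  (hf.comp (Config.measurable_add measurable_snd (measurable_point.comp measurable_fst))).sub
    (hf.comp measurable_snd)

/-- The exponent of the Laplace functional of a Poisson process. -/
def laplaceExp (Λ : Measure X) (u : X → ℝ≥0∞) : ℝ≥0∞ :=
  ∫⁻ x, ENNReal.ofReal (1 - expNeg (u x)) ∂Λ

/-- On `S`, the process `η` is kept with probability `t` and the rest is resampled from an
independent copy; outside `S` it is replaced by the copy. -/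
def resample (η : Ω → Config X) (κ : Ω → ℕ∞) (ξ : ℕ → Ω → X) (Y : ℝ → ℕ → Ω → Bool)
    (S : Set X) (t : ℝ) (p : Ω × Ω) : Config X :=
  restr S (thinning κ ξ Y t p.1) + (restr S (thinning κ ξ Y (1 - t) p.2) + restr Sᶜ (η p.2))

lemma one_sub_mem_Icc {t : ℝ} (ht : t ∈ Set.Icc (0 : ℝ) 1) : 1 - t ∈ Set.Icc (0 : ℝ) 1 :=
  ⟨by linarith [ht.2], by linarith [ht.1]⟩

namespace IsMarkedPoisson

variable {P : Measure Ω} {Λ : Measure X} {η : Ω → Config X} {κ : Ω → ℕ∞}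
    {ξ : ℕ → Ω → X} {Y : ℝ → ℕ → Ω → Bool}

lemma measurable_resample {E : Type*} [MeasurableSpace E] (h : IsMarkedPoisson P Λ η κ ξ Y)
    {S : Set X} (hS : MeasurableSet S) {τ : E → ℝ} {o : E → Ω × Ω} (hτ : Measurable τ)
    (ho : Measurable o) : Measurable fun e => resample η κ ξ Y S (τ e) (o e) :=
  Config.measurable_add ((measurable_restr hS).comp (h.measurable_thinning hτ ho.fst))
    (Config.measurable_add
      ((measurable_restr hS).comp (h.measurable_thinning (hτ.const_sub 1) ho.snd))
      ((measurable_restr hS.compl).comp (h.poisson.measurable.comp ho.snd)))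

lemma measurable_resample_right (h : IsMarkedPoisson P Λ η κ ξ Y) {S : Set X}
    (hS : MeasurableSet S) (t : ℝ) : Measurable (resample η κ ξ Y S t) :=
  h.measurable_resample hS measurable_const measurable_id

/-- The joint Laplace functional of a Poisson process and its resampling. -/
theorem laplace_resample [IsProbabilityMeasure P] (h : IsMarkedPoisson P Λ η κ ξ Y) {S : Set X}
    (hS : MeasurableSet S) {t : ℝ} (ht : t ∈ Set.Icc (0 : ℝ) 1) {u v : X → ℝ≥0∞}
    (hu : Measurable u) (hv : Measurable v) :
    (∫ p, expNeg (∫⁻ x, u x ∂(η p.1).toMeasure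
        + ∫⁻ x, v x ∂(resample η κ ξ Y S t p).toMeasure) ∂(P.prod P))
      * expNeg (ENNReal.ofReal t
        * ∫⁻ x in S, ENNReal.ofReal ((1 - expNeg (u x)) * (1 - expNeg (v x))) ∂Λ)
      = expNeg (laplaceExp Λ u) * expNeg (laplaceExp Λ v) := by
  have ht' := one_sub_mem_Icc ht
  have hv1 : Measurable (S.indicator v) := hv.indicator hS
  have hv2 : Measurable (Sᶜ.indicator v) := hv.indicator hS.compl
  have hpt : ∀ p : Ω × Ω, expNeg (∫⁻ x, u x ∂(η p.1).toMeasure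
        + ∫⁻ x, v x ∂(resample η κ ξ Y S t p).toMeasure)
      = expNeg (∫⁻ x, u x ∂(η p.1).toMeasure
          + ∫⁻ x, S.indicator v x ∂(thinning κ ξ Y t p.1).toMeasure)
        * expNeg (∫⁻ x, Sᶜ.indicator v x ∂(η p.2).toMeasure
          + ∫⁻ x, S.indicator v x ∂(thinning κ ξ Y (1 - t) p.2).toMeasure) := by
    intro p
    rw [← expNeg_add]
    congr 1
    simp only [resample, toMeasure_add, lintegral_add_measure, lintegral_restr hS,
      lintegral_restr hS.compl]
    ring
  simp_rw [hpt]
  rw [integral_prod_mul (fun ω => expNeg (∫⁻ x, u x ∂(η ω).toMeasure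
          + ∫⁻ x, S.indicator v x ∂(thinning κ ξ Y t ω).toMeasure))
        (fun ω => expNeg (∫⁻ x, Sᶜ.indicator v x ∂(η ω).toMeasure
          + ∫⁻ x, S.indicator v x ∂(thinning κ ξ Y (1 - t) ω).toMeasure)),
    h.laplace_thinning ht hu hv1, h.laplace_thinning ht' hv2 hv1, ← expNeg_add, ← expNeg_add,
    ← expNeg_add]
  have hum := measurable_expNeg_comp hu
  have hvm := measurable_expNeg_comp hv
  have hv1m := measurable_expNeg_comp hv1
  have hv2m := measurable_expNeg_comp hv2
  have m1 : Measurable fun x =>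
      ENNReal.ofReal (1 - expNeg (u x) * (1 - t + t * expNeg (S.indicator v x))) :=
    ENNReal.measurable_ofReal.comp ((hum.mul ((hv1m.const_mul t).const_add _)).const_sub 1)
  have m2 : Measurable fun x => ENNReal.ofReal
      (1 - expNeg (Sᶜ.indicator v x) * (1 - (1 - t) + (1 - t) * expNeg (S.indicator v x))) :=
    ENNReal.measurable_ofReal.comp ((hv2m.mul ((hv1m.const_mul _).const_add _)).const_sub 1)
  have m3 : Measurable fun x => ENNReal.ofReal ((1 - expNeg (u x)) * (1 - expNeg (v x))) :=
    ENNReal.measurable_ofReal.comp ((hum.const_sub 1).mul (hvm.const_sub 1))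
  have m4 : Measurable fun x => ENNReal.ofReal (1 - expNeg (u x)) :=
    ENNReal.measurable_ofReal.comp (hum.const_sub 1)
  rw [laplaceExp, laplaceExp, ← lintegral_add_left m1, ← lintegral_const_mul _ m3,
    ← lintegral_indicator hS, ← lintegral_add_right _ ((m3.const_mul _).indicator hS),
    ← lintegral_add_left m4]
  congr 1
  -- Both sides are single exponentials, and the exponents agree pointwise. Keeping the interaction
  -- term as a factor on the left avoids subtraction and division in `[0, ∞]`, so infinite exponents
  -- are allowed.
  refine lintegral_congr fun x => ?_
  have u0 := expNeg_nonneg (u x)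
  have u1 := expNeg_le_one (u x)
  have v0 := expNeg_nonneg (v x)
  have v1 := expNeg_le_one (v x)
  obtain ⟨t0, t1⟩ := ht
  by_cases hx : x ∈ S
  · simp only [hx, Set.indicator_of_mem, Set.mem_compl_iff, not_true_eq_false, not_false_eq_true,
      Set.indicator_of_notMem, expNeg_zero]
    have hq : 0 ≤ t * (1 - expNeg (v x)) := mul_nonneg t0 (by linarith)
    have hq' : 0 ≤ (1 - t) * (1 - expNeg (v x)) := mul_nonneg (by linarith) (by linarith)
    rw [← ENNReal.ofReal_mul t0, ← ENNReal.ofReal_add, ← ENNReal.ofReal_add,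
      ← ENNReal.ofReal_add]
    · congr 1
      ring
    all_goals nlinarith [mul_nonneg u0 hq, mul_nonneg (sub_nonneg.2 u1) hq]
  · simp only [hx, Set.mem_compl_iff, not_false_eq_true, Set.indicator_of_mem,
      Set.indicator_of_notMem, expNeg_zero]
    rw [add_zero]
    congr 2 <;> ring

/-- The resampled process has the same law as the original one. -/
theorem map_resample [IsProbabilityMeasure P] (h : IsMarkedPoisson P Λ η κ ξ Y) {S : Set X}
    (hS : MeasurableSet S) {t : ℝ} (ht : t ∈ Set.Icc (0 : ℝ) 1) :
    (P.prod P).map (resample η κ ξ Y S t) = P.map η := by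
  have hm := h.measurable_resample_right hS t
  refine ext_of_laplace fun u hu => ?_
  have hu' : Measurable fun m : Config X => expNeg (∫⁻ x, u x ∂m.toMeasure) :=
    measurable_expNeg_comp (measurable_lintegral hu)
  rw [integral_map hm.aemeasurable hu'.aestronglyMeasurable,
    integral_map h.poisson.measurable.aemeasurable hu'.aestronglyMeasurable, h.poisson.laplace hu]
  have h1 := h.laplace_resample hS ht (measurable_const (a := (0 : ℝ≥0∞))) hu
  simpa [laplaceExp] using h1

/-- Resampling everything yields an independent copy. -/
theorem map_resample_zero [IsProbabilityMeasure P] (h : IsMarkedPoisson P Λ η κ ξ Y) {S : Set X}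
    (hS : MeasurableSet S) :
    (P.prod P).map (fun p => (η p.1, resample η κ ξ Y S 0 p)) = (P.map η).prod (P.map η) := by
  have hm : Measurable fun p : Ω × Ω => (η p.1, resample η κ ξ Y S 0 p) :=
    (h.poisson.measurable.comp measurable_fst).prodMk (h.measurable_resample_right hS 0)
  have : IsProbabilityMeasure (P.map η) :=
    Measure.isProbabilityMeasure_map h.poisson.measurable.aemeasurable
  refine ext_of_laplace_prod fun u v hu hv => ?_
  have hu' : ∀ {u : X → ℝ≥0∞}, Measurable u →
      Measurable fun m : Config X => expNeg (∫⁻ x, u x ∂m.toMeasure) :=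
    fun hu => measurable_expNeg_comp (measurable_lintegral hu)
  have huv : Measurable fun m : Config X × Config X =>
      expNeg (∫⁻ x, u x ∂m.1.toMeasure + ∫⁻ x, v x ∂m.2.toMeasure) :=
    measurable_expNeg_comp (((measurable_lintegral hu).comp measurable_fst).add
      ((measurable_lintegral hv).comp measurable_snd))
  rw [integral_map hm.aemeasurable huv.aestronglyMeasurable]
  have h1 := h.laplace_resample hS (Set.left_mem_Icc.2 zero_le_one) hu hv
  simp only [ENNReal.ofReal_zero, zero_mul, expNeg_zero, mul_one] at h1
  rw [h1]
  simp_rw [expNeg_add]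
  rw [integral_prod_mul (fun m : Config X => expNeg (∫⁻ x, u x ∂m.toMeasure))
      (fun m : Config X => expNeg (∫⁻ x, v x ∂m.toMeasure)),
    integral_map h.poisson.measurable.aemeasurable (hu' hu).aestronglyMeasurable,
    integral_map h.poisson.measurable.aemeasurable (hu' hv).aestronglyMeasurable,
    h.poisson.laplace hu, h.poisson.laplace hv]
  rfl

/-- Keeping everything yields the original process. -/
theorem resample_univ_one [IsProbabilityMeasure P] (h : IsMarkedPoisson P Λ η κ ξ Y) :
    ∀ᵐ p ∂(P.prod P), resample η κ ξ Y Set.univ 1 p = η p.1 := by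
  have h1 : ∀ᵐ ω ∂P, ∀ n, Y 1 n ω = true := by
    refine ae_all_iff.2 fun n => ?_
    have := h.marks.law 1 (Set.right_mem_Icc.2 zero_le_one) n
    have h2 : ∀ᵐ y ∂(P.map (Y 1 n)), y = true := by
      rw [this]
      simp [ae_dirac_eq]
    exact ae_of_ae_map (h.measurable_marks 1 n).aemeasurable h2
  have h0 : ∀ᵐ ω ∂P, ∀ n, Y 0 n ω = false := by
    refine ae_all_iff.2 fun n => ?_
    have := h.marks.law 0 (Set.left_mem_Icc.2 zero_le_one) n
    have h2 : ∀ᵐ y ∂(P.map (Y 0 n)), y = false := by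
      rw [this]
      simp [ae_dirac_eq]
    exact ae_of_ae_map (h.measurable_marks 0 n).aemeasurable h2
  filter_upwards [Measure.quasiMeasurePreserving_fst.ae h1,
    Measure.quasiMeasurePreserving_snd.ae h0] with p hp1 hp0
  apply toMeasure_injective
  simp only [resample, restr_univ, Set.compl_univ, restr_empty, sub_self, toMeasure_add,
    toMeasure_zero, add_zero, h.toMeasure_thinning, h.eq_sum, hp1, hp0]
  simp [pointSum]

end IsMarkedPoisson

/-! ### The covariance identity on sets of finite intensity -/

lemma integral_mul_exp_Icc (c : ℝ) : ∫ t in Set.Icc (0 : ℝ) 1, c * Real.exp (t * c)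
    = Real.exp c - 1 := by
  rw [integral_Icc_eq_integral_Ioc, ← intervalIntegral.integral_of_le zero_le_one,
    intervalIntegral.integral_eq_sub_of_hasDerivAt (f := fun t => Real.exp (t * c))]
  · simp
  · intro t _
    have := ((hasDerivAt_id t).mul_const c).exp
    simpa [mul_comm] using this
  · exact (continuous_const.mul (Real.continuous_exp.comp
      (continuous_id.mul continuous_const))).intervalIntegrable _ _

lemma integral_add_sub_add {E : Type*} [MeasurableSpace E] {μ : Measure E} {a b c d : E → ℝ}
    (ha : Integrable a μ) (hb : Integrable b μ) (hc : Integrable c μ) (hd : Integrable d μ) :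
    ∫ x, (a x + b x - (c x + d x)) ∂μ
      = ∫ x, a x ∂μ + ∫ x, b x ∂μ - (∫ x, c x ∂μ + ∫ x, d x ∂μ) := by
  rw [integral_sub (f := fun x => a x + b x) (g := fun x => c x + d x) (ha.add hb) (hc.add hd),
    integral_add ha hb, integral_add hc hd]

namespace IsMarkedPoisson

variable {P : Measure Ω} {Λ : Measure X} {η : Ω → Config X} {κ : Ω → ℕ∞}
    {ξ : ℕ → Ω → X} {Y : ℝ → ℕ → Ω → Bool}

/-- Finite intensity makes the interaction factor nonzero, so it can be moved to the other side. The
dependence on `t` is then a pure exponential. -/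
lemma integral_expNeg_resample [IsProbabilityMeasure P] (h : IsMarkedPoisson P Λ η κ ξ Y)
    {S : Set X} (hS : MeasurableSet S) (hΛS : Λ S ≠ ∞) {t : ℝ} (ht : t ∈ Set.Icc (0 : ℝ) 1)
    {u v : X → ℝ≥0∞} (hu : Measurable u) (hv : Measurable v) :
    ∫ p, expNeg (∫⁻ x, u x ∂(η p.1).toMeasure
        + ∫⁻ x, v x ∂(resample η κ ξ Y S t p).toMeasure) ∂(P.prod P)
      = expNeg (laplaceExp Λ u) * expNeg (laplaceExp Λ v)
        * Real.exp (t * ∫ x in S, (1 - expNeg (u x)) * (1 - expNeg (v x)) ∂Λ) := by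
  have h1 := h.laplace_resample hS ht hu hv
  have : IsFiniteMeasure (Λ.restrict S) := isFiniteMeasure_restrict.2 hΛS
  have hm : Measurable fun x => (1 - expNeg (u x)) * (1 - expNeg (v x)) :=
    ((measurable_expNeg_comp hu).const_sub 1).mul ((measurable_expNeg_comp hv).const_sub 1)
  have hnn : ∀ x, 0 ≤ (1 - expNeg (u x)) * (1 - expNeg (v x)) := fun x =>
    mul_nonneg (sub_nonneg.2 (expNeg_le_one _)) (sub_nonneg.2 (expNeg_le_one _))
  have hle : ∀ x, (1 - expNeg (u x)) * (1 - expNeg (v x)) ≤ 1 := fun x =>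
    mul_le_one₀ (by linarith [expNeg_nonneg (u x)]) (sub_nonneg.2 (expNeg_le_one _))
      (by linarith [expNeg_nonneg (v x)])
  have hi : Integrable (fun x => (1 - expNeg (u x)) * (1 - expNeg (v x))) (Λ.restrict S) :=
    Integrable.of_bound hm.aestronglyMeasurable 1 (ae_of_all _ fun x => by
      rw [Real.norm_eq_abs, abs_of_nonneg (hnn x)]; exact hle x)
  rw [← ofReal_integral_eq_lintegral_ofReal hi (ae_of_all _ hnn), ← ENNReal.ofReal_mul ht.1,
    expNeg_ofReal (mul_nonneg ht.1 (integral_nonneg hnn)), Real.exp_neg] at h1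
  rw [← h1]
  field_simp

/-- The covariance identity on a set of finite intensity. -/
theorem covariance_resample [IsProbabilityMeasure P] [SigmaFinite Λ]
    (h : IsMarkedPoisson P Λ η κ ξ Y)
    {S : Set X} (hS : MeasurableSet S) (hΛS : Λ S ≠ ∞) {γ φ : Config X → ℝ}
    (hγ : Measurable γ) (hφ : Measurable φ) {C : ℝ} (hγC : ∀ μ, |γ μ| ≤ C)
    (hφC : ∀ μ, |φ μ| ≤ C) :
    ∫ p, γ (η p.1) * φ (resample η κ ξ Y S 1 p) ∂(P.prod P)
        - (∫ ω, γ (η ω) ∂P) * ∫ ω, φ (η ω) ∂P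
      = ∫ q, diffOp γ q.1.2 (η q.2.1) * diffOp φ q.1.2 (resample η κ ξ Y S q.1.1 q.2)
          ∂(((volume.restrict (Set.Icc (0 : ℝ) 1)).prod (Λ.restrict S)).prod (P.prod P)) := by
  have : IsFiniteMeasure (Λ.restrict S) := isFiniteMeasure_restrict.2 hΛS
  set τ := ((volume.restrict (Set.Icc (0 : ℝ) 1)).prod (Λ.restrict S)).prod (P.prod P) with hτ
  have hηm := h.poisson.measurable
  have hpr : IsProbabilityMeasure (P.map η) := Measure.isProbabilityMeasure_map hηm.aemeasurable
  have hA0 : Measurable fun q : (ℝ × X) × (Ω × Ω) => η q.2.1 :=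
    hηm.comp (measurable_fst.comp measurable_snd)
  have hB0 : Measurable fun q : (ℝ × X) × (Ω × Ω) => resample η κ ξ Y S q.1.1 q.2 :=
    h.measurable_resample hS measurable_fst.fst measurable_snd
  have hpt : Measurable fun q : (ℝ × X) × (Ω × Ω) => point q.1.2 :=
    Config.measurable_point.comp measurable_fst.snd
  have hA1 := Config.measurable_add hA0 hpt
  have hB1 := Config.measurable_add hB0 hpt
  have hend : ∀ t, Measurable fun p : Ω × Ω => (η p.1, resample η κ ξ Y S t p) :=
    fun t => (hηm.comp measurable_fst).prodMk (h.measurable_resample_right hS t)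
  -- The law at `t = 1` minus the law at `t = 0` is the `t`-integral of a signed combination of
  -- shifted laws. With negative terms moved across, both sides are finite measures and can be
  -- compared by Laplace functionals.
  have hmeas : (P.prod P).map (fun p => (η p.1, resample η κ ξ Y S 1 p))
        + (τ.map (fun q => (η q.2.1 + point q.1.2, resample η κ ξ Y S q.1.1 q.2))
          + τ.map (fun q => (η q.2.1, resample η κ ξ Y S q.1.1 q.2 + point q.1.2)))
      = (P.map η).prod (P.map η)
        + (τ.map (fun q => (η q.2.1 + point q.1.2, resample η κ ξ Y S q.1.1 q.2 + point q.1.2))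
          + τ.map (fun q => (η q.2.1, resample η κ ξ Y S q.1.1 q.2))) := by
    refine ext_of_laplace_prod fun u v hu hv => ?_
    let G : Config X × Config X → ℝ := fun m =>
      expNeg (∫⁻ x, u x ∂m.1.toMeasure + ∫⁻ x, v x ∂m.2.toMeasure)
    have hGe : Measurable fun m : Config X × Config X =>
        ∫⁻ x, u x ∂m.1.toMeasure + ∫⁻ x, v x ∂m.2.toMeasure :=
      ((measurable_lintegral hu).comp measurable_fst).add
        ((measurable_lintegral hv).comp measurable_snd)
    have hG : Measurable G := measurable_expNeg_comp hGe
    have hGi : ∀ (m : Measure (Config X × Config X)) [IsFiniteMeasure m], Integrable G m :=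
      fun m _ => integrable_expNeg hGe.aemeasurable
    change ∫ m, G m ∂_ = ∫ m, G m ∂_
    rw [integral_add_measure (hGi _) (hGi _), integral_add_measure (hGi _) (hGi _),
      integral_add_measure (hGi _) (hGi _), integral_add_measure (hGi _) (hGi _),
      ← h.map_resample_zero hS,
      integral_map (hend 1).aemeasurable hG.aestronglyMeasurable,
      integral_map (hA1.prodMk hB0).aemeasurable hG.aestronglyMeasurable,
      integral_map (hA0.prodMk hB1).aemeasurable hG.aestronglyMeasurable,
      integral_map (hA1.prodMk hB1).aemeasurable hG.aestronglyMeasurable,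
      integral_map (hA0.prodMk hB0).aemeasurable hG.aestronglyMeasurable,
      integral_map (hend 0).aemeasurable hG.aestronglyMeasurable]
    have hint : ∀ {a : (ℝ × X) × (Ω × Ω) → Config X × Config X}, Measurable a →
        Integrable (fun q => G (a q)) τ :=
      fun ha => integrable_expNeg (hGe.comp ha).aemeasurable
    have hG11 : ∀ q : (ℝ × X) × (Ω × Ω),
        G (η q.2.1 + point q.1.2, resample η κ ξ Y S q.1.1 q.2 + point q.1.2)
          = expNeg (u q.1.2) * expNeg (v q.1.2) * G (η q.2.1, resample η κ ξ Y S q.1.1 q.2) := by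
      intro q
      simp only [G, toMeasure_add, lintegral_add_measure, lintegral_point hu, lintegral_point hv,
        expNeg_add]
      ring
    have hG10 : ∀ q : (ℝ × X) × (Ω × Ω),
        G (η q.2.1 + point q.1.2, resample η κ ξ Y S q.1.1 q.2)
          = expNeg (u q.1.2) * G (η q.2.1, resample η κ ξ Y S q.1.1 q.2) := by
      intro q
      simp only [G, toMeasure_add, lintegral_add_measure, lintegral_point hu, expNeg_add]
      ring
    have hG01 : ∀ q : (ℝ × X) × (Ω × Ω),
        G (η q.2.1, resample η κ ξ Y S q.1.1 q.2 + point q.1.2)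
          = expNeg (v q.1.2) * G (η q.2.1, resample η κ ξ Y S q.1.1 q.2) := by
      intro q
      simp only [G, toMeasure_add, lintegral_add_measure, lintegral_point hv, expNeg_add]
      ring
    have hZ : ∀ t ∈ Set.Icc (0 : ℝ) 1, ∫ p, G (η p.1, resample η κ ξ Y S t p) ∂(P.prod P)
        = expNeg (laplaceExp Λ u) * expNeg (laplaceExp Λ v)
        * Real.exp (t * ∫ x in S, (1 - expNeg (u x)) * (1 - expNeg (v x)) ∂Λ) :=
      fun t ht => h.integral_expNeg_resample hS hΛS ht hu hv
    set K := expNeg (laplaceExp Λ u) * expNeg (laplaceExp Λ v)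
    set c := ∫ x in S, (1 - expNeg (u x)) * (1 - expNeg (v x)) ∂Λ with hc
    -- The factor `(1 - e^{-u(x)})(1 - e^{-v(x)})` is the effect of both difference operators on
    -- `G`. Integrating it over `S` gives `c`, and `∫₀¹ c e^{tc} dt = e^c - 1`.
    have hdiff : ∫ q, (1 - expNeg (u q.1.2)) * (1 - expNeg (v q.1.2))
          * G (η q.2.1, resample η κ ξ Y S q.1.1 q.2) ∂τ = K * (Real.exp c - 1) := by
      rw [hτ, integral_prod]
      · have hstep : ∫ z : ℝ × X, ∫ p, (1 - expNeg (u z.2)) * (1 - expNeg (v z.2))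
              * G (η p.1, resample η κ ξ Y S z.1 p) ∂(P.prod P)
              ∂((volume.restrict (Set.Icc (0 : ℝ) 1)).prod (Λ.restrict S))
            = ∫ z : ℝ × X, (K * Real.exp (z.1 * c)) * ((1 - expNeg (u z.2)) * (1 - expNeg (v z.2)))
              ∂((volume.restrict (Set.Icc (0 : ℝ) 1)).prod (Λ.restrict S)) := by
          rw [Measure.prod_restrict]
          refine setIntegral_congr_fun (measurableSet_Icc.prod hS) fun z hz => ?_
          rw [integral_const_mul, hZ z.1 hz.1]
          ring
        rw [hstep, integral_prod_mul (fun t : ℝ => K * Real.exp (t * c))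
          (fun x => (1 - expNeg (u x)) * (1 - expNeg (v x))), ← hc, ← integral_mul_exp_Icc c,
          ← integral_mul_const, ← integral_const_mul]
        congr 1
        ext t
        ring
      · have h1 := hint (hA0.prodMk hB0)
        refine (h1.bdd_mul (c := 1) (f := fun q : (ℝ × X) × (Ω × Ω) =>
          (1 - expNeg (u q.1.2)) * (1 - expNeg (v q.1.2))) ?_ (ae_of_all _ fun q => ?_))
        · have hx : Measurable fun q : (ℝ × X) × (Ω × Ω) => q.1.2 :=
            measurable_snd.comp measurable_fst
          exact (((measurable_expNeg_comp (hu.comp hx)).const_sub 1).mul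
            ((measurable_expNeg_comp (hv.comp hx)).const_sub 1)).aestronglyMeasurable
        · have u0 := expNeg_nonneg (u q.1.2)
          have u1 := expNeg_le_one (u q.1.2)
          have v0 := expNeg_nonneg (v q.1.2)
          have v1 := expNeg_le_one (v q.1.2)
          rw [Real.norm_eq_abs, abs_of_nonneg (mul_nonneg (by linarith) (by linarith))]
          exact mul_le_one₀ (by linarith) (by linarith) (by linarith)
    have hexp : ∫ q, (1 - expNeg (u q.1.2)) * (1 - expNeg (v q.1.2))
          * G (η q.2.1, resample η κ ξ Y S q.1.1 q.2) ∂τ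
        = ∫ q, G (η q.2.1 + point q.1.2, resample η κ ξ Y S q.1.1 q.2 + point q.1.2) ∂τ
          + ∫ q, G (η q.2.1, resample η κ ξ Y S q.1.1 q.2) ∂τ
          - (∫ q, G (η q.2.1 + point q.1.2, resample η κ ξ Y S q.1.1 q.2) ∂τ
            + ∫ q, G (η q.2.1, resample η κ ξ Y S q.1.1 q.2 + point q.1.2) ∂τ) := by
      have i11 := hint (hA1.prodMk hB1)
      have i00 := hint (hA0.prodMk hB0)
      have i10 := hint (hA1.prodMk hB0)
      have i01 := hint (hA0.prodMk hB1)
      rw [← integral_add_sub_add i11 i00 i10 i01]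
      refine integral_congr_ae (ae_of_all _ fun q => ?_)
      simp only [hG11, hG10, hG01]
      ring
    have h1 := hZ 1 (Set.right_mem_Icc.2 zero_le_one)
    have h0 := hZ 0 (Set.left_mem_Icc.2 zero_le_one)
    rw [one_mul] at h1
    rw [zero_mul, Real.exp_zero] at h0
    rw [h1, h0]
    linarith
  let G : Config X × Config X → ℝ := fun m => γ m.1 * φ m.2
  have hG : Measurable G := (hγ.comp measurable_fst).mul (hφ.comp measurable_snd)
  have hGb : ∀ m, ‖G m‖ ≤ C * C := fun m => by
    rw [Real.norm_eq_abs, abs_mul]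
    exact mul_le_mul (hγC _) (hφC _) (abs_nonneg _) ((abs_nonneg _).trans (hγC m.1))
  have hGi : ∀ (m : Measure (Config X × Config X)) [IsFiniteMeasure m], Integrable G m :=
    fun m _ => Integrable.of_bound hG.aestronglyMeasurable _ (ae_of_all _ hGb)
  have hint : ∀ {a : (ℝ × X) × (Ω × Ω) → Config X × Config X}, Measurable a →
      Integrable (fun q => G (a q)) τ :=
    fun ha => Integrable.of_bound (hG.comp ha).aestronglyMeasurable _
      (ae_of_all _ fun q => hGb _)
  -- The equality of measures is tested against `γ ⊗ φ`, and the four shifted terms recombine into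
  -- the product of differences.
  have hkey : ∫ x, G x ∂_ = ∫ x, G x ∂_ := congrArg (fun m => ∫ x, G x ∂m) hmeas
  rw [integral_add_measure (hGi _) (hGi _), integral_add_measure (hGi _) (hGi _),
      integral_add_measure (hGi _) (hGi _), integral_add_measure (hGi _) (hGi _),
      integral_map (hend 1).aemeasurable hG.aestronglyMeasurable,
      integral_map (hA1.prodMk hB0).aemeasurable hG.aestronglyMeasurable,
      integral_map (hA0.prodMk hB1).aemeasurable hG.aestronglyMeasurable,
      integral_map (hA1.prodMk hB1).aemeasurable hG.aestronglyMeasurable,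
      integral_map (hA0.prodMk hB0).aemeasurable hG.aestronglyMeasurable,
      integral_prod_mul γ φ, integral_map hηm.aemeasurable hγ.aestronglyMeasurable,
      integral_map hηm.aemeasurable hφ.aestronglyMeasurable] at hkey
  have i11 := hint (hA1.prodMk hB1)
  have i00 := hint (hA0.prodMk hB0)
  have i10 := hint (hA1.prodMk hB0)
  have i01 := hint (hA0.prodMk hB1)
  have hexp : ∫ q, diffOp γ q.1.2 (η q.2.1) * diffOp φ q.1.2 (resample η κ ξ Y S q.1.1 q.2) ∂τ
      = ∫ q, G (η q.2.1 + point q.1.2, resample η κ ξ Y S q.1.1 q.2 + point q.1.2) ∂τ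
        + ∫ q, G (η q.2.1, resample η κ ξ Y S q.1.1 q.2) ∂τ
        - (∫ q, G (η q.2.1 + point q.1.2, resample η κ ξ Y S q.1.1 q.2) ∂τ
          + ∫ q, G (η q.2.1, resample η κ ξ Y S q.1.1 q.2 + point q.1.2) ∂τ) := by
    rw [← integral_add_sub_add i11 i00 i10 i01]
    refine integral_congr_ae (ae_of_all _ fun q => ?_)
    simp only [G, diffOp]
    ring
  rw [hexp]
  simp only [G] at hkey ⊢
  linarith

end IsMarkedPoisson

/-! ### Exhaustion by sets of finite intensity -/

/-- The filtration generated by the restrictions of a configuration to an increasing sequence of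
sets. -/
def restrFiltration (S : ℕ → Set X) (hS : ∀ j, MeasurableSet (S j)) (hmono : Monotone S) :
    Filtration ℕ (inferInstance : MeasurableSpace (Config X)) where
  seq j := MeasurableSpace.comap (restr (S j)) inferInstance
  mono' := by
    intro i j hij
    have : restr (S i) = restr (S i) ∘ restr (S j) := by
      ext1 μ
      rw [Function.comp_apply, restr_restr (hS i) (hS j), Set.inter_eq_left.2 (hmono hij)]
    simp only
    rw [this, ← MeasurableSpace.comap_comp]
    exact MeasurableSpace.comap_mono (measurable_restr (hS i)).comap_le
  le' j := (measurable_restr (hS j)).comap_le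

/-- The mass of `B` is the supremum of the masses of `B ∩ S j`, so the restrictions determine the
configuration measurably. -/
lemma le_iSup_restrFiltration {S : ℕ → Set X} (hS : ∀ j, MeasurableSet (S j))
    (hmono : Monotone S) (hcover : ⋃ j, S j = Set.univ) :
    (inferInstance : MeasurableSpace (Config X)) ≤ ⨆ j, restrFiltration S hS hmono j := by
  set m := ⨆ j, restrFiltration S hS hmono j with hm
  have hid : @Measurable _ _ m instMeasurableSpace (fun μ : Config X => μ) := by
    refine @measurable_of_apply X _ (Config X) m _ fun B hB => ?_
    have : (fun μ : Config X => μ.toMeasure B)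
        = fun μ : Config X => ⨆ j, (restr (S j) μ).toMeasure B := by
      ext μ
      simp_rw [toMeasure_restr (hS _), Measure.restrict_apply hB]
      rw [← (show Monotone fun j => B ∩ S j from fun i j hij =>
        Set.inter_subset_inter_right _ (hmono hij)).measure_iUnion, ← Set.inter_iUnion, hcover,
        Set.inter_univ]
    rw [this]
    refine Measurable.iSup fun j => ?_
    have hj : @Measurable _ _ m instMeasurableSpace (restr (S j)) :=
      Measurable.mono (comap_measurable _) (le_iSup (fun j => restrFiltration S hS hmono j) j)
        le_rfl
    exact (measurable_apply hB).comp hj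
  exact fun s hs => hid hs

/-- Functions of the restriction of a configuration to a set of a given exhausting sequence are
dense in `L¹`. -/
theorem exists_restr_approx (Q : Measure (Config X)) [IsFiniteMeasure Q] {S : ℕ → Set X}
    (hS : ∀ j, MeasurableSet (S j)) (hmono : Monotone S) (hcover : ⋃ j, S j = Set.univ)
    {φ : Config X → ℝ} (hφ : Measurable φ) (hi : Integrable φ Q) {ε : ℝ} (hε : 0 < ε) :
    ∃ (j : ℕ) (ψ : Config X → ℝ), Measurable ψ ∧ Integrable ψ Q ∧ ∫ μ, |φ μ - ψ μ| ∂Q < ε ∧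
      ∀ μ, ψ (restr (S j) μ) = ψ μ := by
  -- Lévy's upward theorem: the conditional expectations given the restrictions to `S j` converge to
  -- `φ` in `L¹`.
  have hlim := hi.tendsto_eLpNorm_condExp (ℱ := restrFiltration S hS hmono)
    (hφ.mono (le_iSup_restrFiltration hS hmono hcover) le_rfl).stronglyMeasurable
  obtain ⟨j, hj⟩ := (hlim.eventually (gt_mem_nhds (ENNReal.ofReal_pos.2 hε))).exists
  obtain ⟨g, hg, hgeq⟩ := StronglyMeasurable.exists_eq_measurable_comp (f := restr (S j))
    (stronglyMeasurable_condExp (m := restrFiltration S hS hmono j) (μ := Q) (f := φ))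
  have hint : Integrable (g ∘ restr (S j)) Q := by
    rw [← hgeq]
    exact integrable_condExp
  refine ⟨j, g ∘ restr (S j), hg.measurable.comp (measurable_restr (hS j)), hint, ?_,
    fun μ => ?_⟩
  · rw [hgeq, eLpNorm_one_eq_lintegral_enorm] at hj
    have h1 : ∫ μ, |φ μ - (g ∘ restr (S j)) μ| ∂Q = ∫ μ, ‖(g ∘ restr (S j) - φ) μ‖ ∂Q := by
      refine integral_congr_ae (ae_of_all _ fun μ => ?_)
      simp only [Pi.sub_apply, Real.norm_eq_abs]
      rw [abs_sub_comm]
    rw [h1, integral_norm_eq_lintegral_enorm (hint.sub hi).aestronglyMeasurable]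
    exact ENNReal.toReal_lt_of_lt_ofReal hj
  · simp [restr_restr (hS j) (hS j)]

/-- Resampling on `T` and on the whole space differ only outside `T`, which `S` does not see. -/
lemma restr_resample_of_subset {Ω : Type*} (η : Ω → Config X) (κ : Ω → ℕ∞) (ξ : ℕ → Ω → X)
    (Y : ℝ → ℕ → Ω → Bool) {S T : Set X} (hS : MeasurableSet S) (hT : MeasurableSet T)
    (hST : S ⊆ T) (t : ℝ) (p : Ω × Ω) :
    restr S (resample η κ ξ Y T t p) = restr S (resample η κ ξ Y Set.univ t p) := by
  have h1 : S ∩ Tᶜ = ∅ := Set.disjoint_iff_inter_eq_empty.1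
    (Set.disjoint_compl_right_iff_subset.2 hST)
  simp only [resample, restr_add hS, restr_restr hS hT, restr_restr hS hT.compl, restr_univ,
    Set.inter_eq_left.2 hST, h1, restr_empty, Set.compl_univ]
  congr 2
  apply toMeasure_injective
  simp [toMeasure_restr hS]

/-- The positive part of an integral is at most the integral of the positive part. -/
lemma ofReal_integral_le_lintegral_ofReal {E : Type*} [MeasurableSpace E] {μ : Measure E}
    (f : E → ℝ) : ENNReal.ofReal (∫ x, f x ∂μ) ≤ ∫⁻ x, ENNReal.ofReal (f x) ∂μ := by
  by_cases hf : Integrable f μ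
  · rw [integral_eq_lintegral_pos_part_sub_lintegral_neg_part hf]
    refine (ENNReal.ofReal_le_ofReal (sub_le_self _ ENNReal.toReal_nonneg)).trans ?_
    exact ENNReal.ofReal_toReal_le
  · simp [integral_undef hf]

namespace IsMarkedPoisson

variable {P : Measure Ω} {Λ : Measure X} {η : Ω → Config X} {κ : Ω → ℕ∞}
    {ξ : ℕ → Ω → X} {Y : ℝ → ℕ → Ω → Bool}

lemma integral_resample [IsProbabilityMeasure P] (h : IsMarkedPoisson P Λ η κ ξ Y) {S : Set X}
    (hS : MeasurableSet S) {t : ℝ} (ht : t ∈ Set.Icc (0 : ℝ) 1) {φ : Config X → ℝ}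
    (hφ : Measurable φ) :
    ∫ p, φ (resample η κ ξ Y S t p) ∂(P.prod P) = ∫ μ, φ μ ∂(P.map η) := by
  rw [← h.map_resample hS ht, integral_map (h.measurable_resample_right hS t).aemeasurable
    hφ.aestronglyMeasurable]

lemma integrable_resample [IsProbabilityMeasure P] (h : IsMarkedPoisson P Λ η κ ξ Y) {S : Set X}
    (hS : MeasurableSet S) {t : ℝ} (ht : t ∈ Set.Icc (0 : ℝ) 1) {φ : Config X → ℝ}
    (hφ : Integrable φ (P.map η)) :
    Integrable (fun p => φ (resample η κ ξ Y S t p)) (P.prod P) := by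
  rw [← h.map_resample hS ht] at hφ
  exact hφ.comp_measurable (h.measurable_resample_right hS t)

/-- Resampling on all of an exhausting sequence of sets converges to resampling everywhere. -/
theorem tendsto_integral_resample [IsProbabilityMeasure P] (h : IsMarkedPoisson P Λ η κ ξ Y)
    {S : ℕ → Set X} (hS : ∀ j, MeasurableSet (S j)) (hmono : Monotone S)
    (hcover : ⋃ j, S j = Set.univ) {t : ℝ} (ht : t ∈ Set.Icc (0 : ℝ) 1) {γ φ : Config X → ℝ}
    (hγ : Measurable γ) (hφ : Measurable φ) {C : ℝ} (hγC : ∀ μ, |γ μ| ≤ C)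
    (hφC : ∀ μ, |φ μ| ≤ C) :
    Tendsto (fun j => ∫ p, γ (η p.1) * φ (resample η κ ξ Y (S j) t p) ∂(P.prod P)) atTop
      (𝓝 (∫ p, γ (η p.1) * φ (resample η κ ξ Y Set.univ t p) ∂(P.prod P))) := by
  have hηm := h.poisson.measurable
  have hpr : IsProbabilityMeasure (P.map η) := Measure.isProbabilityMeasure_map hηm.aemeasurable
  have hφi : Integrable φ (P.map η) :=
    Integrable.of_bound hφ.aestronglyMeasurable C (ae_of_all _ hφC)
  have hC0 : 0 ≤ C := (abs_nonneg _).trans (hγC 0)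
  rw [Metric.tendsto_atTop]
  intro ε hε
  -- For `j ≥ i` the approximant `ψ` does not distinguish the two resamplings. Both have the law of
  -- `η`, so the total error is at most `2C` times the `L¹` distance; the summand `1` in the
  -- denominator covers `C = 0`.
  obtain ⟨i, ψ, hψ, hψi, hψε, hψr⟩ := exists_restr_approx (P.map η) hS hmono hcover hφ hφi
    (show 0 < ε / (2 * C + 1) by positivity)
  refine ⟨i, fun j hij => ?_⟩
  have hψeq : ∀ p, ψ (resample η κ ξ Y (S j) t p) = ψ (resample η κ ξ Y Set.univ t p) := by
    intro p
    rw [← hψr, restr_resample_of_subset η κ ξ Y (hS i) (hS j) (hmono hij), hψr]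
  have hγm : Measurable fun p : Ω × Ω => γ (η p.1) := hγ.comp (hηm.comp measurable_fst)
  have hb : ∀ {T : Set X}, MeasurableSet T →
      Integrable (fun p => γ (η p.1) * φ (resample η κ ξ Y T t p)) (P.prod P) := fun hT =>
    (h.integrable_resample hT ht hφi).bdd_mul hγm.aestronglyMeasurable
      (ae_of_all _ fun p => hγC _)
  have hdi : Integrable (fun μ => |φ μ - ψ μ|) (P.map η) := (hφi.sub hψi).abs
  have hdm : Measurable fun μ => |φ μ - ψ μ| := (hφ.sub hψ).abs
  rw [Real.dist_eq, ← integral_sub (hb (hS j)) (hb MeasurableSet.univ)]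
  calc |∫ p, (γ (η p.1) * φ (resample η κ ξ Y (S j) t p)
          - γ (η p.1) * φ (resample η κ ξ Y Set.univ t p)) ∂(P.prod P)|
      ≤ ∫ p, |γ (η p.1) * φ (resample η κ ξ Y (S j) t p)
          - γ (η p.1) * φ (resample η κ ξ Y Set.univ t p)| ∂(P.prod P) :=
        abs_integral_le_integral_abs
    _ ≤ ∫ p, (C * |φ (resample η κ ξ Y (S j) t p) - ψ (resample η κ ξ Y (S j) t p)|
          + C * |φ (resample η κ ξ Y Set.univ t p) - ψ (resample η κ ξ Y Set.univ t p)|)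
          ∂(P.prod P) := by
        refine integral_mono ((hb (hS j)).sub (hb MeasurableSet.univ)).abs
          (((h.integrable_resample (hS j) ht hdi).const_mul C).add
            ((h.integrable_resample MeasurableSet.univ ht hdi).const_mul C)) fun p => ?_
        beta_reduce
        rw [← mul_sub, abs_mul, hψeq p, ← mul_add]
        refine mul_le_mul (hγC _) ?_ (abs_nonneg _) hC0
        rw [abs_sub_comm (φ (resample η κ ξ Y Set.univ t p))]
        exact abs_sub_le _ _ _
    _ = 2 * C * ∫ μ, |φ μ - ψ μ| ∂(P.map η) := by
        rw [integral_add ((h.integrable_resample (hS j) ht hdi).const_mul C)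
            ((h.integrable_resample MeasurableSet.univ ht hdi).const_mul C),
          integral_const_mul, integral_const_mul, h.integral_resample (hS j) ht hdm,
          h.integral_resample MeasurableSet.univ ht hdm]
        ring
    _ ≤ 2 * C * (ε / (2 * C + 1)) := mul_le_mul_of_nonneg_left hψε.le (by positivity)
    _ < ε := by
        rw [← mul_div_assoc, div_lt_iff₀ (by positivity)]
        nlinarith

end IsMarkedPoisson

lemma abs_diffOp_le {f : Config X → ℝ} {C : ℝ} (hf : ∀ μ, |f μ| ≤ C) (x : X) (μ : Config X) :
    |diffOp f x μ| ≤ 2 * C := by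
  have h1 := abs_sub (f (μ + point x)) (f μ)
  have h2 := hf (μ + point x)
  have h3 := hf μ
  rw [diffOp]
  linarith

namespace IsMarkedPoisson

variable {P : Measure Ω} {Λ : Measure X} {η : Ω → Config X} {κ : Ω → ℕ∞}
    {ξ : ℕ → Ω → X} {Y : ℝ → ℕ → Ω → Bool}

lemma measurable_diffOp_mul [IsProbabilityMeasure P] (h : IsMarkedPoisson P Λ η κ ξ Y)
    {S : Set X} (hS : MeasurableSet S) {γ φ : Config X → ℝ} (hγ : Measurable γ)
    (hφ : Measurable φ) :
    Measurable fun q : (ℝ × X) × (Ω × Ω) => diffOp γ q.1.2 (η q.2.1)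
      * diffOp φ q.1.2 (resample η κ ξ Y S q.1.1 q.2) := by
  have hx : Measurable fun q : (ℝ × X) × (Ω × Ω) => q.1.2 := measurable_fst.snd
  have h1 : Measurable fun q : (ℝ × X) × (Ω × Ω) => η q.2.1 :=
    h.poisson.measurable.comp measurable_snd.fst
  have h2 : Measurable fun q : (ℝ × X) × (Ω × Ω) => resample η κ ξ Y S q.1.1 q.2 :=
    h.measurable_resample hS measurable_fst.fst measurable_snd
  exact ((measurable_diffOp hγ).comp (hx.prodMk h1)).mul
    ((measurable_diffOp hφ).comp (hx.prodMk h2))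

/-- The resampled process has the law of `η`, so the bound depends on neither `S` nor `t`. It serves
as the dominating function when `S` exhausts the space. -/
lemma abs_integral_diffOp_mul_le [IsProbabilityMeasure P] (h : IsMarkedPoisson P Λ η κ ξ Y)
    {S : Set X} (hS : MeasurableSet S) {γ φ : Config X → ℝ} (hγ : Measurable γ)
    (hφ : Measurable φ) {C : ℝ} (hγC : ∀ μ, |γ μ| ≤ C) (hφC : ∀ μ, |φ μ| ≤ C) {t : ℝ}
    (ht : t ∈ Set.Icc (0 : ℝ) 1) (x : X) :
    |∫ p, diffOp γ x (η p.1) * diffOp φ x (resample η κ ξ Y S t p) ∂(P.prod P)|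
      ≤ (∫ ω, diffOp γ x (η ω) ^ 2 ∂P) + ∫ ω, diffOp φ x (η ω) ^ 2 ∂P := by
  have hηm := h.poisson.measurable
  have hD : ∀ {f : Config X → ℝ}, Measurable f → Measurable fun μ => diffOp f x μ ^ 2 :=
    fun hf => ((measurable_diffOp hf).comp measurable_prodMk_left).pow_const 2
  have hpr : IsProbabilityMeasure (P.map η) := Measure.isProbabilityMeasure_map hηm.aemeasurable
  have hDi : ∀ {f : Config X → ℝ}, Measurable f → (∀ μ, |f μ| ≤ C) →
      Integrable (fun μ => diffOp f x μ ^ 2) (P.map η) := by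
    intro f hf hfC
    refine Integrable.of_bound (hD hf).aestronglyMeasurable ((2 * C) ^ 2)
      (ae_of_all _ fun μ => ?_)
    rw [Real.norm_eq_abs, abs_pow]
    exact pow_le_pow_left₀ (abs_nonneg _) (abs_diffOp_le hfC x μ) 2
  have hγi : Integrable (fun ω => diffOp γ x (η ω) ^ 2) P :=
    (hDi hγ hγC).comp_measurable hηm
  have hφi := h.integrable_resample hS ht (hDi hφ hφC)
  calc |∫ p, diffOp γ x (η p.1) * diffOp φ x (resample η κ ξ Y S t p) ∂(P.prod P)|
      ≤ ∫ p, |diffOp γ x (η p.1) * diffOp φ x (resample η κ ξ Y S t p)| ∂(P.prod P) :=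
        abs_integral_le_integral_abs
    _ ≤ ∫ p, (diffOp γ x (η p.1) ^ 2 + diffOp φ x (resample η κ ξ Y S t p) ^ 2)
          ∂(P.prod P) := by
        refine integral_mono_of_nonneg (ae_of_all _ fun p => abs_nonneg _)
          ((hγi.comp_fst P).add hφi) (ae_of_all _ fun p => ?_)
        beta_reduce
        rw [abs_mul]
        nlinarith [sq_abs (diffOp γ x (η p.1)), sq_abs (diffOp φ x (resample η κ ξ Y S t p)),
          sq_nonneg (|diffOp γ x (η p.1)| - |diffOp φ x (resample η κ ξ Y S t p)|),
          sq_nonneg (|diffOp γ x (η p.1)| + |diffOp φ x (resample η κ ξ Y S t p)|)]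
    _ = _ := by
        rw [integral_add (hγi.comp_fst P) hφi,
          integral_fun_fst (μ := P) (ν := P) (fun ω => diffOp γ x (η ω) ^ 2),
          h.integral_resample hS ht (hD hφ), integral_map hηm.aemeasurable
            (hD hφ).aestronglyMeasurable]
        simp

/-- The covariance inequality obtained from resampling. -/
theorem ofReal_covariance_le [IsProbabilityMeasure P] [SigmaFinite Λ]
    (h : IsMarkedPoisson P Λ η κ ξ Y) {γ φ : Config X → ℝ} (hγ : Measurable γ)
    (hφ : Measurable φ) {C : ℝ} (hγC : ∀ μ, |γ μ| ≤ C) (hφC : ∀ μ, |φ μ| ≤ C)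
    (hγ2 : Integrable (fun q : X × Ω => diffOp γ q.1 (η q.2) ^ 2) (Λ.prod P))
    (hφ2 : Integrable (fun q : X × Ω => diffOp φ q.1 (η q.2) ^ 2) (Λ.prod P))
    (hγ0 : ∀ᵐ x ∂Λ, ∀ᵐ ω ∂P, 0 ≤ diffOp γ x (η ω)) :
    ENNReal.ofReal (∫ ω, γ (η ω) * φ (η ω) ∂P - (∫ ω, γ (η ω) ∂P) * ∫ ω, φ (η ω) ∂P)
      ≤ ∫⁻ t in Set.Icc (0 : ℝ) 1, ∫⁻ x, ∫⁻ p, ENNReal.ofReal (diffOp γ x (η p.1))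
          * ENNReal.ofReal (diffOp φ x (resample η κ ξ Y Set.univ t p)) ∂(P.prod P) ∂Λ := by
  have hηm := h.poisson.measurable
  set S := spanningSets Λ with hSdef
  have hS : ∀ j, MeasurableSet (S j) := measurableSet_spanningSets Λ
  have hmono : Monotone S := monotone_spanningSets Λ
  have hcover : ⋃ j, S j = Set.univ := iUnion_spanningSets Λ
  set ν := (volume.restrict (Set.Icc (0 : ℝ) 1)).prod Λ with hν
  have hνIcc : ∀ᵐ z ∂ν, z.1 ∈ Set.Icc (0 : ℝ) 1 :=
    Measure.quasiMeasurePreserving_fst.ae (ae_restrict_mem measurableSet_Icc)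
  let I : Set X → ℝ × X → ℝ := fun T z =>
    ∫ p, diffOp γ z.2 (η p.1) * diffOp φ z.2 (resample η κ ξ Y T z.1 p) ∂(P.prod P)
  have hIm : ∀ {T : Set X}, MeasurableSet T → StronglyMeasurable (I T) := fun hT =>
    (h.measurable_diffOp_mul hT hγ hφ).stronglyMeasurable.integral_prod_right
  have hcov : ∀ j, ∫ p, γ (η p.1) * φ (resample η κ ξ Y (S j) 1 p) ∂(P.prod P)
        - (∫ ω, γ (η ω) ∂P) * ∫ ω, φ (η ω) ∂P
      = ∫ z, (Set.univ ×ˢ S j).indicator (I (S j)) z ∂ν := by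
    intro j
    have hfin : Λ (S j) ≠ ∞ := (measure_spanningSets_lt_top Λ j).ne
    have : IsFiniteMeasure (Λ.restrict (S j)) := isFiniteMeasure_restrict.2 hfin
    rw [h.covariance_resample (hS j) hfin hγ hφ hγC hφC, integral_prod,
      integral_indicator (MeasurableSet.univ.prod (hS j)), hν, ← Measure.prod_restrict,
      Measure.restrict_univ]
    refine Integrable.of_bound (h.measurable_diffOp_mul (hS j) hγ hφ).aestronglyMeasurable
      ((2 * C) * (2 * C)) (ae_of_all _ fun q => ?_)
    rw [Real.norm_eq_abs, abs_mul]
    exact mul_le_mul (abs_diffOp_le hγC _ _) (abs_diffOp_le hφC _ _) (abs_nonneg _)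
      ((abs_nonneg _).trans (abs_diffOp_le hγC q.1.2 (η q.2.1)))
  -- For fixed `x` the differences `D_xγ` and `D_xφ` are bounded functionals, so the convergence of
  -- resamplings applies to them pointwise; the dominating function is integrable by `hγ2` and
  -- `hφ2`.
  have hlimR : Tendsto (fun j => ∫ z, (Set.univ ×ˢ S j).indicator (I (S j)) z ∂ν) atTop
      (𝓝 (∫ z, I Set.univ z ∂ν)) := by
    refine tendsto_integral_of_dominated_convergence (fun z => (∫ ω, diffOp γ z.2 (η ω) ^ 2 ∂P)
      + ∫ ω, diffOp φ z.2 (η ω) ^ 2 ∂P) (fun j => ?_) ?_ (fun j => ?_) ?_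
    · exact ((hIm (hS j)).indicator (MeasurableSet.univ.prod (hS j))).aestronglyMeasurable
    · exact (hγ2.integral_prod_left.add hφ2.integral_prod_left).comp_snd _
    · filter_upwards [hνIcc] with z hz
      refine (norm_indicator_le_norm_self _ _).trans ?_
      exact h.abs_integral_diffOp_mul_le (hS j) hγ hφ hγC hφC hz z.2
    · filter_upwards [hνIcc] with z hz
      have hx : z.2 ∈ ⋃ j, S j := hcover ▸ Set.mem_univ _
      obtain ⟨i, hi⟩ := Set.mem_iUnion.1 hx
      have hm : ∀ {f : Config X → ℝ}, Measurable f → Measurable fun μ => diffOp f z.2 μ :=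
        fun hf => (measurable_diffOp hf).comp measurable_prodMk_left
      refine (h.tendsto_integral_resample hS hmono hcover hz (hm hγ) (hm hφ)
        (abs_diffOp_le hγC z.2) (abs_diffOp_le hφC z.2)).congr' ?_
      filter_upwards [eventually_ge_atTop i] with j hj
      rw [Set.indicator_of_mem (Set.mk_mem_prod (Set.mem_univ _) (hmono hj hi))]
  have hlimL : Tendsto (fun j => ∫ p, γ (η p.1) * φ (resample η κ ξ Y (S j) 1 p) ∂(P.prod P)
        - (∫ ω, γ (η ω) ∂P) * ∫ ω, φ (η ω) ∂P) atTop
      (𝓝 (∫ ω, γ (η ω) * φ (η ω) ∂P - (∫ ω, γ (η ω) ∂P) * ∫ ω, φ (η ω) ∂P)) := by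
    refine Tendsto.sub_const ?_ _
    have h1 := h.tendsto_integral_resample hS hmono hcover (Set.right_mem_Icc.2 zero_le_one)
      hγ hφ hγC hφC
    have h2 : ∫ p, γ (η p.1) * φ (resample η κ ξ Y Set.univ 1 p) ∂(P.prod P)
        = ∫ ω, γ (η ω) * φ (η ω) ∂P := by
      rw [integral_congr_ae (g := fun p : Ω × Ω => γ (η p.1) * φ (η p.1)),
        integral_fun_fst (μ := P) (ν := P) (fun ω => γ (η ω) * φ (η ω))]
      · simp
      · filter_upwards [h.resample_univ_one] with p hp
        rw [hp]
    rwa [h2] at h1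
  have heq : ∫ ω, γ (η ω) * φ (η ω) ∂P - (∫ ω, γ (η ω) ∂P) * ∫ ω, φ (η ω) ∂P
      = ∫ z, I Set.univ z ∂ν := by
    refine tendsto_nhds_unique hlimL ?_
    simp_rw [hcov]
    exact hlimR
  rw [heq]
  -- Only an upper bound is wanted, so positive parts are taken inside the integrals. The sign of
  -- `D_xφ` at the resampled process is never used.
  refine (ofReal_integral_le_lintegral_ofReal _).trans ?_
  have hIo : Measurable fun z => ENNReal.ofReal (I Set.univ z) :=
    ENNReal.measurable_ofReal.comp (hIm MeasurableSet.univ).measurable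
  rw [hν, lintegral_prod _ hIo.aemeasurable]
  refine lintegral_mono fun t => lintegral_mono_ae ?_
  filter_upwards [hγ0] with x hx
  refine (ofReal_integral_le_lintegral_ofReal _).trans (lintegral_mono_ae ?_)
  filter_upwards [Measure.quasiMeasurePreserving_fst.ae hx] with p hp
  exact (ENNReal.ofReal_mul hp).le

end IsMarkedPoisson

/-! ### Truncation and the differential inequality -/

/-- Truncation to the interval `[l, u]`. -/
def clamp (l u z : ℝ) : ℝ := max l (min u z)

lemma clamp_mono (l u : ℝ) : Monotone (clamp l u) := fun _ _ h =>
  max_le_max le_rfl (min_le_min le_rfl h)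

lemma measurable_clamp (l u : ℝ) : Measurable (clamp l u) :=
  measurable_const.max (measurable_const.min measurable_id)

lemma abs_clamp_sub_le (l u z z' : ℝ) : |clamp l u z' - clamp l u z| ≤ |z' - z| := by
  refine (abs_max_sub_max_le_max l _ l _).trans ?_
  simp only [sub_self, abs_zero]
  refine max_le (abs_nonneg _) ((abs_min_sub_min_le_max u _ u _).trans ?_)
  simp

/-- Truncation is monotone and 1-Lipschitz. Positive parts of differences can only shrink, so bounds
for `f` and `e^{sf}` carry over to their truncations. -/
lemma ofReal_clamp_sub_le (l u z z' : ℝ) :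
    ENNReal.ofReal (clamp l u z' - clamp l u z) ≤ ENNReal.ofReal (z' - z) := by
  rcases le_total z z' with h | h
  · refine ENNReal.ofReal_le_ofReal ?_
    have := abs_clamp_sub_le l u z z'
    rw [abs_of_nonneg (sub_nonneg.2 h)] at this
    exact (le_abs_self _).trans this
  · rw [ENNReal.ofReal_of_nonpos (sub_nonpos.2 (clamp_mono l u h))]
    exact zero_le

lemma exp_mul_clamp {s : ℝ} (hs : 0 ≤ s) (l u z : ℝ) :
    Real.exp (s * clamp l u z)
      = clamp (Real.exp (s * l)) (Real.exp (s * u)) (Real.exp (s * z)) := by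
  have hm : Monotone fun y => Real.exp (s * y) := fun _ _ h =>
    Real.exp_le_exp.2 (mul_le_mul_of_nonneg_left h hs)
  rw [clamp, clamp, hm.map_max, hm.map_min]

lemma abs_clamp_le {N : ℝ} (hN : 0 ≤ N) (z : ℝ) : |clamp (-N) N z| ≤ N :=
  abs_le.2 ⟨le_max_left _ _, max_le (by linarith) (min_le_left _ _)⟩

lemma abs_clamp_le_abs {N : ℝ} (hN : 0 ≤ N) (z : ℝ) : |clamp (-N) N z| ≤ |z| := by
  have h0 : clamp (-N) N 0 = 0 := by simp [clamp, hN]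
  simpa [h0] using abs_clamp_sub_le (-N) N 0 z

lemma tendsto_clamp (z : ℝ) : Tendsto (fun n : ℕ => clamp (-n) n z) atTop (𝓝 z) := by
  obtain ⟨m, hm⟩ := exists_nat_ge |z|
  refine tendsto_const_nhds.congr' ?_
  filter_upwards [eventually_ge_atTop m] with n hn
  have h1 : |z| ≤ n := hm.trans (by exact_mod_cast hn)
  rw [clamp, min_eq_right (le_trans (le_abs_self z) h1), max_eq_right]
  linarith [neg_abs_le z]

/-- This is the tangent inequality at `y`. In the application `y = s f(η + δ_x)`, so the exponential
is evaluated after the added point, as the Mecke equation requires. -/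
lemma exp_sub_exp_le (x y : ℝ) : Real.exp y - Real.exp x ≤ Real.exp y * (y - x) := by
  have h1 := Real.add_one_le_exp (x - y)
  have h2 : Real.exp x = Real.exp y * Real.exp (x - y) := by rw [← Real.exp_add]; ring_nf
  rw [h2]
  nlinarith [Real.exp_pos y]

lemma abs_exp_sub_exp_le {M x y : ℝ} (hx : x ≤ M) (hy : y ≤ M) :
    |Real.exp y - Real.exp x| ≤ Real.exp M * |y - x| := by
  have key : ∀ {x y : ℝ}, x ≤ y → y ≤ M → |Real.exp y - Real.exp x| ≤ Real.exp M * |y - x| := by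
    intro x y hxy hy
    rw [abs_of_nonneg (sub_nonneg.2 (Real.exp_le_exp.2 hxy)), abs_of_nonneg (sub_nonneg.2 hxy)]
    exact (exp_sub_exp_le x y).trans
      (mul_le_mul_of_nonneg_right (Real.exp_le_exp.2 hy) (sub_nonneg.2 hxy))
  rcases le_total x y with h | h
  · exact key h hy
  · rw [abs_sub_comm, abs_sub_comm y]
    exact key h hx

lemma exp_mul_le_one_add {s s' y : ℝ} (hs : 0 ≤ s) (hss' : s ≤ s') :
    Real.exp (s * y) ≤ 1 + Real.exp (s' * y) := by
  rcases le_total 0 y with h | h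
  · have := Real.exp_le_exp.2 (mul_le_mul_of_nonneg_right hss' h)
    linarith
  · have := Real.exp_le_one_iff.2 (mul_nonpos_of_nonneg_of_nonpos hs h)
    linarith [Real.exp_pos (s' * y)]

/-- An upper bound for a `[0, ∞]`-valued quantity also says that the bound is nonnegative; applied
to `aF + b`, this is the source of `F ≥ -b/a`. -/
lemma le_ofReal_of_coe_le {x : ℝ≥0∞} {c : ℝ} (h : (x : EReal) ≤ (c : EReal)) :
    0 ≤ c ∧ x ≤ ENNReal.ofReal c := by
  have hc : 0 ≤ c := by
    have : (0 : EReal) ≤ (c : EReal) := (EReal.coe_ennreal_nonneg x).trans h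
    exact_mod_cast this
  refine ⟨hc, ?_⟩
  rw [← EReal.coe_ennreal_le_coe_ennreal_iff, EReal.coe_ennreal_ofReal, max_eq_left hc]
  exact h

/-- An iterated integral rearranged so that the factor `A` comes out of the inner integrals. -/
lemma lintegral_mul_eq_lintegral_mul_lintegral {T : Type*} [MeasurableSpace T] {P : Measure Ω}
    {Λ : Measure X} [SFinite P] [SFinite Λ] (ν : Measure T) [SFinite ν] {A : X × Ω → ℝ≥0∞}
    (hA : Measurable A) {D : ((T × X) × Ω) × Ω → ℝ≥0∞} (hD : Measurable D) :
    ∫⁻ t, ∫⁻ x, ∫⁻ p, A (x, p.1) * D (((t, x), p.1), p.2) ∂(P.prod P) ∂Λ ∂ν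
      = ∫⁻ ω, ∫⁻ x, A (x, ω) * ∫⁻ t, ∫⁻ ω', D (((t, x), ω), ω') ∂P ∂ν ∂Λ ∂P := by
  let B : (T × X) × Ω → ℝ≥0∞ := fun q => ∫⁻ ω', D (q, ω') ∂P
  have hB : Measurable B := hD.lintegral_prod_right'
  have h1 : ∀ t x, ∫⁻ p, A (x, p.1) * D (((t, x), p.1), p.2) ∂(P.prod P)
      = ∫⁻ ω, A (x, ω) * B ((t, x), ω) ∂P := by
    intro t x
    have hm : Measurable fun p : Ω × Ω => A (x, p.1) * D (((t, x), p.1), p.2) :=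
      (hA.comp (measurable_const.prodMk measurable_fst)).mul
        (hD.comp ((measurable_const.prodMk measurable_fst).prodMk measurable_snd))
    rw [lintegral_prod _ hm.aemeasurable]
    refine lintegral_congr fun ω => ?_
    have hDω : Measurable fun ω' => D (((t, x), ω), ω') := hD.comp measurable_prodMk_left
    exact lintegral_const_mul (A (x, ω)) hDω
  have hF : Measurable fun q : (T × X) × Ω => A (q.1.2, q.2) * B q :=
    (hA.comp (measurable_fst.snd.prodMk measurable_snd)).mul hB
  have h2 : ∀ t, ∫⁻ x, ∫⁻ ω, A (x, ω) * B ((t, x), ω) ∂P ∂Λ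
      = ∫⁻ ω, ∫⁻ x, A (x, ω) * B ((t, x), ω) ∂Λ ∂P := by
    intro t
    refine lintegral_lintegral_swap ?_
    exact (hF.comp ((measurable_const.prodMk measurable_fst).prodMk
      measurable_snd)).aemeasurable
  simp_rw [h1, h2]
  rw [lintegral_lintegral_swap]
  · refine lintegral_congr fun ω => ?_
    rw [lintegral_lintegral_swap]
    · refine lintegral_congr fun x => ?_
      have hBx : Measurable fun t => B ((t, x), ω) :=
        hB.comp ((measurable_id'.prodMk measurable_const).prodMk measurable_const)
      exact lintegral_const_mul (A (x, ω)) hBx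
    · exact (hF.comp (measurable_id'.prodMk measurable_const)).aemeasurable
  · have hm : Measurable fun q : (T × Ω) × X => A (q.2, q.1.2) * B ((q.1.1, q.2), q.1.2) :=
      hF.comp ((measurable_fst.fst.prodMk measurable_snd).prodMk measurable_fst.snd)
    exact hm.lintegral_prod_right'.aemeasurable

namespace IsMarkedPoisson

variable {P : Measure Ω} {Λ : Measure X} {η : Ω → Config X} {κ : Ω → ℕ∞}
    {ξ : ℕ → Ω → X} {Y : ℝ → ℕ → Ω → Bool}

lemma resample_univ {Ω : Type*} (η : Ω → Config X) (κ : Ω → ℕ∞) (ξ : ℕ → Ω → X) (Y : ℝ → ℕ → Ω → Bool)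
    (t : ℝ) (p : Ω × Ω) : resample η κ ξ Y Set.univ t p
      = thinning κ ξ Y t p.1 + thinning κ ξ Y (1 - t) p.2 := by
  simp [resample]

/-- The integral of the resampled difference operator in terms of `avgDiff`. -/
theorem lintegral_resample_eq_avgDiff [IsProbabilityMeasure P] [SigmaFinite Λ]
    (h : IsMarkedPoisson P Λ η κ ξ Y) {f : Config X → ℝ} (hf : Measurable f)
    {A : X × Config X → ℝ≥0∞} (hA : Measurable A) :
    ∫⁻ t in Set.Icc (0 : ℝ) 1, ∫⁻ x, ∫⁻ p, A (x, η p.1)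
        * ENNReal.ofReal (diffOp f x (resample η κ ξ Y Set.univ t p)) ∂(P.prod P) ∂Λ
      = ∫⁻ ω, ∫⁻ x, A (x, η ω) * avgDiff Λ f κ ξ Y x ω ∂Λ ∂P := by
  have hD : Measurable fun q : ((ℝ × X) × Ω) × Ω => ENNReal.ofReal
      (diffOp f q.1.1.2 (thinning κ ξ Y q.1.1.1 q.1.2 + thinning κ ξ Y (1 - q.1.1.1) q.2)) := by
    have ht : Measurable fun q : ((ℝ × X) × Ω) × Ω => q.1.1.1 := measurable_fst.fst.fst
    have hx : Measurable fun q : ((ℝ × X) × Ω) × Ω => q.1.1.2 := measurable_fst.fst.snd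
    exact ENNReal.measurable_ofReal.comp ((measurable_diffOp hf).comp (hx.prodMk
      (Config.measurable_add (h.measurable_thinning ht measurable_fst.snd)
        (h.measurable_thinning (ht.const_sub 1) measurable_snd))))
  have hAm : Measurable fun q : X × Ω => A (q.1, η q.2) :=
    hA.comp (measurable_fst.prodMk (h.poisson.measurable.comp measurable_snd))
  simp_rw [resample_univ]
  rw [lintegral_mul_eq_lintegral_mul_lintegral (P := P) (Λ := Λ)
    (volume.restrict (Set.Icc (0 : ℝ) 1)) hAm hD]
  refine lintegral_congr fun ω => lintegral_congr fun x => ?_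
  rw [h.avgDiff_eq hf]

/-- The Mecke equation for the reduced integral weighted by a function of the process. -/
theorem lintegral_mul_reducedIntegral [IsProbabilityMeasure P] [SigmaFinite Λ]
    (h : IsMarkedPoisson P Λ η κ ξ Y) {f : Config X → ℝ} (hf : Measurable f) {g : X → ℝ≥0}
    (hg : Measurable g) {w : Config X → ℝ≥0∞} (hw : Measurable w) :
    ∫⁻ ω, ∫⁻ x, w (η ω + point x) * (ENNReal.ofReal (diffOp f x (η ω)) * g x) ∂Λ ∂P
      = ∫⁻ ω, w (η ω) * reducedIntegral η κ ξ f g ω ∂P := by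
  -- In the Mecke equation the configuration is punctured at `x`, so `w` evaluated after adding the
  -- point back is `w(η)` and leaves the sum.
  have hH : Measurable fun q : X × Config X =>
      w (q.2 + point q.1) * (ENNReal.ofReal (diffOp f q.1 q.2) * g q.1) :=
    (hw.comp (Config.measurable_add measurable_snd
      (Config.measurable_point.comp measurable_fst))).mul
      ((ENNReal.measurable_ofReal.comp (measurable_diffOp hf)).mul
        (hg.coe_nnreal_ennreal.comp measurable_fst))
  rw [← h.mecke hH]
  refine lintegral_congr fun ω => ?_
  rw [reducedIntegral, ← ENNReal.tsum_mul_left]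
  refine tsum_congr fun n => ?_
  by_cases hn : (n : ℕ∞) < κ ω
  · simp only [hn, if_true]
    rw [h.ofMeasure_sub_dirac hn, ← h.eq_punctured_add hn]
  · simp [hn]

end IsMarkedPoisson

/-- The covariance of a truncated random variable and its exponential converges. -/
lemma tendsto_covariance_clamp {P : Measure Ω} [IsProbabilityMeasure P] {Z : Ω → ℝ}
    (hZ : Measurable Z) (hZ2 : MemLp Z 2 P) {s : ℝ} (hs : 0 ≤ s)
    (hEs : MemLp (fun ω => Real.exp (s * Z ω)) 2 P) :
    Tendsto (fun n : ℕ => ∫ ω, Real.exp (s * clamp (-n) n (Z ω)) * clamp (-n) n (Z ω) ∂P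
        - (∫ ω, Real.exp (s * clamp (-n) n (Z ω)) ∂P) * ∫ ω, clamp (-n) n (Z ω) ∂P) atTop
      (𝓝 (∫ ω, Real.exp (s * Z ω) * Z ω ∂P - (∫ ω, Real.exp (s * Z ω) ∂P) * ∫ ω, Z ω ∂P)) := by
  have hEint : Integrable (fun ω => Real.exp (s * Z ω)) P := hEs.integrable one_le_two
  have hcl : ∀ n : ℕ, Measurable fun ω => clamp (-n) n (Z ω) := fun n =>
    (measurable_clamp _ _).comp hZ
  have hexpcl : ∀ n : ℕ, Measurable fun ω => Real.exp (s * clamp (-n) n (Z ω)) := fun n =>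
    Real.measurable_exp.comp ((hcl n).const_mul s)
  -- Truncation from below can raise the exponential, but only to `e^{-sn} ≤ 1`, hence the summand
  -- `1`.
  have hle : ∀ (n : ℕ) (z : ℝ), Real.exp (s * clamp (-n) n z) ≤ 1 + Real.exp (s * z) := by
    intro n z
    have h1 : Real.exp (s * -(n : ℝ)) ≤ 1 := by
      rw [Real.exp_le_one_iff, mul_neg]
      exact neg_nonpos.2 (mul_nonneg hs (Nat.cast_nonneg n))
    rw [exp_mul_clamp hs, clamp]
    refine max_le (h1.trans ?_) ((min_le_right _ _).trans ?_)
    · linarith [Real.exp_pos (s * z)]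
    · linarith
  have hdom1 : Integrable (fun ω => 1 + Real.exp (s * Z ω)) P :=
    (integrable_const (1 : ℝ)).add hEint
  have hdom2 : Integrable (fun ω => (1 + Real.exp (s * Z ω)) * |Z ω|) P := by
    have h1 : MemLp (fun ω => 1 + Real.exp (s * Z ω)) 2 P := (memLp_const (1 : ℝ)).add hEs
    exact h1.integrable_mul hZ2.abs
  have hexpt : ∀ z : ℝ, Tendsto (fun n : ℕ => Real.exp (s * clamp (-n) n z)) atTop
      (𝓝 (Real.exp (s * z))) := fun z =>
    (Real.continuous_exp.tendsto _).comp ((tendsto_clamp z).const_mul s)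
  have l1 : Tendsto (fun n : ℕ => ∫ ω, Real.exp (s * clamp (-n) n (Z ω)) * clamp (-n) n (Z ω) ∂P)
      atTop (𝓝 (∫ ω, Real.exp (s * Z ω) * Z ω ∂P)) := tendsto_integral_of_dominated_convergence _
    (fun n : ℕ => ((hexpcl n).mul (hcl n)).aestronglyMeasurable) hdom2
    (fun n => ae_of_all P fun ω => by
      rw [Real.norm_eq_abs, abs_mul, abs_of_pos (Real.exp_pos _)]
      exact mul_le_mul (hle n _) (abs_clamp_le_abs (Nat.cast_nonneg n) _) (abs_nonneg _)
        (by positivity))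
    (ae_of_all P fun ω => (hexpt (Z ω)).mul (tendsto_clamp (Z ω)))
  have l2 : Tendsto (fun n : ℕ => ∫ ω, Real.exp (s * clamp (-n) n (Z ω)) ∂P)
      atTop (𝓝 (∫ ω, Real.exp (s * Z ω) ∂P)) := tendsto_integral_of_dominated_convergence _
    (fun n : ℕ => (hexpcl n).aestronglyMeasurable) hdom1
    (fun n => ae_of_all P fun ω => by
      rw [Real.norm_eq_abs, abs_of_pos (Real.exp_pos _)]
      exact hle n _)
    (ae_of_all P fun ω => hexpt (Z ω))
  have l3 : Tendsto (fun n : ℕ => ∫ ω, clamp (-n) n (Z ω) ∂P)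
      atTop (𝓝 (∫ ω, Z ω ∂P)) := tendsto_integral_of_dominated_convergence _
    (fun n : ℕ => (hcl n).aestronglyMeasurable) (hZ2.integrable one_le_two).abs
    (fun n => ae_of_all P fun ω => abs_clamp_le_abs (Nat.cast_nonneg n) _)
    (ae_of_all P fun ω => tendsto_clamp (Z ω))
  exact l1.sub (l2.mul l3)

namespace IsMarkedPoisson

variable {P : Measure Ω} {Λ : Measure X} {η : Ω → Config X} {κ : Ω → ℕ∞}
    {ξ : ℕ → Ω → X} {Y : ℝ → ℕ → Ω → Bool}

/-- Square integrability of `D e^{sF}` implies that of `D F` for functionals bounded below. -/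
lemma integrable_diffOp_sq [IsProbabilityMeasure P] [SigmaFinite Λ]
    (h : IsMarkedPoisson P Λ η κ ξ Y) {f : Config X → ℝ} (hf : Measurable f)
    (hDF : ∀ᵐ p ∂(P.prod Λ), 0 ≤ diffOp f p.2 (η p.1)) {c : ℝ} (hc : ∀ᵐ ω ∂P, c ≤ f (η ω))
    {s : ℝ} (hs : 0 < s)
    (hD : MemLp (fun p : Ω × X => diffOp (fun μ => Real.exp (s * f μ)) p.2 (η p.1)) 2
      (P.prod Λ)) :
    Integrable (fun q : X × Ω => diffOp f q.1 (η q.2) ^ 2) (Λ.prod P) := by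
  have hm : Measurable fun p : Ω × X => diffOp f p.2 (η p.1) :=
    (measurable_diffOp hf).comp (measurable_snd.prodMk (h.poisson.measurable.comp measurable_fst))
  have hL : MemLp (fun p : Ω × X => diffOp f p.2 (η p.1)) 2 (P.prod Λ) := by
    -- The constant comes from `e^{sy} - e^{sz} ≥ s e^{sz}(y - z) ≥ s e^{sc}(y - z)` for `y ≥ z ≥
    -- c`.
    refine MemLp.of_le_mul (c := (s * Real.exp (s * c))⁻¹) hD hm.aestronglyMeasurable ?_
    filter_upwards [hDF, Measure.quasiMeasurePreserving_fst.ae hc] with p hp hpc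
    have h0 : 0 < s * Real.exp (s * c) := mul_pos hs (Real.exp_pos _)
    rw [Real.norm_eq_abs, Real.norm_eq_abs, abs_of_nonneg hp, inv_mul_eq_div, le_div_iff₀ h0]
    refine le_trans ?_ (le_abs_self _)
    simp only [diffOp] at hp ⊢
    set y := f (η p.1 + point p.2)
    set z := f (η p.1)
    have h1 := Real.add_one_le_exp (s * (y - z))
    have h2 : Real.exp (s * y) = Real.exp (s * z) * Real.exp (s * (y - z)) := by
      rw [← Real.exp_add]; ring_nf
    have h3 : Real.exp (s * c) ≤ Real.exp (s * z) :=
      Real.exp_le_exp.2 (mul_le_mul_of_nonneg_left hpc hs.le)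
    have h4 : 0 ≤ s * (y - z) := mul_nonneg hs.le hp
    rw [h2]
    calc (y - z) * (s * Real.exp (s * c)) = Real.exp (s * c) * (s * (y - z)) := by ring
      _ ≤ Real.exp (s * z) * (s * (y - z)) := mul_le_mul_of_nonneg_right h3 h4
      _ ≤ Real.exp (s * z) * (Real.exp (s * (y - z)) - 1) :=
        mul_le_mul_of_nonneg_left (by linarith) (Real.exp_pos _).le
      _ = _ := by ring
  exact hL.integrable_sq.swap

/-- The Mecke bound on the integral of `D e^{sF}` against the averaged difference operator. -/
lemma lintegral_diffOp_exp_mul_avgDiff_le [IsProbabilityMeasure P] [SigmaFinite Λ]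
    (h : IsMarkedPoisson P Λ η κ ξ Y) {f : Config X → ℝ} (hf : Measurable f)
    (hDF : ∀ᵐ p ∂(P.prod Λ), 0 ≤ diffOp f p.2 (η p.1)) {g : X → ℝ≥0} (hg : Measurable g)
    (havg : ∀ᵐ ω ∂P, ∀ᵐ x ∂Λ, avgDiff Λ f κ ξ Y x ω ≤ (g x : ℝ≥0∞)) {s : ℝ} (hs : 0 ≤ s) :
    ∫⁻ ω, ∫⁻ x, ENNReal.ofReal (diffOp (fun μ => Real.exp (s * f μ)) x (η ω))
        * avgDiff Λ f κ ξ Y x ω ∂Λ ∂P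
      ≤ ∫⁻ ω, ENNReal.ofReal (s * Real.exp (s * f (η ω))) * reducedIntegral η κ ξ f g ω ∂P := by
  have hw : Measurable fun μ : Config X => ENNReal.ofReal (s * Real.exp (s * f μ)) :=
    ENNReal.measurable_ofReal.comp ((Real.measurable_exp.comp (hf.const_mul s)).const_mul s)
  rw [← h.lintegral_mul_reducedIntegral hf hg hw]
  refine lintegral_mono_ae ?_
  filter_upwards [havg, Measure.ae_ae_of_ae_prod hDF] with ω hω hω'
  refine lintegral_mono_ae ?_
  filter_upwards [hω, hω'] with x hx hx'
  rw [← mul_assoc]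
  refine mul_le_mul' ?_ hx
  rw [← ENNReal.ofReal_mul (by positivity)]
  refine ENNReal.ofReal_le_ofReal ((exp_sub_exp_le _ _).trans (le_of_eq ?_))
  simp only [diffOp]
  ring

/-- Covariance bound for the truncated functional. -/
lemma ofReal_covariance_clamp_le [IsProbabilityMeasure P] [SigmaFinite Λ]
    (h : IsMarkedPoisson P Λ η κ ξ Y) {f : Config X → ℝ} (hf : Measurable f)
    (hDF : ∀ᵐ p ∂(P.prod Λ), 0 ≤ diffOp f p.2 (η p.1))
    (hD2 : Integrable (fun q : X × Ω => diffOp f q.1 (η q.2) ^ 2) (Λ.prod P))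
    {s : ℝ} (hs : 0 ≤ s) (n : ℕ) :
    ENNReal.ofReal (∫ ω, Real.exp (s * clamp (-n) n (f (η ω))) * clamp (-n) n (f (η ω)) ∂P
        - (∫ ω, Real.exp (s * clamp (-n) n (f (η ω))) ∂P) * ∫ ω, clamp (-n) n (f (η ω)) ∂P)
      ≤ ∫⁻ ω, ∫⁻ x, ENNReal.ofReal (diffOp (fun μ => Real.exp (s * f μ)) x (η ω))
          * avgDiff Λ f κ ξ Y x ω ∂Λ ∂P := by
  have hn : (0 : ℝ) ≤ n := Nat.cast_nonneg n
  have hφ : Measurable fun μ : Config X => clamp (-n) n (f μ) := (measurable_clamp _ _).comp hf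
  have hγ : Measurable fun μ : Config X => Real.exp (s * clamp (-n) n (f μ)) :=
    Real.measurable_exp.comp (hφ.const_mul s)
  have hle : ∀ μ : Config X, s * clamp (-n) n (f μ) ≤ s * n := fun μ =>
    mul_le_mul_of_nonneg_left ((le_abs_self _).trans (abs_clamp_le hn _)) hs
  have hmD : ∀ {u : Config X → ℝ}, Measurable u →
      Measurable fun q : X × Ω => diffOp u q.1 (η q.2) ^ 2 := fun hu =>
    ((measurable_diffOp hu).comp (measurable_fst.prodMk
      (h.poisson.measurable.comp measurable_snd))).pow_const 2
  have hφD : ∀ x μ, |diffOp (fun μ : Config X => clamp (-n) n (f μ)) x μ| ≤ |diffOp f x μ| :=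
    fun x μ => abs_clamp_sub_le _ _ _ _
  have hγD : ∀ x μ, |diffOp (fun μ : Config X => Real.exp (s * clamp (-n) n (f μ))) x μ|
      ≤ Real.exp (s * n) * s * |diffOp f x μ| := by
    intro x μ
    refine (abs_exp_sub_exp_le (hle _) (hle _)).trans ?_
    rw [← mul_sub, abs_mul, abs_of_nonneg hs, mul_assoc]
    exact mul_le_mul_of_nonneg_left (mul_le_mul_of_nonneg_left (hφD x μ) hs) (Real.exp_pos _).le
  have hγ2 : Integrable (fun q : X × Ω =>
      diffOp (fun μ : Config X => Real.exp (s * clamp (-n) n (f μ))) q.1 (η q.2) ^ 2)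
      (Λ.prod P) := by
    refine (hD2.const_mul ((Real.exp (s * n) * s) ^ 2)).mono' (hmD hγ).aestronglyMeasurable
      (ae_of_all _ fun q => ?_)
    rw [Real.norm_eq_abs, abs_of_nonneg (sq_nonneg _), ← mul_pow, sq_le_sq, abs_mul,
      abs_of_nonneg (mul_nonneg (Real.exp_pos _).le hs)]
    exact hγD _ _
  have hφ2 : Integrable (fun q : X × Ω =>
      diffOp (fun μ : Config X => clamp (-n) n (f μ)) q.1 (η q.2) ^ 2) (Λ.prod P) := by
    refine hD2.mono' (hmD hφ).aestronglyMeasurable (ae_of_all _ fun q => ?_)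
    rw [Real.norm_eq_abs, abs_of_nonneg (sq_nonneg _), sq_le_sq]
    exact hφD _ _
  have hγ0 : ∀ᵐ x ∂Λ, ∀ᵐ ω ∂P,
      0 ≤ diffOp (fun μ : Config X => Real.exp (s * clamp (-n) n (f μ))) x (η ω) := by
    have h1 : ∀ᵐ q ∂(Λ.prod P), 0 ≤ diffOp f q.1 (η q.2) := by
      rw [← Measure.prod_swap] at hDF
      exact ae_of_ae_map measurable_swap.aemeasurable hDF
    filter_upwards [Measure.ae_ae_of_ae_prod h1] with x hx
    filter_upwards [hx] with ω hω
    exact sub_nonneg.2 (Real.exp_le_exp.2 (mul_le_mul_of_nonneg_left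
      (clamp_mono _ _ (sub_nonneg.1 hω)) hs))
  have hkey := h.ofReal_covariance_le hγ hφ (C := max (n : ℝ) (Real.exp (s * n)))
    (fun μ => by
      rw [abs_of_pos (Real.exp_pos _)]
      exact le_max_of_le_right (Real.exp_le_exp.2 (hle μ)))
    (fun μ => le_max_of_le_left (abs_clamp_le hn _)) hγ2 hφ2 hγ0
  have hA : Measurable fun q : X × Config X =>
      ENNReal.ofReal (diffOp (fun μ => Real.exp (s * f μ)) q.1 q.2) :=
    ENNReal.measurable_ofReal.comp (measurable_diffOp (Real.measurable_exp.comp (hf.const_mul s)))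
  -- The truncations are removed from both differences; the expectation over the independent copy
  -- and the integral over `t` then form `avgDiff`.
  refine hkey.trans ?_
  rw [← h.lintegral_resample_eq_avgDiff hf hA]
  refine lintegral_mono fun t => lintegral_mono fun x => lintegral_mono fun p => ?_
  refine mul_le_mul' ?_ (ofReal_clamp_sub_le _ _ _ _)
  simp only [diffOp, exp_mul_clamp hs]
  exact ofReal_clamp_sub_le _ _ _ _

/-- The differential inequality for the moment generating function, in integrated form. -/
theorem integral_mul_exp_le [IsProbabilityMeasure P] [SigmaFinite Λ]
    (h : IsMarkedPoisson P Λ η κ ξ Y) {f : Config X → ℝ} (hf : Measurable f)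
    (hF2 : MemLp (fun ω => f (η ω)) 2 P)
    (hDF : ∀ᵐ p ∂(P.prod Λ), 0 ≤ diffOp f p.2 (η p.1)) {g : X → ℝ≥0} (hg : Measurable g)
    {a b : ℝ} (ha : 0 < a)
    (havg : ∀ᵐ ω ∂P, ∀ᵐ x ∂Λ, avgDiff Λ f κ ξ Y x ω ≤ (g x : ℝ≥0∞))
    (hred : ∀ᵐ ω ∂P,
      (reducedIntegral η κ ξ f g ω : EReal) ≤ ((a * f (η ω) + b : ℝ) : EReal))
    {s s₀ : ℝ} (hs₀ : 0 < s₀) (hs : 0 ≤ s) (hss₀ : s ≤ s₀)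
    (hE : MemLp (fun ω => Real.exp (s₀ * f (η ω))) 2 P)
    (hD : MemLp (fun p : Ω × X => diffOp (fun μ => Real.exp (s₀ * f μ)) p.2 (η p.1)) 2
      (P.prod Λ)) :
    ∫ ω, Real.exp (s * f (η ω)) * f (η ω) ∂P
        - (∫ ω, Real.exp (s * f (η ω)) ∂P) * ∫ ω, f (η ω) ∂P
      ≤ s * ∫ ω, Real.exp (s * f (η ω)) * (a * f (η ω) + b) ∂P := by
  have hfη : Measurable fun ω => f (η ω) := hf.comp h.poisson.measurable
  have hexp : Measurable fun ω => Real.exp (s * f (η ω)) :=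
    Real.measurable_exp.comp (hfη.const_mul s)
  have hred' : ∀ᵐ ω ∂P, 0 ≤ a * f (η ω) + b
      ∧ reducedIntegral η κ ξ f g ω ≤ ENNReal.ofReal (a * f (η ω) + b) :=
    hred.mono fun ω hω => le_ofReal_of_coe_le hω
  have hc : ∀ᵐ ω ∂P, -b / a ≤ f (η ω) := hred'.mono fun ω hω => by
    rw [div_le_iff₀ ha]; linarith [hω.1]
  have hE2 : MemLp (fun ω => 1 + Real.exp (s₀ * f (η ω))) 2 P := (memLp_const (1 : ℝ)).add hE
  have hEs : MemLp (fun ω => Real.exp (s * f (η ω))) 2 P := by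
    refine hE2.mono hexp.aestronglyMeasurable (ae_of_all _ fun ω => ?_)
    rw [Real.norm_eq_abs, Real.norm_eq_abs, abs_of_pos (Real.exp_pos _),
      abs_of_pos (by positivity)]
    exact exp_mul_le_one_add hs hss₀
  have hRint : Integrable (fun ω => Real.exp (s * f (η ω)) * (a * f (η ω) + b)) P := by
    have h1 : MemLp (fun ω => a * f (η ω) + b) 2 P := (hF2.const_mul a).add (memLp_const b)
    exact hEs.integrable_mul h1
  have hD2 := h.integrable_diffOp_sq hf hDF hc hs₀ hD
  have hR0 : 0 ≤ᵐ[P] fun ω => s * (Real.exp (s * f (η ω)) * (a * f (η ω) + b)) :=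
    hred'.mono fun ω hω => mul_nonneg hs (mul_nonneg (Real.exp_pos _).le hω.1)
  have hbound : ∀ n : ℕ,
      ∫ ω, Real.exp (s * clamp (-n) n (f (η ω))) * clamp (-n) n (f (η ω)) ∂P
        - (∫ ω, Real.exp (s * clamp (-n) n (f (η ω))) ∂P) * ∫ ω, clamp (-n) n (f (η ω)) ∂P
      ≤ s * ∫ ω, Real.exp (s * f (η ω)) * (a * f (η ω) + b) ∂P := by
    intro n
    rw [← integral_const_mul s]
    -- The right side is nonnegative, so the comparison may be made in `[0, ∞]`.
    refine (ENNReal.ofReal_le_ofReal_iff (integral_nonneg_of_ae hR0)).1 ?_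
    refine (h.ofReal_covariance_clamp_le hf hDF hD2 hs n).trans
      ((h.lintegral_diffOp_exp_mul_avgDiff_le hf hDF hg havg hs).trans ?_)
    rw [ofReal_integral_eq_lintegral_ofReal (hRint.const_mul s) hR0]
    refine lintegral_mono_ae ?_
    filter_upwards [hred'] with ω hω
    rw [← mul_assoc, ENNReal.ofReal_mul (mul_nonneg hs (Real.exp_pos _).le)]
    exact mul_le_mul' le_rfl hω.2
  exact le_of_tendsto' (tendsto_covariance_clamp hfη hF2 hs hEs) hbound

end IsMarkedPoisson

/-! ### From the differential inequality to the tail -/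

/-- A lower bounded random variable has finite exponential moments below a finite one. -/
lemma mem_integrableExpSet_of_le {P : Measure Ω} [IsProbabilityMeasure P] {Z : Ω → ℝ}
    (hZ : Measurable Z) {c : ℝ} (hc : ∀ᵐ ω ∂P, c ≤ Z ω) {s₀ : ℝ}
    (hE : Integrable (fun ω => Real.exp (s₀ * Z ω)) P) {t : ℝ} (ht : t ≤ s₀) :
    t ∈ integrableExpSet Z P := by
  have hm : Measurable fun ω => Real.exp (t * Z ω) :=
    Real.measurable_exp.comp (hZ.const_mul t)
  have hd : Integrable (fun ω => (1 + Real.exp (t * c)) + Real.exp (s₀ * Z ω)) P :=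
    (integrable_const (1 + Real.exp (t * c))).add hE
  refine hd.mono' hm.aestronglyMeasurable ?_
  filter_upwards [hc] with ω hω
  rw [Real.norm_eq_abs, abs_of_pos (Real.exp_pos _)]
  rcases le_total 0 t with h0 | h0
  · linarith [exp_mul_le_one_add (y := Z ω) h0 ht, Real.exp_pos (t * c)]
  · have := Real.exp_le_exp.2 (mul_le_mul_of_nonpos_left hω h0)
    linarith [Real.exp_pos (s₀ * Z ω)]

/-- The cumulant bound obtained by integrating the differential inequality for the moment
generating function. -/
lemma cgf_le_of_integral_mul_exp_le {P : Measure Ω} [IsProbabilityMeasure P] {Z : Ω → ℝ}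
    (hZ : Measurable Z) {a b c s₀ : ℝ} (ha : 0 < a) (hc : ∀ᵐ ω ∂P, c ≤ Z ω)
    (hE : Integrable (fun ω => Real.exp (s₀ * Z ω)) P)
    (hineq : ∀ s, 0 ≤ s → s ≤ s₀ → ∫ ω, Real.exp (s * Z ω) * Z ω ∂P
        - (∫ ω, Real.exp (s * Z ω) ∂P) * ∫ ω, Z ω ∂P
      ≤ s * ∫ ω, Real.exp (s * Z ω) * (a * Z ω + b) ∂P)
    {s : ℝ} (hs : 0 ≤ s) (hss₀ : s < s₀) (hsa : s < a⁻¹) :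
    cgf Z P s ≤ -(b * s / a) - ((∫ ω, Z ω ∂P) / a + b / a ^ 2) * Real.log (1 - a * s) := by
  set m := ∫ ω, Z ω ∂P with hm
  -- `ψ` is the antiderivative of `(m + bu)/(1 - au)` with `ψ 0 = 0`.
  set ψ : ℝ → ℝ := fun u => -(b * u / a) - (m / a + b / a ^ 2) * Real.log (1 - a * u) with hψ
  -- Negative `u` are admissible because `Z` is bounded below, so `0` is an interior point and `cgf`
  -- is differentiable there.
  have hint : ∀ u, u < s₀ → u ∈ interior (integrableExpSet Z P) := fun u hu =>
    interior_maximal (fun t (ht : t < s₀) => mem_integrableExpSet_of_le hZ hc hE ht.le)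
      isOpen_Iio hu
  have hI : ∀ u, u < s₀ → Integrable (fun ω => Real.exp (u * Z ω)) P := fun u hu =>
    mem_integrableExpSet_of_le hZ hc hE hu.le
  have hpos : ∀ u, u < a⁻¹ → 0 < 1 - a * u := by
    intro u hu
    have := mul_lt_mul_of_pos_left hu ha
    rw [mul_inv_cancel₀ ha.ne'] at this
    linarith
  have hψd : ∀ u, u < a⁻¹ → HasDerivAt ψ ((m + b * u) / (1 - a * u)) u := by
    intro u hu
    have h1 : HasDerivAt (fun u : ℝ => 1 - a * u) (-a) u := by
      simpa using ((hasDerivAt_id u).const_mul a).const_sub 1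
    have h2 : HasDerivAt (fun u : ℝ => -(b * u / a)) (-(b / a)) u := by
      simpa using (((hasDerivAt_id u).const_mul b).div_const a).fun_neg
    have h0 := hpos u hu
    refine (h2.fun_sub ((h1.log h0.ne').const_mul (m / a + b / a ^ 2))).congr_deriv ?_
    have := h0.ne'
    field_simp
    ring
  have hMd : ∀ u, u < s₀ → HasDerivAt (cgf Z P)
      ((∫ ω, Z ω * Real.exp (u * Z ω) ∂P) / mgf Z P u) u := fun u hu =>
    (hasDerivAt_mgf (hint u hu)).log (mgf_pos (hI u hu)).ne'
  -- The integrated inequality reads `(1 - au) M' ≤ (m + bu) M`; division by `1 - au` is where `u <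
  -- 1/a` enters.
  have hle : ∀ u, 0 ≤ u → u < s₀ → u < a⁻¹ →
      (∫ ω, Z ω * Real.exp (u * Z ω) ∂P) / mgf Z P u ≤ (m + b * u) / (1 - a * u) := by
    intro u hu hus hua
    have hI0 := hI u hus
    have hI1 : Integrable (fun ω => Z ω * Real.exp (u * Z ω)) P := by
      simpa using integrable_pow_mul_exp_of_mem_interior_integrableExpSet (hint u hus) 1
    have h1 := hineq u hu hus.le
    have h2 : ∫ ω, Real.exp (u * Z ω) * (a * Z ω + b) ∂P
        = a * (∫ ω, Z ω * Real.exp (u * Z ω) ∂P) + b * mgf Z P u := by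
      rw [mgf, ← integral_const_mul a, ← integral_const_mul b,
        ← integral_add (hI1.const_mul a) (hI0.const_mul b)]
      refine integral_congr_ae (ae_of_all _ fun ω => ?_)
      ring
    have h3 : ∫ ω, Real.exp (u * Z ω) * Z ω ∂P = ∫ ω, Z ω * Real.exp (u * Z ω) ∂P :=
      integral_congr_ae (ae_of_all _ fun ω => mul_comm _ _)
    have h4 : ∫ ω, Real.exp (u * Z ω) ∂P = mgf Z P u := rfl
    rw [h2, h3, h4] at h1
    rw [div_le_div_iff₀ (mgf_pos hI0) (hpos u hua)]
    linarith
  have hd : ∀ u ∈ Set.Icc 0 s, HasDerivAt (fun u => cgf Z P u - ψ u)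
      ((∫ ω, Z ω * Real.exp (u * Z ω) ∂P) / mgf Z P u - (m + b * u) / (1 - a * u)) u :=
    fun u hu => (hMd u (hu.2.trans_lt hss₀)).sub (hψd u (hu.2.trans_lt hsa))
  have hanti : AntitoneOn (fun u => cgf Z P u - ψ u) (Set.Icc 0 s) := by
    refine antitoneOn_of_deriv_nonpos (convex_Icc 0 s)
      (fun u hu => (hd u hu).continuousAt.continuousWithinAt)
      (fun u hu => (hd u (interior_subset hu)).differentiableAt.differentiableWithinAt)
      (fun u hu => ?_)
    have hu' := interior_subset hu
    rw [(hd u hu').deriv]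
    exact sub_nonpos.2 (hle u hu'.1 (hu'.2.trans_lt hss₀) (hu'.2.trans_lt hsa))
  have h0 := hanti (Set.left_mem_Icc.2 hs) (Set.right_mem_Icc.2 hs) hs
  simp only [cgf_zero, hψ, mul_zero, zero_div, neg_zero, sub_zero, Real.log_one] at h0
  linarith

/-- The Chernoff bound for a centred random variable. -/
lemma measure_sub_integral_ge_le {P : Measure Ω} [IsProbabilityMeasure P] {Z : Ω → ℝ} {s K : ℝ}
    (hs : 0 ≤ s) (hE : Integrable (fun ω => Real.exp (s * Z ω)) P) (hK : cgf Z P s ≤ K) (r : ℝ) :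
    P {ω | r ≤ Z ω - ∫ ω', Z ω' ∂P}
      ≤ ENNReal.ofReal (Real.exp (K - s * (∫ ω', Z ω' ∂P) - s * r)) := by
  have hset : {ω | r ≤ Z ω - ∫ ω', Z ω' ∂P} = {ω | (∫ ω', Z ω' ∂P) + r ≤ Z ω} := by
    ext ω
    simp only [Set.mem_ofPred_eq]
    constructor <;> intro h <;> linarith
  rw [hset, ← ofReal_measureReal]
  refine ENNReal.ofReal_le_ofReal
    ((measure_ge_le_exp_cgf _ hs hE).trans (Real.exp_le_exp.2 ?_))
  linarith

lemma IsPoissonProcess.congr {P : Measure Ω} {Λ : Measure X} {η η' : Ω → Config X}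
    (hη : IsPoissonProcess P η Λ) (hm : Measurable η') (he : η' =ᵐ[P] η) :
    IsPoissonProcess P η' Λ where
  measurable := hm
  law_of_ne_top B hB hΛ := by
    rw [← hη.law_of_ne_top B hB hΛ]
    exact Measure.map_congr (he.mono fun ω hω => by simp only [hω])
  law_of_eq_top B hB hΛ := by
    filter_upwards [hη.law_of_eq_top B hB hΛ, he] with ω h1 h2
    rw [h2, h1]
  indep m B hB hd := (hη.indep m B hB hd).congr
    fun i => he.symm.mono fun ω hω => by simp only [hω]

lemma IsThinningMarks.congr {P : Measure Ω} {κ κ' : Ω → ℕ∞} {ξ : ℕ → Ω → X}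
    {Y : ℝ → ℕ → Ω → Bool} (hY : IsThinningMarks P κ ξ Y) (he : κ' =ᵐ[P] κ) :
    IsThinningMarks P κ' ξ Y where
  measurable := hY.measurable
  law := hY.law
  indep := hY.indep
  indep_points t ht := (hY.indep_points t ht).congr (EventuallyEq.refl _ _)
    (he.symm.mono fun ω hω => by simp only [hω])

/-- A proper Poisson process and its number of points can be modified on a null set so that the
representation as a sum of unit masses holds everywhere. -/
lemma exists_isMarkedPoisson {P : Measure Ω} {Λ : Measure X} {η : Ω → Config X} {κ : Ω → ℕ∞}
    {ξ : ℕ → Ω → X} {Y : ℝ → ℕ → Ω → Bool} (hη : IsPoissonProcess P η Λ)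
    (hξ : IsProperRep P η κ ξ) (hY : IsThinningMarks P κ ξ Y) :
    ∃ (η' : Ω → Config X) (κ' : Ω → ℕ∞), IsMarkedPoisson P Λ η' κ' ξ Y
      ∧ η' =ᵐ[P] η ∧ κ' =ᵐ[P] κ := by
  classical
  -- On a measurable null set containing all failures the process is made empty and `κ` is set to
  -- `0`, so the representation holds there as an empty sum.
  set N := toMeasurable P
    {ω | ¬ (η ω).toMeasure = pointSum (κ ω) (fun n => ξ n ω) (fun _ => true)} with hN
  have hNm : MeasurableSet N := measurableSet_toMeasurable _ _
  have hN0 : ∀ᵐ ω ∂P, ω ∉ N := by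
    rw [← measure_eq_zero_iff_ae_notMem, hN, measure_toMeasurable]
    exact hξ.eq_sum
  have h1 : (fun ω => if ω ∈ N then 0 else η ω) =ᵐ[P] η := hN0.mono fun ω hω => if_neg hω
  have h2 : (fun ω => if ω ∈ N then 0 else κ ω) =ᵐ[P] κ := hN0.mono fun ω hω => if_neg hω
  refine ⟨fun ω => if ω ∈ N then 0 else η ω, fun ω => if ω ∈ N then 0 else κ ω, ⟨hη.congr (Measurable.ite hNm measurable_const hη.measurable) h1,
    Measurable.ite hNm measurable_const hξ.measurable_card, hξ.measurable_point, fun ω => ?_,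
    hY.congr h2⟩, h1, h2⟩
  by_cases hω : ω ∈ N
  · simp only [hω, if_true]
    simp [pointSum, toMeasure_zero]
  · simp only [hω, if_false]
    by_contra hne
    exact hω (subset_toMeasurable _ _ hne)

/-- The exponential is an order isomorphism from `EReal` onto `[0, ∞]`, so it respects infima; for
an empty index type the bound is `∞`. -/
lemma le_exp_iInf {ι : Sort*} {x : ℝ≥0∞} {u : ι → EReal} (h : ∀ i, x ≤ EReal.exp (u i)) :
    x ≤ EReal.exp (⨅ i, u i) := by
  rw [← ENNReal.log_le_log_iff, EReal.log_exp]
  refine le_iInf fun i => ?_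
  rw [← EReal.log_exp (u i)]
  exact ENNReal.log_le_log_iff.2 (h i)

/-- The exponent of the concentration bound at its minimiser. -/
lemma exponent_at_minimiser {a b m r : ℝ} (ha : 0 < a) (hq : 0 < m + b / a) (hr : 0 < r) :
    -(b * (r / (a * (r + m + b / a))) / a)
        - (m / a + b / a ^ 2) * Real.log (1 - a * (r / (a * (r + m + b / a))))
        - r / (a * (r + m + b / a)) * m - r / (a * (r + m + b / a)) * r
      = -(1 / a) * (r + (m + b / a) * Real.log ((m + b / a) / (r + m + b / a))) := by
  -- With `q = m + b/a` the exponent is `-s(q + r) - (q/a) log(1 - as)`. Its derivative vanishes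
  -- when `1 - as = q/(r + q)`, which is the chosen `s`.
  obtain ⟨q, rfl⟩ : ∃ q, b = a * (q - m) := ⟨m + b / a, by field_simp; ring⟩
  have hq' : m + a * (q - m) / a = q := by field_simp; ring
  have hR : r + m + a * (q - m) / a = r + q := by rw [add_assoc, hq']
  rw [hq'] at hq ⊢
  rw [hR]
  have h0 : r + q ≠ 0 := (add_pos hr hq).ne'
  have h1 : 1 - a * (r / (a * (r + q))) = q / (r + q) := by field_simp; ring
  rw [h1]
  field_simp
  ring

/-- The tail bound for a single exponent. -/
theorem IsMarkedPoisson.measure_le_ofReal_exp {P : Measure Ω} [IsProbabilityMeasure P]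
    {Λ : Measure X} [SigmaFinite Λ] {η : Ω → Config X} {κ : Ω → ℕ∞} {ξ : ℕ → Ω → X}
    {Y : ℝ → ℕ → Ω → Bool} (h : IsMarkedPoisson P Λ η κ ξ Y) {f : Config X → ℝ}
    (hf : Measurable f) (hF2 : MemLp (fun ω => f (η ω)) 2 P)
    (hDF : ∀ᵐ p ∂(P.prod Λ), 0 ≤ diffOp f p.2 (η p.1)) {g : X → ℝ≥0} (hg : Measurable g)
    {a b : ℝ} (ha : 0 < a)
    (havg : ∀ᵐ ω ∂P, ∀ᵐ x ∂Λ, avgDiff Λ f κ ξ Y x ω ≤ (g x : ℝ≥0∞))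
    (hred : ∀ᵐ ω ∂P,
      (reducedIntegral η κ ξ f g ω : EReal) ≤ ((a * f (η ω) + b : ℝ) : EReal))
    {s : ℝ} (hs : 0 < s) (hsa : s < a⁻¹) (hsF : ENNReal.ofReal s < sCrit P Λ η f) (r : ℝ) :
    P {ω | r ≤ f (η ω) - ∫ ω', f (η ω') ∂P} ≤ ENNReal.ofReal (Real.exp (-(b * s / a)
      - ((∫ ω', f (η ω') ∂P) / a + b / a ^ 2) * Real.log (1 - a * s)
      - s * (∫ ω', f (η ω') ∂P) - s * r)) := by
  -- A single admissible `s₀ > s` suffices: its integrability conditions control all exponents in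
  -- `[0, s₀]`.
  obtain ⟨_, ⟨s₀, rfl, hE, hD⟩, hlt⟩ := lt_sSup_iff.1 hsF
  have hlt' : s < s₀ := by
    rwa [← ENNReal.ofReal_coe_nnreal, ENNReal.ofReal_lt_ofReal_iff_of_nonneg hs.le] at hlt
  have hfη : Measurable fun ω => f (η ω) := hf.comp h.poisson.measurable
  have hc : ∀ᵐ ω ∂P, -b / a ≤ f (η ω) := hred.mono fun ω hω => by
    rw [div_le_iff₀ ha]; linarith [(le_ofReal_of_coe_le hω).1]
  have hEi : Integrable (fun ω => Real.exp (s₀ * f (η ω))) P := hE.integrable one_le_two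
  refine measure_sub_integral_ge_le hs.le (mem_integrableExpSet_of_le hfη hc hEi hlt'.le)
    (cgf_le_of_integral_mul_exp_le hfη ha hc hEi (fun u hu hus => ?_) hs.le hlt' hsa) r
  exact h.integral_mul_exp_le hf hF2 hDF hg ha havg hred (hs.trans hlt') hu hus hE hD

end PoissonConcentration

end

/-! ### The concentration bounds -/

theorem mainTheorem3 {Ω X : Type*} [MeasurableSpace Ω] [MeasurableSpace X]
    (P : Measure Ω) [IsProbabilityMeasure P] (Λ : Measure X) [SigmaFinite Λ]
    (η : Ω → PoissonConcentration.Config X)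
    (hη : PoissonConcentration.IsPoissonProcess P η Λ)
    (κ : Ω → ℕ∞) (ξ : ℕ → Ω → X)
    (hξ : PoissonConcentration.IsProperRep P η κ ξ)
    (Y : ℝ → ℕ → Ω → Bool)
    (hY : PoissonConcentration.IsThinningMarks P κ ξ Y)
    (f : PoissonConcentration.Config X → ℝ) (hf : Measurable f)
    (F : Ω → ℝ) (hF : F =ᵐ[P] fun ω => f (η ω)) (hF2 : MemLp F 2 P)
    (hDF : ∀ᵐ p ∂(P.prod Λ), 0 ≤ PoissonConcentration.diffOp f p.2 (η p.1))
    (g : X → ℝ≥0) (hg : Measurable g) (a b : ℝ) (ha : 0 < a) (hb : 0 ≤ b)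
    (havg : ∀ᵐ ω ∂P, ∀ᵐ x ∂Λ,
      PoissonConcentration.avgDiff Λ f κ ξ Y x ω ≤ (g x : ℝ≥0∞))
    (hred : ∀ᵐ ω ∂P,
      (PoissonConcentration.reducedIntegral η κ ξ f g ω : EReal) ≤ ((a * F ω + b : ℝ) : EReal)) :
    (∀ r : ℝ, 0 ≤ r →
      P {ω | r ≤ F ω - ∫ ω', F ω' ∂P} ≤
        EReal.exp (⨅ (s : ℝ) (_ : 0 < s ∧ s < a⁻¹ ∧
            ENNReal.ofReal s < PoissonConcentration.sCrit P Λ η f),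
          ((-(b * s / a) - s * (∫ ω', F ω' ∂P)
            - ((∫ ω', F ω' ∂P) / a + b / a ^ 2) * Real.log (1 - a * s) - s * r : ℝ) : EReal))) ∧
    (ENNReal.ofReal a⁻¹ ≤ PoissonConcentration.sCrit P Λ η f →
      ∀ r : ℝ, 0 ≤ r →
        P {ω | r ≤ F ω - ∫ ω', F ω' ∂P} ≤
          ENNReal.ofReal (Real.exp (-(1 / a) * (r + ((∫ ω', F ω' ∂P) + b / a) *
            Real.log (((∫ ω', F ω' ∂P) + b / a) / (r + (∫ ω', F ω' ∂P) + b / a)))))) := by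
  obtain ⟨η', κ', h, hη', hκ'⟩ := PoissonConcentration.exists_isMarkedPoisson hη hξ hY
  have hFη' : F =ᵐ[P] fun ω => f (η' ω) := by
    filter_upwards [hF, hη'] with ω h1 h2
    rw [h1, h2]
  have hprod : ∀ᵐ p ∂(P.prod Λ), η' p.1 = η p.1 := Measure.quasiMeasurePreserving_fst.ae hη'
  have hm : ∫ ω, F ω ∂P = ∫ ω, f (η' ω) ∂P := integral_congr_ae hFη'
  have hset : ∀ r : ℝ, P {ω | r ≤ F ω - ∫ ω', F ω' ∂P}
      = P {ω | r ≤ f (η' ω) - ∫ ω', f (η' ω') ∂P} := by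
    intro r
    refine measure_congr (hFη'.mono fun ω hω => ?_)
    change (r ≤ F ω - _) = (r ≤ f (η' ω) - _)
    rw [hω, hm]
  have hcrit : PoissonConcentration.sCrit P Λ η' f = PoissonConcentration.sCrit P Λ η f := by
    refine congrArg sSup (Set.ext fun S => exists_congr fun s => and_congr_right fun _ => ?_)
    refine and_congr (memLp_congr_ae (hη'.mono fun ω hω => ?_))
      (memLp_congr_ae (hprod.mono fun p hp => ?_))
    · simp only [hω]
    · simp only [hp]
  have hDF' : ∀ᵐ p ∂(P.prod Λ), 0 ≤ PoissonConcentration.diffOp f p.2 (η' p.1) := by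
    filter_upwards [hDF, hprod] with p h1 h2
    rwa [h2]
  have havg' : ∀ᵐ ω ∂P, ∀ᵐ x ∂Λ,
      PoissonConcentration.avgDiff Λ f κ' ξ Y x ω ≤ (g x : ℝ≥0∞) := by
    filter_upwards [havg, hκ'] with ω h1 h2
    simpa only [PoissonConcentration.avgDiff, PoissonConcentration.thinning, h2] using h1
  have hred' : ∀ᵐ ω ∂P, (PoissonConcentration.reducedIntegral η' κ' ξ f g ω : EReal)
      ≤ ((a * f (η' ω) + b : ℝ) : EReal) := by
    filter_upwards [hred, hη', hκ', hFη'] with ω h1 h2 h3 h4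
    rw [← h4]
    simpa only [PoissonConcentration.reducedIntegral, h2, h3] using h1
  have hbound : ∀ s r : ℝ, 0 < s → s < a⁻¹ →
      ENNReal.ofReal s < PoissonConcentration.sCrit P Λ η f →
      P {ω | r ≤ F ω - ∫ ω', F ω' ∂P} ≤ ENNReal.ofReal (Real.exp (-(b * s / a)
        - ((∫ ω', F ω' ∂P) / a + b / a ^ 2) * Real.log (1 - a * s)
        - s * (∫ ω', F ω' ∂P) - s * r)) := by
    intro s r hs hsa hsF
    rw [hset, hm]
    exact h.measure_le_ofReal_exp hf ((memLp_congr_ae hFη').1 hF2) hDF' hg ha havg' hred' hs hsa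
      (hcrit ▸ hsF) r
  refine ⟨fun r _ => ?_, fun hcr r hr => ?_⟩
  · refine PoissonConcentration.le_exp_iInf fun s =>
      PoissonConcentration.le_exp_iInf fun hs => (hbound s r hs.1 hs.2.1 hs.2.2).trans ?_
    rw [EReal.exp_coe]
    exact ENNReal.ofReal_le_ofReal (Real.exp_le_exp.2 (by linarith))
  have hFi : Integrable F P := hF2.integrable one_le_two
  have hnn : 0 ≤ᵐ[P] fun ω => a * F ω + b :=
    hred.mono fun ω hω => (PoissonConcentration.le_ofReal_of_coe_le hω).1
  have hi : Integrable (fun ω => a * F ω + b) P := (hFi.const_mul a).add (integrable_const b)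
  have hint : ∫ ω, (a * F ω + b) ∂P = a * ((∫ ω, F ω ∂P) + b / a) := by
    rw [integral_add (hFi.const_mul a) (integrable_const b), integral_const_mul]
    simp
    field_simp
  -- The expectation of `aF + b ≥ 0` is `a` times this quantity.
  have hq : 0 ≤ (∫ ω, F ω ∂P) + b / a := by
    have := integral_nonneg_of_ae hnn
    rw [hint] at this
    exact nonneg_of_mul_nonneg_right this ha
  -- For `r = 0` the minimiser would be `s = 0`, which is not admissible, but the claimed bound
  -- equals `1`.
  rcases hr.eq_or_lt with rfl | hr0
  · refine prob_le_one.trans (le_of_eq ?_)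
    rcases hq.eq_or_lt with hq0 | hq0
    · simp [← hq0]
    · simp [div_self hq0.ne']
  rcases hq.eq_or_lt with hq0 | hq0
  -- A nonnegative variable with mean zero vanishes, so `F` is almost surely constant and exceeds
  -- its mean by `r > 0` with probability zero.
  · have hz : (fun ω => a * F ω + b) =ᵐ[P] 0 :=
      (integral_eq_zero_iff_of_nonneg_ae hnn hi).1 (by rw [hint, ← hq0, mul_zero])
    refine le_of_eq_of_le ?_ zero_le
    refine measure_eq_zero_iff_ae_notMem.2 (hz.mono fun ω hω hmem => ?_)
    have h1 : r ≤ F ω - ∫ ω', F ω' ∂P := hmem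
    have h2 : a * F ω + b = 0 := hω
    have h3 : F ω + b / a = 0 := by field_simp; linarith
    linarith
  · have hR : 0 < r + (∫ ω, F ω ∂P) + b / a := by linarith
    -- Positivity of `E F + b/a` makes the minimiser strictly smaller than `1/a`, hence also than
    -- `s_F`.
    have hs : r / (a * (r + (∫ ω, F ω ∂P) + b / a)) < a⁻¹ := by
      rw [div_lt_iff₀ (mul_pos ha hR), inv_mul_cancel_left₀ ha.ne']
      linarith
    have hs0 : 0 < r / (a * (r + (∫ ω, F ω ∂P) + b / a)) := div_pos hr0 (mul_pos ha hR)
    have := hbound _ r hs0 hs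
      (((ENNReal.ofReal_lt_ofReal_iff (inv_pos.2 ha)).2 hs).trans_le hcr)
    rwa [PoissonConcentration.exponent_at_minimiser ha hq0 hr0] at this
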